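/- **Model.** In the (deterministic) Massively Parallel Computation model, $M$ machines with $S$ words of memory each communicate in synchronous rounds; a word has $O(\log n)$ bits. In each round every machine performs an unbounded local computation on its memory, keeps part of the result, and sends messages of total size at most $S$ words to other machines; what a machine keeps together with what it receives must never exceed $S$ words. The total space is $M\cdot S$. The edges of the input graph $G$ on the vertex set $\{0,\dots,n-1\}$ are initially distributed arbitrarily over the machines, each edge on exactly one machine, so that the input of each machine fits into its memory (two words per edge); the machines are required to be large and numerous enough for such a distribution to exist. At the end a designated machine computes the output from its memory. The program depends on $n$ and on a given bound $\alpha$ on the arboricity, but not on $G$ otherwise. The arboricity of $G$ is the least number of forests into which the edges of $G$ can be partitioned. **Theorem.** Let $k\ge 0$ be a fixed integer, let $0<\delta<1$, and suppose that $1\le\alpha=O(n^{\delta'/2})$ for some $\delta'<\delta$. Then the $k$-cliques of every $n$-vertex graph of arboricity at most $\alpha$ can be counted exactly in $O_\delta(\log\log n)$ rounds, with $O(n\alpha^2)$ total space, on machines with $O(n^\delta)$ space. Precisely: for every $k$ and every $\delta\in(0,1)$ there is a constant $C=C(k,\delta)$ such that for all real $\delta'<\delta$ and $B$ there is an $n_0$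 such that for all integers $n\ge n_0$ and $\alpha\ge 1$ with $\alpha\le B\,n^{\delta'/2}$ there are integers $M,S,R$ with $$S\le C\,n^{\delta},\qquad M\cdot S\le C\,n\alpha^2,\qquad R\le C\log\log n,$$ and a program for $M$ machines with $S$ words of memory each, all words being non-negative integers smaller than $n^{C}$, which, for every graph $G$ on $n$ vertices of arboricity at most $\alpha$ and every admissible initial distribution of its edges, outputs after $R$ rounds exactly the number of $k$-cliques of $G$. -/

import Mathlib

/-- The graph `G` is the edge-disjoint union of `a` forests. -/
def SimpleGraph.IsUnionOfForests {V : Type*} (G : SimpleGraph V) (a : ℕ) : Prop :=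
  ∃ F : Fin a → SimpleGraph V,
    (∀ i, (F i).IsAcyclic) ∧ Pairwise (fun i j => Disjoint (F i) (F j)) ∧ (⨆ i, F i) = G

/-- The arboricity: the least number of forests into which the edges can be partitioned
(on a finite vertex set such a number always exists). -/
noncomputable def SimpleGraph.arboricity {V : Type*} (G : SimpleGraph V) : ℕ :=
  sInf {a | G.IsUnionOfForests a}

/-- The number of `k`-cliques: `k`-element sets of pairwise adjacent vertices. -/
noncomputable def SimpleGraph.numCliques {V : Type*} (G : SimpleGraph V) (k : ℕ) : ℕ :=
  {s : Finset V | G.IsNClique k s}.ncard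

namespace MPC

/-- A (deterministic) program for `M` machines of the Massively Parallel Computation model.
The memory of a machine is a list of words, a word being a natural number. In round `t` machine
`i` applies the function `step t i` to its memory; local computation is unbounded, so this is an
arbitrary function. It returns the words that the machine keeps, and the one-word messages that
it sends, each with its destination. At the end the machine `outputMachine` computes the output
from its own memory. -/
structure Program (M : ℕ) where
  step : ℕ → Fin M → List ℕ → List ℕ × List (Fin M × ℕ)
  outputMachine : Fin M
  output : List ℕ → ℕ

namespace Program

variable {M : ℕ}

/-- The words that machine `j` receives, listed by sender, when the machines hold `mem` at the
start of round `t`. -/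
def received (P : Program M) (t : ℕ) (mem : Fin M → List ℕ) (j : Fin M) : List ℕ :=
  (List.finRange M).flatMap fun i =>
    ((P.step t i (mem i)).2.filter fun msg => msg.1 = j).map Prod.snd

/-- The memories of the machines after `t` rounds: what a machine has kept, followed by what it
has received. -/
def memory (P : Program M) (init : Fin M → List ℕ) : ℕ → Fin M → List ℕ
  | 0 => init
  | t + 1 => fun j =>
      (P.step t j (P.memory init t j)).1 ++ P.received t (P.memory init t) j

/-- For `R` rounds, every machine's memory (including all that it has just received) consists of
at most `S` words, all words are smaller than `W`, and in every round each machine sends at most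
`S` words in total. -/
def Respects (P : Program M) (init : Fin M → List ℕ) (S W R : ℕ) : Prop :=
  (∀ t ≤ R, ∀ i, (P.memory init t i).length ≤ S ∧ ∀ x ∈ P.memory init t i, x < W) ∧
  (∀ t < R, ∀ i, (P.step t i (P.memory init t i)).2.length ≤ S)

end Program

/-- All edges held by the machines together, when machine `i` holds the list `inp i`. -/
def allEdges {n M : ℕ} (inp : Fin M → List (Fin n × Fin n)) : List (Sym2 (Fin n)) :=
  ((List.finRange M).flatMap inp).map fun p => s(p.1, p.2)

/-- The words that represent a list of edges: two words per edge, its endpoints. -/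
def encode {n : ℕ} (l : List (Fin n × Fin n)) : List ℕ :=
  l.flatMap fun p => [(p.1 : ℕ), (p.2 : ℕ)]

/-- `inp` is a distribution of the edges of `G` over `M` machines with `S` words of space: each
edge is held by exactly one machine, once and as a pair in one of its two orders, nothing else is
held, and the input of each machine fits into its space. Apart from this the distribution, the
order of the list of a machine and the order of a pair are arbitrary. -/
structure IsDistribution {n M : ℕ} (G : SimpleGraph (Fin n)) (S : ℕ)
    (inp : Fin M → List (Fin n × Fin n)) : Prop where
  nodup : (allEdges inp).Nodup
  mem_iff : ∀ e, e ∈ allEdges inp ↔ e ∈ G.edgeSet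
  fits : ∀ i, (encode (inp i)).length ≤ S

/-- On the input graph `G`, the program `P` counts the `k`-cliques exactly in `R` rounds with `S`
words of space per machine and words smaller than `W`: the graph fits into the machines, and
from every distribution of its edges over the machines the space bounds are respected and the
output is the number of `k`-cliques. -/
def CountsCliques {n M : ℕ} (P : Program M) (k : ℕ) (G : SimpleGraph (Fin n))
    (S W R : ℕ) : Prop :=
  (∃ inp : Fin M → List (Fin n × Fin n), IsDistribution G S inp) ∧
  ∀ inp : Fin M → List (Fin n × Fin n), IsDistribution G S inp →
    P.Respects (fun i => encode (inp i)) S W R ∧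
    P.output (P.memory (fun i => encode (inp i)) R P.outputMachine) = G.numCliques k

end MPC

/-! ### Programs as information flow between configurations -/

namespace MPC

open Finset

variable {M : ℕ} {Γ : Type*} {X Y Z : Type}

/-! The algorithm peels off vertices of low degree in phases. If a graph of arboricity at most α has
all its edges inside a vertex set U, it has at most 2α|U| ordered adjacent pairs
(`card_halfEdges_le`), so at most 2α|U|/d vertices have degree above d. A phase with threshold d
counts the k-cliques that contain a vertex of degree at most d, and then deletes all edges at such
vertices. A clique of this kind is charged to its first low vertex v; its other vertices form a
(k-1)-clique inside a set of at most d forward neighbours of v (`numCliques_peel`).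

Listing all pairs of forward neighbours costs about |U|d² words. Once |U| is at most n/2^g, the
threshold d = α·2^(2+g/2) is therefore affordable in total space O(nα²)
(`card_mul_threshold_sq_le`), and the next vertex set is smaller by a further factor 2^(1+g/2)
(`exists_support`). So g grows by a factor of about 3/2 per phase. As d² words must also fit into
one machine, the growth of the exponent is capped at some E of order log n. The cap is in reach
after O(log E) = O(log log n) phases (`min_le_gain`), and from then on every phase adds at least E/2
to g, so that a constant number of further phases removes all edges (`le_gain`, `lt_two_pow_gain`).

A phase takes a number of rounds bounded in terms of k and δ. The M = f^T machines compute prefix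
sums along a tree of fan-out f and depth T (`Leads.scan`), and radix sort by p digits to base D
follows from this (`Leads.pass`, `Setup.leads_sort`). After sorting, all items with the same first
vertex are consecutive; if they are no more than one block, then any machine that holds one of them
sees them all in its own and the two adjacent blocks (`filter_subset_nearBlocks`). This decides
degrees and assembles forward neighbourhoods. To learn which forward neighbours are adjacent, the
pairs are sorted together with the edges, in three copies whose ranks reveal whether an edge was
sorted in between (`adj_iff_rank`). There may be many copies of the same pair, and no machine has to
see the whole run.

No program is written down. Local computation is arbitrary, so a round is realizable as soon as the
messages of a machine are a function of its memory: two inputs γ, γ' that look alike to machine i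
must lead to the same messages (`Reach.step`). Most proof obligations about rounds are statements of
this kind, together with bounds on cardinalities. Configurations are multisets, because the order of
the words in a memory carries no information here.

For k at most 1 the number of cliques depends on n alone, and no communication is needed. -/

/-- The word that represents an element of the finite type `X`. -/
noncomputable def code {X : Type} [Fintype X] (x : X) : ℕ := (Fintype.equivFin X x : ℕ)

theorem code_injective [Fintype X] : Function.Injective (code (X := X)) := fun _ _ h =>
  (Fintype.equivFin X).injective (Fin.ext h)

theorem code_lt [Fintype X] (x : X) : code x < Fintype.card X := (Fintype.equivFin X x).isLt

/-- The memories `l` hold, in some order, the words that represent the configuration `c`. -/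
def Holds [Fintype X] (c : Fin M → Multiset X) (l : Fin M → List ℕ) : Prop :=
  ∀ j, (l j : Multiset ℕ) = (c j).map code

/-- The coding is injective, so a machine can decode its memory. This turns conditions on raw
memories into conditions on configurations. -/
theorem Holds.injective [Fintype X] {c c' : Fin M → Multiset X} {l l' : Fin M → List ℕ}
    (h : Holds c l) (h' : Holds c' l') {i : Fin M} (hi : l i = l' i) : c i = c' i :=
  Multiset.map_injective code_injective (by rw [← h i, ← h' i, hi])

/-- Some program takes, in `r` rounds and within the bounds `S` and `W`, every family of memories
that satisfies `pre γ` to one that satisfies `post γ`. The program does not depend on `γ`. -/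
def Reach (S W : ℕ) (pre post : Γ → (Fin M → List ℕ) → Prop) (r : ℕ) : Prop :=
  ∃ P : Program M, ∀ γ l, pre γ l → P.Respects l S W r ∧ post γ (P.memory l r)

/-- `Reach` between two configurations that depend on `γ`. -/
def Leads [Fintype X] [Fintype Y] (S W : ℕ) (c : Γ → Fin M → Multiset X)
    (c' : Γ → Fin M → Multiset Y) (r : ℕ) : Prop :=
  Reach S W (fun γ => Holds (c γ)) (fun γ => Holds (c' γ)) r

theorem Program.memory_congr (P Q : Program M) (l : Fin M → List ℕ) (r : ℕ)
    (h : ∀ t < r, P.step t = Q.step t) : ∀ t ≤ r, P.memory l t = Q.memory l t := by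
  intro t
  induction t with
  | zero => intro _; rfl
  | succ t ih =>
    intro ht
    have h1 := ih (by omega)
    have h2 := h t (by omega)
    funext j
    simp only [Program.memory, Program.received, h1, h2]

theorem Program.memory_shift (P Q : Program M) (l : Fin M → List ℕ) (r : ℕ)
    (h : ∀ t, P.step (r + t) = Q.step t) :
    ∀ t, P.memory l (r + t) = Q.memory (P.memory l r) t := by
  intro t
  induction t with
  | zero => rfl
  | succ t ih =>
    funext j
    have h2 := h t
    rw [← Nat.add_assoc]
    simp only [Program.memory, Program.received, ih, h2]

/-- A step may depend on the round number, so two programs are glued by switching at round `r` and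
restarting the clock. The second one works from any memories that satisfy `mid`. -/
theorem Reach.trans {S W r s : ℕ} {pre mid post : Γ → (Fin M → List ℕ) → Prop}
    (h₁ : Reach S W pre mid r) (h₂ : Reach S W mid post s) : Reach S W pre post (r + s) := by
  obtain ⟨P, hP⟩ := h₁
  obtain ⟨Q, hQ⟩ := h₂
  let R : Program M := ⟨fun t => if t < r then P.step t else Q.step (t - r), P.outputMachine,
    P.output⟩
  have hst : ∀ t < r, R.step t = P.step t := fun t ht => if_pos ht
  have hsh : ∀ t, R.step (r + t) = Q.step t := by
    intro t
    change (if r + t < r then P.step (r + t) else Q.step (r + t - r)) = _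
    rw [if_neg (by omega), Nat.add_sub_cancel_left]
  refine ⟨R, fun γ l hl => ?_⟩
  have hm := Program.memory_congr R P l r hst
  have hm' := Program.memory_shift R Q l r hsh
  rw [hm r le_rfl] at hm'
  obtain ⟨⟨a1, a2⟩, a3⟩ := hP γ l hl
  obtain ⟨⟨b1, b2⟩, b3⟩ := hQ γ _ a3
  refine ⟨⟨fun t ht => ?_, fun t ht => ?_⟩, ?_⟩
  · by_cases h : t ≤ r
    · rw [hm t h]; exact a1 t h
    · obtain ⟨u, rfl⟩ := Nat.exists_eq_add_of_le (not_le.mp h).le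
      rw [hm' u]; exact b1 u (by omega)
  · by_cases h : t < r
    · rw [hm t h.le, hst t h]; exact a2 t h
    · obtain ⟨u, rfl⟩ := Nat.exists_eq_add_of_le (not_lt.mp h)
      rw [hm' u, hsh u]; exact b2 u (by omega)
  · rw [hm' s]; exact b3

theorem Leads.trans [Fintype X] [Fintype Y] [Fintype Z] {S W r s : ℕ}
    {c : Γ → Fin M → Multiset X} {c' : Γ → Fin M → Multiset Y} {c'' : Γ → Fin M → Multiset Z}
    (h₁ : Leads S W c c' r) (h₂ : Leads S W c' c'' s) : Leads S W c c'' (r + s) :=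
  Reach.trans h₁ h₂

theorem Leads.refl [NeZero M] [Fintype X] {S W : ℕ} {c : Γ → Fin M → Multiset X}
    (hS : ∀ γ j, (c γ j).card ≤ S) (hW : Fintype.card X ≤ W) : Leads S W c c 0 := by
  refine ⟨⟨fun _ _ _ => ([], []), 0, fun _ => 0⟩, fun γ l hl => ⟨⟨fun t ht i => ?_, ?_⟩, hl⟩⟩
  · obtain rfl : t = 0 := by omega
    have h := hl i
    refine ⟨?_, fun x hx => ?_⟩
    · have h' := congrArg Multiset.card h
      simp only [Multiset.coe_card, Multiset.card_map] at h'
      exact h'.trans_le (hS γ i)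
    · have hx' : x ∈ (l i : Multiset ℕ) := hx
      rw [h] at hx'
      obtain ⟨y, -, rfl⟩ := Multiset.mem_map.mp hx'
      exact (code_lt y).trans_le hW
  · omega

theorem filter_sum_multiset {ι α : Type*} (s : Finset ι) (f : ι → Multiset α)
    (p : α → Prop) [DecidablePred p] :
    (∑ i ∈ s, f i).filter p = ∑ i ∈ s, (f i).filter p := by
  classical
  induction s using Finset.induction_on with
  | empty => simp
  | insert a s ha ih => rw [sum_insert ha, sum_insert ha, Multiset.filter_add, ih]

theorem map_sum_multiset {ι α β : Type*} (s : Finset ι) (f : ι → Multiset α)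
    (g : α → β) : (∑ i ∈ s, f i).map g = ∑ i ∈ s, (f i).map g :=
  map_sum (Multiset.mapAddMonoidHom g) f s

theorem card_sum_multiset {ι α : Type*} (s : Finset ι) (f : ι → Multiset α) :
    (∑ i ∈ s, f i).card = ∑ i ∈ s, (f i).card := Multiset.card_sum s f

theorem coe_flatMap_finRange (f : Fin M → List ℕ) :
    (((List.finRange M).flatMap f : List ℕ) : Multiset ℕ) = ∑ i, (f i : Multiset ℕ) := by
  rw [← Multiset.coe_bind, Multiset.bind, Multiset.join, Finset.sum]
  rfl

/-- One round of communication: `out γ i j` is what machine `i` sends to machine `j`. It is enough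
that `out γ i` is determined by the memory of machine `i`. -/
theorem Reach.step [NeZero M] [Fintype Y] {S W : ℕ} {pre : Γ → (Fin M → List ℕ) → Prop}
    (out : Γ → Fin M → Fin M → Multiset Y)
    (hknow : ∀ γ γ' l l' i, pre γ l → pre γ' l' → l i = l' i → out γ i = out γ' i)
    (hpre : ∀ γ l, pre γ l → ∀ i, (l i).length ≤ S ∧ ∀ x ∈ l i, x < W)
    (hW : Fintype.card Y ≤ W)
    (hsend : ∀ γ i, ∑ j, (out γ i j).card ≤ S)
    (hrecv : ∀ γ j, ∑ i, (out γ i j).card ≤ S) :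
    Reach S W pre (fun γ => Holds (fun j => ∑ i, out γ i j)) 1 := by
  classical
  -- The messages are read off the memory `w` by choosing any input compatible with it; `hknow`
  -- makes the choice irrelevant. Memories that never occur send nothing.
  let F : Fin M → List ℕ → Fin M → Multiset Y := fun i w =>
    if h : ∃ p : Γ × (Fin M → List ℕ), pre p.1 p.2 ∧ p.2 i = w then out h.choose.1 i else 0
  have hF : ∀ γ l i, pre γ l → F i (l i) = out γ i := by
    intro γ l i hl
    have h : ∃ p : Γ × (Fin M → List ℕ), pre p.1 p.2 ∧ p.2 i = l i := ⟨(γ, l), hl, rfl⟩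
    simp only [F, dif_pos h]
    exact hknow _ _ _ _ i h.choose_spec.1 hl h.choose_spec.2
  let msgs : Fin M → List ℕ → Multiset (Fin M × ℕ) := fun i w =>
    ∑ j, (F i w j).map fun y => (j, code y)
  -- Nothing is kept: what a machine wants to retain it sends to itself, so `out γ i i` counts
  -- towards both bounds.
  let P : Program M := ⟨fun _ i w => ([], (msgs i w).toList), 0, fun _ => 0⟩
  have hrec : ∀ γ l, pre γ l → Holds (fun j => ∑ i, out γ i j) (P.memory l 1) := by
    intro γ l hl j
    simp only [Program.memory, Program.received, P, List.nil_append]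
    rw [coe_flatMap_finRange, map_sum_multiset]
    refine sum_congr rfl fun i _ => ?_
    rw [← Multiset.map_coe, ← Multiset.filter_coe, Multiset.coe_toList,
      filter_sum_multiset, map_sum_multiset, sum_eq_single j]
    · rw [Multiset.filter_eq_self.mpr, Multiset.map_map, hF γ l i hl]
      · rfl
      · intro x hx
        obtain ⟨y, -, rfl⟩ := Multiset.mem_map.mp hx
        rfl
    · intro j' _ hj'
      rw [Multiset.filter_eq_nil.mpr, Multiset.map_zero]
      intro x hx
      obtain ⟨y, -, rfl⟩ := Multiset.mem_map.mp hx
      exact hj'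
    · simp
  refine ⟨P, fun γ l hl => ⟨⟨fun t ht i => ?_, fun t ht i => ?_⟩, hrec γ l hl⟩⟩
  · obtain rfl | rfl : t = 0 ∨ t = 1 := by omega
    · exact hpre γ l hl i
    · have h := hrec γ l hl i
      refine ⟨?_, fun x hx => ?_⟩
      · have h' := congrArg Multiset.card h
        simp only [Multiset.coe_card, Multiset.card_map, card_sum_multiset] at h'
        exact h'.trans_le (hrecv γ i)
      · have hx' : x ∈ (P.memory l 1 i : Multiset ℕ) := hx
        rw [h] at hx'
        obtain ⟨y, -, rfl⟩ := Multiset.mem_map.mp hx'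
        exact (code_lt y).trans_le hW
  · obtain rfl : t = 0 := by omega
    have : (msgs i (l i)).card ≤ S := by
      simp only [msgs, card_sum_multiset, Multiset.card_map, hF γ l i hl]
      exact hsend γ i
    simpa [P, Program.memory] using this

/-- One round of communication between configurations. -/
theorem Leads.step [NeZero M] [Fintype X] [Fintype Y] {S W : ℕ} {c : Γ → Fin M → Multiset X}
    {c' : Γ → Fin M → Multiset Y}
    (out : Γ → Fin M → Fin M → Multiset Y)
    (hknow : ∀ γ γ' i, c γ i = c γ' i → out γ i = out γ' i)
    (hc' : ∀ γ j, c' γ j = ∑ i, out γ i j)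
    (hX : Fintype.card X ≤ W) (hY : Fintype.card Y ≤ W)
    (hS : ∀ γ j, (c γ j).card ≤ S)
    (hsend : ∀ γ i, ∑ j, (out γ i j).card ≤ S)
    (hrecv : ∀ γ j, (c' γ j).card ≤ S) : Leads S W c c' 1 := by
  have e : c' = fun γ j => ∑ i, out γ i j := by funext γ j; exact hc' γ j
  subst e
  refine Reach.step out (fun γ γ' l l' i h h' hi => hknow γ γ' i (h.injective h' hi))
    (fun γ l hl i => ?_) hY hsend (fun γ j => by simpa using hrecv γ j)
  have h := hl i
  refine ⟨?_, fun x hx => ?_⟩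
  · have h' := congrArg Multiset.card h
    simp only [Multiset.coe_card, Multiset.card_map] at h'
    exact h'.trans_le (hS γ i)
  · have hx' : x ∈ (l i : Multiset ℕ) := hx
    rw [h] at hx'
    obtain ⟨y, -, rfl⟩ := Multiset.mem_map.mp hx'
    exact (code_lt y).trans_le hX

/-- One round of local computation. -/
theorem Leads.map [NeZero M] [Fintype X] [Fintype Y] {S W : ℕ} {c : Γ → Fin M → Multiset X}
    {c' : Γ → Fin M → Multiset Y}
    (hknow : ∀ γ γ' i, c γ i = c γ' i → c' γ i = c' γ' i)
    (hX : Fintype.card X ≤ W) (hY : Fintype.card Y ≤ W)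
    (hS : ∀ γ j, (c γ j).card ≤ S) (hS' : ∀ γ j, (c' γ j).card ≤ S) : Leads S W c c' 1 := by
  refine Leads.step (fun γ i j => if i = j then c' γ i else 0) ?_ ?_ hX hY hS ?_ hS'
  · intro γ γ' i h
    funext j
    rw [hknow γ γ' i h]
  · intro γ j; simp
  · intro γ i
    rw [sum_eq_single i]
    · simpa using hS' γ i
    · intro j _ hj; simp [hj.symm]
    · simp

end MPC

/-! ### Vectors as words, and groups of machines by digits -/

namespace MPC

open Finset

variable {M : ℕ} {Γ : Type*} {X Y Z : Type}

section DisjSum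

theorem filterMap_none (s : Multiset X) : s.filterMap (fun _ => (none : Option Y)) = 0 := by
  induction s using Multiset.induction_on with
  | empty => rfl
  | cons x s ih => rw [Multiset.filterMap_cons_none _ _ rfl, ih]

/-- The two parts are recovered by filtering on the tag. A machine that holds several kinds of items
thus knows each kind separately. -/
theorem disjSum_injective {a a' : Multiset X} {b b' : Multiset Y}
    (h : a.disjSum b = a'.disjSum b') : a = a' ∧ b = b' := by
  have hl : ∀ (a : Multiset X) (b : Multiset Y), (a.disjSum b).filterMap Sum.getLeft? = a := by
    intro a b
    simp [Multiset.disjSum, Multiset.filterMap_map, Function.comp_def, filterMap_none]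
  have hr : ∀ (a : Multiset X) (b : Multiset Y), (a.disjSum b).filterMap Sum.getRight? = b := by
    intro a b
    simp [Multiset.disjSum, Multiset.filterMap_map, Function.comp_def, filterMap_none]
  exact ⟨by rw [← hl a b, h, hl], by rw [← hr a b, h, hr]⟩

theorem sum_disjSum {ι : Type*} (s : Finset ι) (a : ι → Multiset X) (b : ι → Multiset Y) :
    ∑ i ∈ s, (a i).disjSum (b i) = (∑ i ∈ s, a i).disjSum (∑ i ∈ s, b i) := by
  simp only [Multiset.disjSum, sum_add_distrib, map_sum_multiset]

end DisjSum

section Words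

variable {D N : ℕ}

/-- The words that represent a vector with entries below `N`. -/
def vecWords (N : ℕ) [NeZero N] (u : Fin D → ℕ) : Multiset (Fin D × Fin N) :=
  (univ : Finset (Fin D)).val.map fun d => (d, Fin.ofNat N (u d))

/-- The vector that is obtained from a collection of words by adding the entries with the same
index. -/
def vecSum (d : Fin D) (s : Multiset (Fin D × Fin N)) : ℕ :=
  ((s.filter fun p => p.1 = d).map fun p => (p.2 : ℕ)).sum

theorem vecSum_zero (d : Fin D) : vecSum d (0 : Multiset (Fin D × Fin N)) = 0 := by
  simp [vecSum]

theorem vecSum_add (d : Fin D) (s s' : Multiset (Fin D × Fin N)) :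
    vecSum d (s + s') = vecSum d s + vecSum d s' := by
  simp [vecSum]

theorem vecSum_sum {ι : Type*} (d : Fin D) (s : Finset ι) (f : ι → Multiset (Fin D × Fin N)) :
    vecSum d (∑ i ∈ s, f i) = ∑ i ∈ s, vecSum d (f i) := by
  classical
  induction s using Finset.induction_on with
  | empty => simp [vecSum_zero]
  | insert a s ha ih => rw [sum_insert ha, sum_insert ha, vecSum_add, ih]

theorem vecSum_vecWords [NeZero N] {u : Fin D → ℕ} {d : Fin D} (h : u d < N) :
    vecSum d (vecWords N u) = u d := by
  simp only [vecSum, vecWords, Multiset.filter_map, Multiset.map_map, Function.comp_def]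
  have : Multiset.filter (fun x => x = d) (univ : Finset (Fin D)).val = {d} := by
    rw [← Finset.filter_val]
    simp [Finset.filter_eq']
  rw [this]
  simp [Nat.mod_eq_of_lt h]

theorem card_vecWords [NeZero N] (u : Fin D → ℕ) : (vecWords N u).card = D := by
  simp [vecWords]

end Words

section Groups

variable {f : ℕ}

/-- The machines that agree with `j` in all but the last `t` digits to base `f`. -/
def grp (f t : ℕ) (j : Fin M) : Finset (Fin M) :=
  univ.filter fun i => (i : ℕ) / f ^ t = (j : ℕ) / f ^ t

/-- The machines that agree with `j` in all digits to base `f`, but perhaps that of weight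
`f ^ t`. -/
def sib (f t : ℕ) (j : Fin M) : Finset (Fin M) :=
  univ.filter fun i => (i : ℕ) / f ^ (t + 1) = (j : ℕ) / f ^ (t + 1) ∧
    (i : ℕ) % f ^ t = (j : ℕ) % f ^ t

theorem mem_sib_comm {t : ℕ} {i j : Fin M} : i ∈ sib f t j ↔ j ∈ sib f t i := by
  simp only [sib, mem_filter, mem_univ, true_and]
  exact and_congr eq_comm eq_comm

theorem self_mem_sib {t : ℕ} {j : Fin M} : j ∈ sib f t j := by simp [sib]

theorem eq_of_mem_sib {t : ℕ} {i j : Fin M} (h : i ∈ sib f t j)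
    (h' : (i : ℕ) / f ^ t = (j : ℕ) / f ^ t) : i = j := by
  simp only [sib, mem_filter, mem_univ, true_and] at h
  ext
  rw [← Nat.div_add_mod (i : ℕ) (f ^ t), ← Nat.div_add_mod (j : ℕ) (f ^ t), h.2, h']

theorem card_sib_le (hf : 0 < f) (t : ℕ) (j : Fin M) : (sib f t j).card ≤ f := by
  have : (sib f t j).card ≤ (range f).card := by
    refine card_le_card_of_injOn (fun i => (i : ℕ) / f ^ t % f) ?_ ?_
    · intro i _
      simpa using Nat.mod_lt _ hf
    · intro i hi i' hi' h
      have hi := mem_coe.mp hi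
      have hi' := mem_coe.mp hi'
      simp only at h
      have e : ∀ i ∈ sib f t j, (i : ℕ) / f ^ t / f = (j : ℕ) / f ^ (t + 1) := by
        intro i hi
        simp only [sib, mem_filter, mem_univ, true_and] at hi
        rw [Nat.div_div_eq_div_mul, ← pow_succ, hi.1]
      have h1 : i ∈ sib f t i' := by
        simp only [sib, mem_filter, mem_univ, true_and] at hi hi' ⊢
        exact ⟨hi.1.trans hi'.1.symm, hi.2.trans hi'.2.symm⟩
      refine eq_of_mem_sib h1 ?_
      rw [← Nat.div_add_mod ((i : ℕ) / f ^ t) f, ← Nat.div_add_mod ((i' : ℕ) / f ^ t) f,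
        e i hi, e i' hi', h]
  simpa using this

/-- A group of level `t + 1` is the disjoint union of the level-`t` groups of the siblings of `j`,
since each of these contains exactly one sibling: the machine with the high digits of the group and
the low digits of `j`. That this number is below `M` uses that `M` is a power of `f`. -/
theorem sum_grp_succ {T t : ℕ} (hf : 0 < f) (hM : M = f ^ T) (ht : t < T) (j : Fin M)
    (g : Fin M → ℕ) :
    ∑ i ∈ grp f (t + 1) j, g i = ∑ i ∈ sib f t j, ∑ i' ∈ grp f t i, g i' := by
  have hpos : 0 < f ^ t := pow_pos hf t
  have hlt : ∀ i : Fin M, f ^ t * ((i : ℕ) / f ^ t) + (j : ℕ) % f ^ t < M := by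
    intro i
    obtain ⟨s, rfl⟩ := Nat.exists_eq_add_of_le ht.le
    have hi : (i : ℕ) < f ^ t * f ^ s := by rw [← pow_add, ← hM]; exact i.2
    have h1 : (i : ℕ) / f ^ t < f ^ s := Nat.div_lt_of_lt_mul hi
    have h2 := Nat.mod_lt (j : ℕ) hpos
    calc f ^ t * ((i : ℕ) / f ^ t) + (j : ℕ) % f ^ t
        < f ^ t * ((i : ℕ) / f ^ t) + f ^ t := by omega
      _ = f ^ t * ((i : ℕ) / f ^ t + 1) := by ring
      _ ≤ f ^ t * f ^ s := Nat.mul_le_mul_left _ h1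
      _ = M := by rw [hM, pow_add]
  let rep : Fin M → Fin M := fun i => ⟨_, hlt i⟩
  have hdiv : ∀ i, (rep i : ℕ) / f ^ t = (i : ℕ) / f ^ t := by
    intro i
    change (f ^ t * ((i : ℕ) / f ^ t) + (j : ℕ) % f ^ t) / f ^ t = _
    rw [Nat.mul_add_div hpos, Nat.div_eq_of_lt (Nat.mod_lt _ hpos), add_zero]
  have hmod : ∀ i, (rep i : ℕ) % f ^ t = (j : ℕ) % f ^ t := by
    intro i
    change (f ^ t * ((i : ℕ) / f ^ t) + (j : ℕ) % f ^ t) % f ^ t = _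
    rw [Nat.mul_add_mod, Nat.mod_mod]
  have hsucc : ∀ i : Fin M, (i : ℕ) / f ^ (t + 1) = (i : ℕ) / f ^ t / f := by
    intro i; rw [Nat.div_div_eq_div_mul, pow_succ]
  rw [← sum_fiberwise_of_maps_to (s := grp f (t + 1) j) (t := sib f t j) (g := rep)]
  · refine sum_congr rfl fun i hi => sum_congr ?_ fun _ _ => rfl
    have hi2 := hi
    simp only [sib, mem_filter, mem_univ, true_and] at hi2
    ext i'
    simp only [grp, mem_filter, mem_univ, true_and]
    constructor
    · rintro ⟨_, h⟩
      rw [← hdiv i', h]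
    · intro h
      refine ⟨by rw [hsucc, h, ← hsucc, hi2.1], ?_⟩
      refine eq_of_mem_sib (f := f) (t := t) ?_ (by rw [hdiv, h])
      simp only [sib, mem_filter, mem_univ, true_and]
      exact ⟨by rw [hsucc, hdiv, h, ← hsucc], by rw [hmod, hi2.2]⟩
  · intro i hi
    simp only [grp, sib, mem_filter, mem_univ, true_and] at hi ⊢
    exact ⟨by rw [hsucc, hdiv, ← hsucc, hi], hmod i⟩

end Groups

end MPC

/-! ### Prefix sums along a tree of fan-out `f` -/

namespace MPC

open Finset

variable {M : ℕ} {Γ : Type*} {X Y Z : Type}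

section Scan

variable {f D N : ℕ} [NeZero N]

/-- The sum of the vectors of the machines in the group of `j`. -/
def grpSum (f t : ℕ) (u : Fin M → Fin D → ℕ) (j : Fin M) (d : Fin D) : ℕ :=
  ∑ i ∈ grp f t j, u i d

/-- The sum of the vectors of the machines before `j` in the group of `j`. -/
def grpPrefix (f t : ℕ) (u : Fin M → Fin D → ℕ) (j : Fin M) (d : Fin D) : ℕ :=
  ∑ i ∈ grp f t j, if i < j then u i d else 0

theorem grp_zero (j : Fin M) : grp f 0 j = {j} := by
  ext i
  simp [grp, Fin.ext_iff]

theorem grp_top {T : ℕ} (hM : M = f ^ T) (j : Fin M) : grp f T j = univ := by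
  ext i
  have hi := i.2
  have hj := j.2
  simp only [grp, mem_filter, mem_univ, true_and, Nat.div_eq_of_lt (hi.trans_eq hM),
    Nat.div_eq_of_lt (hj.trans_eq hM)]

theorem grpSum_succ {T t : ℕ} (hf : 0 < f) (hM : M = f ^ T) (ht : t < T)
    (u : Fin M → Fin D → ℕ) (j : Fin M) (d : Fin D) :
    grpSum f (t + 1) u j d = ∑ i ∈ sib f t j, grpSum f t u i d :=
  sum_grp_succ hf hM ht j _

/-- Groups are intervals of machine numbers. The group of a sibling other than `j` therefore lies
entirely before or entirely after `j`, and contributes its full sum or nothing. -/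
theorem grpPrefix_succ {T t : ℕ} (hf : 0 < f) (hM : M = f ^ T) (ht : t < T)
    (u : Fin M → Fin D → ℕ) (j : Fin M) (d : Fin D) :
    grpPrefix f (t + 1) u j d =
      grpPrefix f t u j d + ∑ i ∈ sib f t j, if i < j then grpSum f t u i d else 0 := by
  rw [grpPrefix, sum_grp_succ hf hM ht, ← add_sum_erase _ _ self_mem_sib,
    ← add_sum_erase (sib f t j) _ self_mem_sib]
  simp only [lt_self_iff_false, if_false, zero_add]
  congr 1
  refine sum_congr rfl fun i hi => ?_
  rw [mem_erase] at hi
  have hne : (i : ℕ) / f ^ t ≠ (j : ℕ) / f ^ t := fun h => hi.1 (eq_of_mem_sib hi.2 h)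
  have hiff : ∀ i' ∈ grp f t i, i' < j ↔ i < j := by
    intro i' hi'
    simp only [grp, mem_filter, mem_univ, true_and] at hi'
    constructor
    · intro h
      by_contra h'
      have h1 := Nat.div_le_div_right (c := f ^ t) (Fin.le_def.mp h.le)
      have h2 := Nat.div_le_div_right (c := f ^ t) (Fin.le_def.mp (not_lt.mp h'))
      omega
    · intro h
      by_contra h'
      have h1 := Nat.div_le_div_right (c := f ^ t) (Fin.le_def.mp h.le)
      have h2 := Nat.div_le_div_right (c := f ^ t) (Fin.le_def.mp (not_lt.mp h'))
      omega
  by_cases h : i < j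
  · rw [if_pos h, grpSum]
    exact sum_congr rfl fun i' hi' => if_pos ((hiff i' hi').mpr h)
  · rw [if_neg h]
    exact sum_eq_zero fun i' hi' => if_neg fun h' => h ((hiff i' hi').mp h')

theorem grpSum_le (t : ℕ) (u : Fin M → Fin D → ℕ) (j : Fin M) (d : Fin D) :
    grpSum f t u j d ≤ ∑ i, u i d :=
  sum_le_sum_of_subset (subset_univ _)

theorem grpPrefix_le (t : ℕ) (u : Fin M → Fin D → ℕ) (j : Fin M) (d : Fin D) :
    grpPrefix f t u j d ≤ ∑ i, u i d :=
  (sum_le_sum fun i _ => by split <;> simp).trans (grpSum_le (f := f) t u j d)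

/-- A configuration together with two vectors on every machine. -/
def withVecs (N : ℕ) [NeZero N] (c : Multiset X) (u v : Fin D → ℕ) :
    Multiset (X ⊕ ((Fin D × Fin N) ⊕ (Fin D × Fin N))) :=
  c.disjSum ((vecWords N u).disjSum (vecWords N v))

theorem withVecs_injective {c c' : Multiset X} {u u' v v' : Fin D → ℕ}
    (hu : ∀ d, u d < N) (hu' : ∀ d, u' d < N) (hv : ∀ d, v d < N) (hv' : ∀ d, v' d < N)
    (h : withVecs N c u v = withVecs N c' u' v') : c = c' ∧ u = u' ∧ v = v' := by
  obtain ⟨h1, h2⟩ := disjSum_injective h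
  obtain ⟨h2, h3⟩ := disjSum_injective h2
  refine ⟨h1, funext fun d => ?_, funext fun d => ?_⟩
  · rw [← vecSum_vecWords (hu d), h2, vecSum_vecWords (hu' d)]
  · rw [← vecSum_vecWords (hv d), h3, vecSum_vecWords (hv' d)]

theorem card_withVecs (c : Multiset X) (u v : Fin D → ℕ) :
    (withVecs N c u v).card = c.card + (D + D) := by
  simp [withVecs, card_vecWords]

/-- The messages that pass the vectors to the siblings. -/
def scanOut (N : ℕ) [NeZero N] (f t : ℕ) (i : Fin M) (c : Multiset X) (u v : Fin D → ℕ)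
    (j : Fin M) : Multiset (X ⊕ ((Fin D × Fin N) ⊕ (Fin D × Fin N))) :=
  (if i = j then c else 0).disjSum
    ((if i ∈ sib f t j then vecWords N u else 0).disjSum
      ((if i = j then vecWords N v else 0) +
        if i ∈ sib f t j then if i < j then vecWords N u else 0 else 0))

/-- Machine `j` is its own sibling: its group sum enters the new total, but not the new prefix,
which collects only siblings before `j`. -/
theorem sum_scanOut (t : ℕ) (c : Fin M → Multiset X) (u v : Fin M → Fin D → ℕ) (j : Fin M) :
    ∑ i, scanOut N f t i (c i) (u i) (v i) j =
      (c j).disjSum ((∑ i ∈ sib f t j, vecWords N (u i)).disjSum (vecWords N (v j) +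
        ∑ i ∈ sib f t j, if i < j then vecWords N (u i) else 0)) := by
  simp only [scanOut, sum_disjSum, sum_add_distrib, sum_ite_eq', mem_univ, if_true, sum_ite_mem,
    univ_inter]

variable [Fintype X]

/-- Every machine learns the sum of all vectors and the sum of the vectors of the machines before
it. -/
theorem Leads.scan [NeZero M] {S W T L : ℕ} (hf : 0 < f) (hM : M = f ^ T)
    (c : Γ → Fin M → Multiset X) (u : Γ → Fin M → Fin D → ℕ)
    (hu : ∀ γ γ' i, c γ i = c γ' i → u γ i = u γ' i)
    (hN : ∀ γ d, ∑ i, u γ i d < N)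
    (hL : ∀ γ j, (c γ j).card ≤ L) (hS : L + 3 * (f * D) ≤ S)
    (hW : Fintype.card X + 2 * (D * N) ≤ W) :
    Leads S W c (fun γ j => withVecs N (c γ j) (fun d => ∑ i, u γ i d)
      (fun d => ∑ i, if i < j then u γ i d else 0)) (1 + T * 2) := by
  have hX : Fintype.card X ≤ W := le_trans (by omega) hW
  have hY : Fintype.card (X ⊕ ((Fin D × Fin N) ⊕ (Fin D × Fin N))) ≤ W := by
    simp only [Fintype.card_sum, Fintype.card_prod, Fintype.card_fin]
    omega
  have hfD : D ≤ f * D := Nat.le_mul_of_pos_left D hf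
  have hs : ∀ t γ j d, grpSum f t (u γ) j d < N := fun t γ j d =>
    (grpSum_le t _ j d).trans_lt (hN γ d)
  have hp : ∀ t γ j d, grpPrefix f t (u γ) j d < N := fun t γ j d =>
    (grpPrefix_le t _ j d).trans_lt (hN γ d)
  have hcard : ∀ t γ j, (withVecs N (c γ j) (grpSum f t (u γ) j)
      (grpPrefix f t (u γ) j)).card ≤ S := by
    intro t γ j
    rw [card_withVecs]
    have := hL γ j
    omega
  -- After `t` levels every machine knows the sum and the prefix of its group. One round writes down
  -- the vectors of level 0, where the prefix is zero; each level then costs one round of exchange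
  -- and one of local addition.
  have main : ∀ t ≤ T, Leads S W c
      (fun γ j => withVecs N (c γ j) (grpSum f t (u γ) j) (grpPrefix f t (u γ) j))
      (1 + t * 2) := by
    intro t
    induction t with
    | zero =>
      intro _
      refine Leads.map ?_ hX hY (fun γ j => (hL γ j).trans (by omega)) (hcard 0)
      intro γ γ' i h
      have : ∀ γ, grpSum f 0 (u γ) i = u γ i ∧ grpPrefix f 0 (u γ) i = 0 := by
        intro γ
        constructor <;> funext d <;> simp [grpSum, grpPrefix, grp_zero]
      rw [(this γ).1, (this γ).2, (this γ').1, (this γ').2, h, hu γ γ' i h]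
    | succ t ih =>
      intro ht
      have e : 1 + (t + 1) * 2 = (1 + t * 2) + (1 + 1) := by ring
      rw [e]
      refine (ih (by omega)).trans ?_
      have hmid : ∀ γ j, (∑ i, scanOut N f t i (c γ i) (grpSum f t (u γ) i)
          (grpPrefix f t (u γ) i) j).card ≤ S := by
        intro γ j
        rw [sum_scanOut]
        simp only [Multiset.card_disjSum, Multiset.card_add, card_sum_multiset, card_vecWords]
        have h1 := hL γ j
        have h2 : ∑ i ∈ sib f t j, D ≤ f * D := by
          rw [sum_const, smul_eq_mul]
          exact Nat.mul_le_mul_right D (card_sib_le hf t j)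
        have h3 : ∑ i ∈ sib f t j, (if i < j then vecWords N (grpSum f t (u γ) i) else 0).card
            ≤ ∑ i ∈ sib f t j, D := by
          refine sum_le_sum fun i _ => ?_
          split <;> simp [card_vecWords]
        omega
      refine Leads.trans (c' := fun γ j => ∑ i, scanOut N f t i (c γ i) (grpSum f t (u γ) i)
          (grpPrefix f t (u γ) i) j)
        (Leads.step (fun γ i j => scanOut N f t i (c γ i) (grpSum f t (u γ) i)
          (grpPrefix f t (u γ) i) j) ?_ (fun _ _ => rfl) hY hY (hcard t) ?_ hmid) ?_
      · intro γ γ' i h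
        obtain ⟨h1, h2, h3⟩ := withVecs_injective (hs t γ i) (hs t γ' i) (hp t γ i) (hp t γ' i) h
        simp only [h1, h2, h3]
      · intro γ i
        have h0 : ∀ j, (scanOut N f t i (c γ i) (grpSum f t (u γ) i)
            (grpPrefix f t (u γ) i) j).card ≤ (if i = j then (c γ i).card + D else 0) +
              (if j ∈ sib f t i then D + D else 0) := by
          intro j
          simp only [scanOut, mem_sib_comm (i := i), Multiset.card_disjSum, Multiset.card_add]
          split_ifs <;> simp [card_vecWords] <;> omega
        refine (sum_le_sum fun j _ => h0 j).trans ?_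
        rw [sum_add_distrib]
        simp only [sum_ite_eq, mem_univ, if_true, sum_ite_mem, univ_inter, sum_const, smul_eq_mul]
        have h1 := hL γ i
        have h2 : (sib f t i).card * (D + D) ≤ f * (D + D) :=
          Nat.mul_le_mul_right _ (card_sib_le hf t i)
        have h3 : f * (D + D) = f * D + f * D := mul_add f D D
        omega
      · refine Leads.map ?_ hY hY hmid (hcard (t + 1))
        intro γ γ' j h
        rw [sum_scanOut, sum_scanOut] at h
        obtain ⟨h1, h2⟩ := disjSum_injective h
        obtain ⟨h2, h3⟩ := disjSum_injective h2
        have e1 : ∀ γ, grpSum f (t + 1) (u γ) j = fun d => vecSum d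
            (∑ i ∈ sib f t j, vecWords N (grpSum f t (u γ) i)) := by
          intro γ
          funext d
          rw [grpSum_succ hf hM ht, vecSum_sum]
          exact sum_congr rfl fun i _ => (vecSum_vecWords (hs t γ i d)).symm
        have e2 : ∀ γ, grpPrefix f (t + 1) (u γ) j = fun d => vecSum d
            (vecWords N (grpPrefix f t (u γ) j) + ∑ i ∈ sib f t j,
              if i < j then vecWords N (grpSum f t (u γ) i) else 0) := by
          intro γ
          funext d
          rw [grpPrefix_succ hf hM ht, vecSum_add, vecSum_sum, vecSum_vecWords (hp t γ j d)]
          congr 1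
          refine sum_congr rfl fun i _ => ?_
          split
          · rw [vecSum_vecWords (hs t γ i d)]
          · rw [vecSum_zero]
        simp only [e1, e2, h1, h2, h3]
  have h := main T le_rfl
  have e : (fun γ j => withVecs N (c γ j) (grpSum f T (u γ) j) (grpPrefix f T (u γ) j)) =
      fun γ j => withVecs N (c γ j) (fun d => ∑ i, u γ i d)
      (fun d => ∑ i, if i < j then u γ i d else 0) := by
    funext γ j
    have e1 : grpSum f T (u γ) j = fun d => ∑ i, u γ i d := by
      funext d
      rw [grpSum, grp_top hM]
    have e2 : grpPrefix f T (u γ) j = fun d => ∑ i, if i < j then u γ i d else 0 := by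
      funext d
      rw [grpPrefix, grp_top hM]
    rw [e1, e2]
  rwa [e] at h

end Scan

end MPC

/-! ### Ranks, and one pass of radix sort -/

namespace MPC

open Finset

variable {M : ℕ} {Γ : Type*} {X Y Z : Type}

section Rank

variable {α Λ : Type*} [LinearOrder Λ]

/-- The number of elements of `A` that precede `x` when the order is by `ρ`. -/
def rankBy (A : Finset α) (ρ : α → Λ) (x : α) : ℕ := (A.filter fun y => ρ y < ρ x).card

theorem rankBy_lt_of_lt {A : Finset α} {ρ : α → Λ} {x y : α} (hx : x ∈ A) (h : ρ x < ρ y) :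
    rankBy A ρ x < rankBy A ρ y := by
  refine card_lt_card ⟨fun z hz => ?_, fun hs => ?_⟩
  · rw [mem_filter] at hz ⊢
    exact ⟨hz.1, hz.2.trans h⟩
  · have := hs (mem_filter.mpr ⟨hx, h⟩)
    exact lt_irrefl _ (mem_filter.mp this).2

theorem rankBy_lt_card {A : Finset α} {ρ : α → Λ} {x : α} (hx : x ∈ A) :
    rankBy A ρ x < A.card := by
  refine card_lt_card ⟨filter_subset _ _, fun hs => ?_⟩
  exact lt_irrefl _ (mem_filter.mp (hs hx)).2

theorem rankBy_lt_iff {A : Finset α} {ρ : α → Λ} {x y : α} (hx : x ∈ A) (hy : y ∈ A)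
    (hρ : Set.InjOn ρ A) : rankBy A ρ x < rankBy A ρ y ↔ ρ x < ρ y := by
  refine ⟨fun h => ?_, rankBy_lt_of_lt hx⟩
  rcases lt_trichotomy (ρ x) (ρ y) with h' | h' | h'
  · exact h'
  · rw [hρ hx hy h'] at h
    exact absurd h (lt_irrefl _)
  · exact absurd h (rankBy_lt_of_lt hy h').not_gt

theorem rankBy_injOn {A : Finset α} {ρ : α → Λ} (hρ : Set.InjOn ρ A) :
    Set.InjOn (rankBy A ρ) A := by
  intro x hx y hy h
  apply hρ hx hy
  by_contra hne
  rcases lt_or_gt_of_ne hne with h' | h'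
  · exact (rankBy_lt_of_lt (mem_coe.mp hx) h').ne h
  · exact (rankBy_lt_of_lt (mem_coe.mp hy) h').ne' h

theorem image_eq_range {A : Finset α} {r : α → ℕ} (hr : Set.InjOn r A)
    (hlt : ∀ x ∈ A, r x < A.card) : A.image r = range A.card := by
  refine eq_of_subset_of_card_le (fun m hm => ?_) ?_
  · obtain ⟨x, hx, rfl⟩ := mem_image.mp hm
    exact mem_range.mpr (hlt x hx)
  · rw [card_image_of_injOn hr, card_range]

theorem card_filter_of_ranks {A : Finset α} {r : α → ℕ} (hr : Set.InjOn r A)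
    (hlt : ∀ x ∈ A, r x < A.card) {s : Finset ℕ} (hs : s ⊆ range A.card) :
    (A.filter fun x => r x ∈ s).card = s.card := by
  rw [← card_image_of_injOn (f := r) (hr.mono (coe_subset.mpr (filter_subset _ _)))]
  congr 1
  ext m
  simp only [mem_image, mem_filter]
  constructor
  · rintro ⟨x, ⟨_, h⟩, rfl⟩
    exact h
  · intro hm
    have := hs hm
    rw [← image_eq_range hr hlt] at this
    obtain ⟨x, hx, rfl⟩ := mem_image.mp this
    exact ⟨x, ⟨hx, hm⟩, rfl⟩

/-- An injection of `A` into the numbers below its cardinality is a bijection, so `r x` is the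
number of elements with smaller value. Monotonicity says which elements these are. -/
theorem eq_rankBy {A : Finset α} {r : α → ℕ} {ρ : α → Λ} (hr : Set.InjOn r A)
    (hlt : ∀ x ∈ A, r x < A.card) (hmono : ∀ x ∈ A, ∀ y ∈ A, ρ x < ρ y → r x < r y)
    (hρ : Set.InjOn ρ A) {x : α} (hx : x ∈ A) : r x = rankBy A ρ x := by
  have h := card_filter_of_ranks hr hlt (s := range (r x))
    (range_subset_range.mpr (hlt x hx).le)
  rw [card_range] at h
  rw [← h, rankBy]
  congr 1
  refine filter_congr fun y hy => ?_
  rw [mem_range]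
  refine ⟨fun h' => ?_, hmono y hy x hx⟩
  rcases lt_trichotomy (ρ y) (ρ x) with h2 | h2 | h2
  · exact h2
  · rw [hρ hy hx h2] at h'
    exact absurd h' (lt_irrefl _)
  · exact absurd h' (hmono x hx y hy h2).not_gt

theorem card_block_le {A : Finset α} {r : α → ℕ} (hr : Set.InjOn r A) {β : ℕ} (hβ : 0 < β)
    (j : ℕ) : (A.filter fun x => r x / β = j).card ≤ β := by
  have : (A.filter fun x => r x / β = j).card ≤ (Ico (j * β) ((j + 1) * β)).card := by
    refine card_le_card_of_injOn r (fun x hx => ?_) (hr.mono (coe_subset.mpr (filter_subset _ _)))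
    have := (mem_filter.mp hx).2
    rw [Nat.div_eq_iff hβ] at this
    rw [mem_coe, mem_Ico, add_mul, one_mul]
    omega
  rw [Nat.card_Ico, add_mul, one_mul] at this
  omega

end Rank

theorem val_biUnion [DecidableEq X] {a : Fin M → Finset X}
    (h : Pairwise fun i j => Disjoint (a i) (a j)) :
    (univ.biUnion a).val = ∑ i, (a i).val := by
  have h' : ((univ : Finset (Fin M)) : Set (Fin M)).PairwiseDisjoint a :=
    fun i _ j _ hij => h hij
  rw [← disjiUnion_eq_biUnion univ a h', disjiUnion_val]
  rfl

section Pass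

variable [DecidableEq X] {D : ℕ}

/-- The rank of `x`, held by machine `i`, in the order by digit, machine and local key. -/
theorem rank_formula (a : Fin M → Finset X) (dig : X → Fin D) (κ : X → ℕ) (i : Fin M) (x : X) :
    rankBy (univ.sigma a) (fun p => toLex (dig p.2, toLex (p.1, κ p.2))) ⟨i, x⟩ =
      (∑ d with d < dig x, ∑ i', ((a i').filter fun y => dig y = d).card) +
      (∑ i', if i' < i then ((a i').filter fun y => dig y = dig x).card else 0) +
      ((a i).filter fun y => dig y = dig x ∧ κ y < κ x).card := by
  have h1 : (univ.sigma a).filter (fun p => toLex (dig p.2, toLex (p.1, κ p.2)) <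
      toLex (dig x, toLex (i, κ x))) = univ.sigma fun i' => (a i').filter fun y =>
        dig y < dig x ∨ dig y = dig x ∧ (i' < i ∨ i' = i ∧ κ y < κ x) := by
    ext ⟨i', y⟩
    simp [Prod.Lex.toLex_lt_toLex]
  rw [rankBy, h1, card_sigma, sum_comm, ← sum_add_distrib]
  have h2 : ((a i).filter fun y => dig y = dig x ∧ κ y < κ x).card =
      ∑ i', if i' = i then ((a i').filter fun y => dig y = dig x ∧ κ y < κ x).card else 0 := by
    simp
  rw [h2, ← sum_add_distrib]
  refine sum_congr rfl fun i' _ => ?_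
  have h3 : ∑ d with d < dig x, ((a i').filter fun y => dig y = d).card =
      ((a i').filter fun y => dig y < dig x).card := by
    rw [card_eq_sum_card_fiberwise (f := dig) (t := univ.filter (· < dig x))]
    · refine sum_congr rfl fun d hd => ?_
      rw [filter_filter]
      congr 1
      refine filter_congr fun y _ => ?_
      have := (mem_filter.mp hd).2
      constructor
      · rintro rfl; exact ⟨this, rfl⟩
      · exact fun h => h.2
    · intro y hy
      simpa using (mem_filter.mp hy).2
  rw [h3, filter_or, card_union_of_disjoint, add_assoc]
  · congr 1
    rcases lt_trichotomy i' i with h | h | h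
    · simp [h, h.ne]
    · subst h; simp
    · simp [h.ne', not_lt_of_gt h]
  · rw [disjoint_filter]
    rintro y _ h ⟨h', _⟩
    exact h.ne h'

variable [Fintype X] [Fintype Z] {f N : ℕ} [NeZero N]

/-- One pass of radix sort. -/
theorem Leads.pass [NeZero M] {S W T L β : ℕ} (hf : 0 < f) (hM : M = f ^ T) (hβ : 0 < β)
    (a : Γ → Fin M → Finset X) (z : Γ → Fin M → Multiset Z) (A : Γ → Finset X)
    (hdisj : ∀ γ, Pairwise fun i j => Disjoint (a γ i) (a γ j))
    (hA : ∀ γ, univ.biUnion (a γ) = A γ)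
    (hN : ∀ γ, (A γ).card < N) (dig : X → Fin D) (κ : X → ℕ) (hκ : Function.Injective κ)
    (hL : ∀ γ j, (a γ j).card + (z γ j).card ≤ L) (hL' : ∀ γ j, β + (z γ j).card ≤ L)
    (hS : L + 3 * (f * D) ≤ S) (hW : Fintype.card X + Fintype.card Z + 2 * (D * N) ≤ W) :
    ∃ r : Γ → X → ℕ, (∀ γ, Set.InjOn (r γ) (A γ)) ∧ (∀ γ, ∀ x ∈ A γ, r γ x < (A γ).card) ∧
      (∀ γ i j, ∀ x ∈ a γ i, ∀ y ∈ a γ j,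
        (dig x < dig y ∨ dig x = dig y ∧ (i < j ∨ i = j ∧ κ x < κ y)) → r γ x < r γ y) ∧
      Leads S W (fun γ j => (a γ j).val.disjSum (z γ j))
        (fun γ j => ((A γ).filter fun x => r γ x / β = j).val.disjSum (z γ j))
        (1 + T * 2 + 1) := by
  classical
  -- The digit comes first; ties are broken by the current machine and the local key, which makes
  -- the pass stable.
  let ρ : (Σ _ : Fin M, X) → Fin D ×ₗ (Fin M ×ₗ ℕ) :=
    fun p => toLex (dig p.2, toLex (p.1, κ p.2))
  have hρ : Function.Injective ρ := by
    rintro ⟨i, x⟩ ⟨j, y⟩ h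
    have h' : dig x = dig y ∧ i = j ∧ κ x = κ y := by simpa [ρ] using h
    obtain rfl := h'.2.1
    obtain rfl := hκ h'.2.2
    rfl
  -- Each item is on only one machine, so the rank is a function of the item alone. The value 0 for
  -- items that no machine holds is never used.
  have hex : ∀ γ, ∃ r : X → ℕ, ∀ i, ∀ x ∈ a γ i, r x = rankBy (univ.sigma (a γ)) ρ ⟨i, x⟩ := by
    intro γ
    refine ⟨fun x => if h : ∃ i, x ∈ a γ i then rankBy (univ.sigma (a γ)) ρ ⟨h.choose, x⟩ else 0,
      fun i x hx => ?_⟩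
    have h : ∃ i, x ∈ a γ i := ⟨i, hx⟩
    have hi : h.choose = i := by
      by_contra hne
      exact disjoint_left.mp (hdisj γ hne) h.choose_spec hx
    simp only [dif_pos h, hi]
  choose r hr using hex
  have hmem : ∀ γ x, x ∈ A γ ↔ ∃ i, x ∈ a γ i := by
    intro γ x
    rw [← hA]
    simp
  have hsig : ∀ γ, (univ.sigma (a γ)).card = (A γ).card := by
    intro γ
    rw [card_sigma, ← hA, card_biUnion fun i _ j _ hij => hdisj γ hij]
  have hinj : ∀ γ, Set.InjOn (r γ) (A γ) := by
    intro γ x hx y hy h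
    obtain ⟨i, hi⟩ := (hmem γ x).mp hx
    obtain ⟨j, hj⟩ := (hmem γ y).mp hy
    rw [hr γ i x hi, hr γ j y hj] at h
    have := rankBy_injOn (A := univ.sigma (a γ)) hρ.injOn (by simpa using hi) (by simpa using hj) h
    exact congrArg (fun p : (Σ _ : Fin M, X) => p.2) this
  have hlt : ∀ γ, ∀ x ∈ A γ, r γ x < (A γ).card := by
    intro γ x hx
    obtain ⟨i, hi⟩ := (hmem γ x).mp hx
    rw [hr γ i x hi, ← hsig]
    exact rankBy_lt_card (by simpa using hi)
  refine ⟨r, hinj, hlt, ?_, ?_⟩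
  · intro γ i j x hx y hy h
    rw [hr γ i x hx, hr γ j y hy]
    refine rankBy_lt_of_lt (by simpa using hx) ?_
    simpa [ρ, Prod.Lex.toLex_lt_toLex] using h
  · have hform : ∀ γ i, ∀ x ∈ a γ i, r γ x =
        (∑ d with d < dig x, ∑ i', ((a γ i').filter fun y => dig y = d).card) +
        (∑ i', if i' < i then ((a γ i').filter fun y => dig y = dig x).card else 0) +
        ((a γ i).filter fun y => dig y = dig x ∧ κ y < κ x).card := by
      intro γ i x hx
      rw [hr γ i x hx]
      exact rank_formula _ _ _ _ _
    have hX : Fintype.card (X ⊕ Z) ≤ W := by rw [Fintype.card_sum]; omega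
    have hY : Fintype.card ((X ⊕ Z) ⊕ ((Fin D × Fin N) ⊕ (Fin D × Fin N))) ≤ W := by
      simp only [Fintype.card_sum, Fintype.card_prod, Fintype.card_fin]
      omega
    have hfD : D ≤ f * D := Nat.le_mul_of_pos_left D hf
    have htot : ∀ γ d, ∑ i, ((a γ i).filter fun y => dig y = d).card < N := by
      intro γ d
      refine lt_of_le_of_lt ?_ (hN γ)
      rw [← hsig, card_sigma]
      exact sum_le_sum fun i _ => card_le_card (filter_subset _ _)
    -- The scanned vector counts the items of a machine by digit. In `rank_formula` the totals
    -- supply the first term, the prefixes the second, and the third is local; hence every machine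
    -- knows the destinations of its items.
    refine Leads.trans (Leads.scan (L := L) (N := N) (D := D) hf hM _
      (fun γ i d => ((a γ i).filter fun y => dig y = d).card) ?_ htot ?_ hS ?_) ?_
    · intro γ γ' i h
      have h' := val_injective (disjSum_injective h).1
      simp only [h']
    · intro γ j
      simpa using hL γ j
    · rw [Fintype.card_sum]; exact hW
    · have hpre : ∀ γ (i : Fin M) d,
          (∑ i', if i' < i then ((a γ i').filter fun y => dig y = d).card else 0) < N := by
        intro γ i d
        refine lt_of_le_of_lt (sum_le_sum fun i' _ => ?_) (htot γ d)
        split <;> simp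
      refine Leads.step (fun γ i j => ((a γ i).filter fun x => r γ x / β = j).val.disjSum
        (if i = j then z γ i else 0)) ?_ ?_ hY hX ?_ ?_ ?_
      · intro γ γ' i h
        obtain ⟨h1, h2, h3⟩ := withVecs_injective (htot γ) (htot γ') (hpre γ i) (hpre γ' i) h
        obtain ⟨h4, h5⟩ := disjSum_injective h1
        have h4 := val_injective h4
        funext j
        rw [h5, h4]
        congr 2
        refine filter_congr fun x hx => ?_
        have e : r γ x = r γ' x := by
          rw [hform γ i x (h4 ▸ hx), hform γ' i x hx, h4]
          have e2 := congrFun h3 (dig x)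
          rw [e2]
          congr 2
          exact sum_congr rfl fun d _ => congrFun h2 d
        rw [e]
      · intro γ j
        rw [sum_disjSum]
        congr 1
        · rw [← val_biUnion, ← hA, filter_biUnion]
          intro i i' hii
          exact (hdisj γ hii).mono (filter_subset _ _) (filter_subset _ _)
        · simp
      · intro γ j
        rw [card_withVecs, Multiset.card_disjSum]
        have := hL γ j
        simp only [card_val]
        omega
      · intro γ i
        simp only [Multiset.card_disjSum, sum_add_distrib, card_val]
        have h1 : ∑ j : Fin M, ((a γ i).filter fun x => r γ x / β = j).card ≤ (a γ i).card := by
          rw [← card_biUnion]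
          · exact card_le_card (biUnion_subset.mpr fun _ _ => filter_subset _ _)
          · intro j _ j' _ hj
            rw [Function.onFun, disjoint_filter]
            intro x _ h h'
            exact hj (Fin.ext (h.symm.trans h'))
        have h2 : ∑ j, (if i = j then z γ i else 0).card = (z γ i).card := by
          rw [sum_eq_single i]
          · simp
          · intro j _ hj; simp [hj.symm]
          · simp
        have := hL γ i
        omega
      · intro γ j
        rw [Multiset.card_disjSum, card_val]
        have h1 := card_block_le (hinj γ) hβ j
        have h2 := hL' γ j
        omega

end Pass

end MPC

/-! ### Sorted blocks and what a machine sees of them -/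

namespace MPC

open Finset

variable {M : ℕ} {Γ : Type*} {X Y Z : Type}

section Window

variable [LinearOrder X]

/-- The number of elements of `A` below `x`. -/
def rank (A : Finset X) (x : X) : ℕ := rankBy A id x

theorem rank_lt_iff {A : Finset X} {x y : X} (hx : x ∈ A) (hy : y ∈ A) :
    rank A x < rank A y ↔ x < y := rankBy_lt_iff hx hy Function.injective_id.injOn

theorem rank_injOn (A : Finset X) : Set.InjOn (rank A) A :=
  rankBy_injOn Function.injective_id.injOn

theorem rank_lt_card {A : Finset X} {x : X} (hx : x ∈ A) : rank A x < A.card :=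
  rankBy_lt_card hx

/-- The elements whose ranks lie in the `j`-th interval of length `β`. -/
def block (A : Finset X) (β j : ℕ) : Finset X := A.filter fun x => rank A x / β = j

theorem mem_block {A : Finset X} {β j : ℕ} {x : X} :
    x ∈ block A β j ↔ x ∈ A ∧ rank A x / β = j := mem_filter

theorem block_subset (A : Finset X) (β j : ℕ) : block A β j ⊆ A := filter_subset _ _

theorem disjoint_block (A : Finset X) (β : ℕ) {i j : ℕ} (h : i ≠ j) :
    Disjoint (block A β i) (block A β j) := by
  rw [block, block, disjoint_filter]
  intro x _ h1 h2
  exact h (h1.symm.trans h2)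

theorem card_block (A : Finset X) {β : ℕ} (hβ : 0 < β) (j : ℕ) : (block A β j).card ≤ β :=
  card_block_le (rank_injOn A) hβ j

theorem rank_div_lt {A : Finset X} {β : ℕ} (h : A.card ≤ M * β) {x : X} (hx : x ∈ A) :
    rank A x / β < M :=
  Nat.div_lt_of_lt_mul ((rank_lt_card hx).trans_le (h.trans_eq (mul_comm _ _)))

theorem biUnion_block [DecidableEq X] {A : Finset X} {β : ℕ} (h : A.card ≤ M * β) :
    univ.biUnion (fun j : Fin M => block A β j) = A := by
  ext x
  simp only [mem_biUnion, mem_univ, true_and, mem_block]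
  exact ⟨fun ⟨_, hx, _⟩ => hx, fun hx => ⟨⟨_, rank_div_lt h hx⟩, hx, rfl⟩⟩

/-- All ranks below `j * β` are taken by earlier blocks. A machine therefore knows the exact ranks
of its own items from its block and its number. -/
theorem rank_eq_of_mem_block {A : Finset X} {β j : ℕ} {x : X} (hx : x ∈ block A β j) :
    rank A x = j * β + ((block A β j).filter (· < x)).card := by
  obtain ⟨hxA, hj⟩ := mem_block.mp hx
  have hβj : j * β ≤ rank A x := by rw [← hj]; exact Nat.div_mul_le_self _ _
  have h := card_filter_of_ranks (rank_injOn A) (fun y hy => rank_lt_card hy)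
    (s := range (j * β)) (range_subset_range.mpr (hβj.trans (rank_lt_card hxA).le))
  rw [card_range] at h
  rw [← h, ← card_union_of_disjoint]
  · rw [rank, rankBy]
    congr 1
    ext y
    simp only [mem_union, mem_filter, mem_block, id, mem_range]
    constructor
    · rintro ⟨hy, hyx⟩
      by_cases hlt : rank A y < j * β
      · exact Or.inl ⟨hy, hlt⟩
      · refine Or.inr ⟨⟨hy, ?_⟩, hyx⟩
        have h1 := (rank_lt_iff hy hxA).mpr hyx
        have h2 := Nat.div_le_div_right (c := β) h1.le
        rcases Nat.eq_zero_or_pos β with rfl | hβ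
        · simpa using hj
        · have h3 := (Nat.le_div_iff_mul_le hβ).mpr (not_lt.mp hlt)
          omega
    · rintro (⟨hy, hlt⟩ | ⟨⟨hy, _⟩, hyx⟩)
      · exact ⟨hy, (rank_lt_iff hy hxA).mp (hlt.trans_le hβj)⟩
      · exact ⟨hy, hyx⟩
  · rw [disjoint_left]
    intro y hy hy'
    simp only [mem_filter, mem_block, mem_range] at hy hy'
    rcases Nat.eq_zero_or_pos β with rfl | hβ
    · simp at hy
    · have := (Nat.le_div_iff_mul_le hβ).mp hy'.1.2.ge
      omega

/-- The blocks `i` and `j` are equal or adjacent. -/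
def Near (i j : ℕ) : Prop := i ≤ j + 1 ∧ j ≤ i + 1

instance (i j : ℕ) : Decidable (Near i j) := inferInstanceAs (Decidable (_ ∧ _))

/-- The elements of the `j`-th block and of the two adjacent blocks. -/
def nearBlocks (A : Finset X) (β j : ℕ) : Finset X := A.filter fun x => Near (rank A x / β) j

theorem card_nearBlocks (A : Finset X) {β : ℕ} (hβ : 0 < β) (j : ℕ) :
    (nearBlocks A β j).card ≤ 3 * β := by
  have : (nearBlocks A β j).card ≤ (Ico ((j - 1) * β) ((j - 1) * β + 3 * β)).card := by
    refine card_le_card_of_injOn (rank A) (fun x hx => ?_)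
      ((rank_injOn A).mono (coe_subset.mpr (filter_subset _ _)))
    obtain ⟨h1, h2⟩ := (mem_filter.mp hx).2
    rw [mem_coe, mem_Ico, ← add_mul, ← Nat.le_div_iff_mul_le hβ, ← Nat.div_lt_iff_lt_mul hβ]
    generalize rank A x / β = m at h1 h2
    omega
  rwa [Nat.card_Ico, Nat.add_sub_cancel_left] at this

theorem card_near_le (i : ℕ) : (univ.filter fun j : Fin M => Near i j).card ≤ 3 := by
  have : (univ.filter fun j : Fin M => Near i j).card ≤ (Ico (i - 1) (i - 1 + 3)).card := by
    refine card_le_card_of_injOn (fun j : Fin M => (j : ℕ)) (fun j hj => ?_)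
      (Fin.val_injective.injOn)
    obtain ⟨h1, h2⟩ := (mem_filter.mp hj).2
    simp only [mem_coe, mem_Ico]
    omega
  rwa [Nat.card_Ico, Nat.add_sub_cancel_left] at this

/-- What machine `j` sees of the sorted set `A`: its own block and the adjacent ones, with ranks. -/
def window [DecidableEq X] (A : Finset X) (β j : ℕ) : Finset (ℕ × X) :=
  (nearBlocks A β j).image fun x => (rank A x, x)

theorem mem_window {A : Finset X} {β j : ℕ} {m : ℕ} {x : X} :
    (m, x) ∈ window A β j ↔ x ∈ A ∧ rank A x = m ∧ Near (m / β) j := by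
  simp only [window, nearBlocks, mem_image, mem_filter, Prod.mk.injEq]
  constructor
  · rintro ⟨y, ⟨h1, h2⟩, rfl, rfl⟩
    exact ⟨h1, rfl, h2⟩
  · rintro ⟨h1, rfl, h2⟩
    exact ⟨x, ⟨h1, h2⟩, rfl, rfl⟩

theorem nearBlocks_eq_of_window {A A' : Finset X} {β j : ℕ}
    (h : window A β j = window A' β j) : nearBlocks A β j = nearBlocks A' β j := by
  have e : ∀ A : Finset X, nearBlocks A β j = (window A β j).image Prod.snd := by
    intro A
    rw [window, image_image]
    exact image_id.symm
  rw [e, e, h]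

theorem block_eq_of_window {A A' : Finset X} {β j : ℕ}
    (h : window A β j = window A' β j) : block A β j = block A' β j := by
  have e : ∀ A : Finset X, block A β j =
      ((window A β j).filter fun p => p.1 / β = j).image Prod.snd := by
    intro A
    ext x
    simp only [mem_block, mem_image, mem_filter, Prod.exists, mem_window, exists_eq_right]
    constructor
    · rintro ⟨h1, h2⟩
      exact ⟨_, ⟨h1, rfl, by rw [h2]; simp [Near]⟩, h2⟩
    · rintro ⟨m, ⟨h1, rfl, _⟩, h3⟩
      exact ⟨h1, h3⟩
  rw [e, e, h]

theorem block_subset_nearBlocks (A : Finset X) (β j : ℕ) : block A β j ⊆ nearBlocks A β j := by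
  intro x hx
  obtain ⟨h1, h2⟩ := mem_block.mp hx
  exact mem_filter.mpr ⟨h1, by rw [h2]; simp [Near]⟩

theorem rank_eq_of_window {A A' : Finset X} {β j : ℕ}
    (h : window A β j = window A' β j) {x : X} (hx : x ∈ nearBlocks A β j) :
    rank A x = rank A' x := by
  have h1 : (rank A x, x) ∈ window A β j := mem_image.mpr ⟨x, hx, rfl⟩
  rw [h] at h1
  exact (mem_window.mp h1).2.1.symm

/-- A convex part of `A` that meets the `j`-th block and is not larger than a block lies within the
`j`-th block and the two adjacent ones. -/
theorem filter_subset_nearBlocks {A : Finset X} {β j : ℕ} {x : X} (hx : x ∈ block A β j)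
    {P : X → Prop} [DecidablePred P] (hP : ∀ y z w, P y → P w → y ≤ z → z ≤ w → P z)
    (hPx : P x) (hcard : (A.filter P).card ≤ β) : A.filter P ⊆ nearBlocks A β j := by
  obtain ⟨hxA, hj⟩ := mem_block.mp hx
  have hβ : 0 < β := lt_of_lt_of_le (card_pos.mpr ⟨x, mem_filter.mpr ⟨hxA, hPx⟩⟩) hcard
  -- By convexity everything of `A` between `y` and `w` satisfies `P`, so their ranks differ by less
  -- than the size of that part.
  have key : ∀ y ∈ A, ∀ w ∈ A, P y → P w → y ≤ w → rank A w < rank A y + β := by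
    intro y hy w hw hPy hPw hyw
    have h : (A.filter (· < w)).card ≤ (A.filter (· < y)).card + ((A.filter P).erase w).card := by
      refine le_trans (card_le_card ?_) (card_union_le _ _)
      intro v hv
      obtain ⟨hvA, hvw⟩ := mem_filter.mp hv
      rcases lt_or_ge v y with h | h
      · exact mem_union_left _ (mem_filter.mpr ⟨hvA, h⟩)
      · exact mem_union_right _ (mem_erase.mpr ⟨hvw.ne, mem_filter.mpr
          ⟨hvA, hP y v w hPy hPw h hvw.le⟩⟩)
    have h2 : ((A.filter P).erase w).card < (A.filter P).card :=
      card_lt_card (erase_ssubset (mem_filter.mpr ⟨hw, hPw⟩))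
    change (A.filter (· < w)).card < (A.filter (· < y)).card + β
    omega
  intro y hy
  obtain ⟨hyA, hPy⟩ := mem_filter.mp hy
  refine mem_filter.mpr ⟨hyA, ?_⟩
  rw [← hj]
  rcases le_total x y with h | h
  · have h1 := key x hxA y hyA hPx hPy h
    have h2 : rank A x ≤ rank A y := card_le_card fun v hv => by
      simp only [mem_filter, id] at hv ⊢
      exact ⟨hv.1, hv.2.trans_le h⟩
    have h3 := Nat.div_le_div_right (c := β) h1.le
    have h4 := Nat.div_le_div_right (c := β) h2
    rw [Nat.add_div_right _ hβ] at h3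
    exact ⟨h3, by omega⟩
  · have h1 := key y hyA x hxA hPy hPx h
    have h2 : rank A y ≤ rank A x := card_le_card fun v hv => by
      simp only [mem_filter, id] at hv ⊢
      exact ⟨hv.1, hv.2.trans_le h⟩
    have h3 := Nat.div_le_div_right (c := β) h1.le
    have h4 := Nat.div_le_div_right (c := β) h2
    rw [Nat.add_div_right _ hβ] at h3
    exact ⟨by omega, h3⟩

/-- Whether a convex part of `A` has at most `d` elements can be seen from the adjacent blocks. -/
theorem card_filter_nearBlocks_le_iff {A : Finset X} {β j d : ℕ} {x : X} (hx : x ∈ block A β j)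
    {P : X → Prop} [DecidablePred P] (hP : ∀ y z w, P y → P w → y ≤ z → z ≤ w → P z)
    (hPx : P x) (hd : d ≤ β) :
    ((nearBlocks A β j).filter P).card ≤ d ↔ (A.filter P).card ≤ d := by
  refine ⟨fun h => ?_, fun h => (card_le_card (filter_subset_filter _ (filter_subset _ _))).trans h⟩
  by_contra hlt
  obtain ⟨hxA, hj⟩ := mem_block.mp hx
  have hne : ¬ A.filter P ⊆ nearBlocks A β j := by
    intro hs
    apply hlt
    refine le_trans (card_le_card ?_) h
    intro y hy
    exact mem_filter.mpr ⟨hs hy, (mem_filter.mp hy).2⟩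
  obtain ⟨y, hy, hy'⟩ := not_subset.mp hne
  obtain ⟨hyA, hPy⟩ := mem_filter.mp hy
  have hfar : ¬ Near (rank A y / β) j := fun hn => hy' (mem_filter.mpr ⟨hyA, hn⟩)
  have hβ : 0 < β := by
    rcases Nat.eq_zero_or_pos β with rfl | h0
    · simp only [Nat.div_zero] at hj hfar
      subst hj
      simp [Near] at hfar
    · exact h0
  -- The ranks between that of `x` and the far end of the adjacent block.
  have key : ∀ s : Finset ℕ, β < s.card → (∀ m ∈ s, m < A.card) →
      (∀ v ∈ A, rank A v ∈ s → Near (rank A v / β) j ∧ P v) → False := by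
    intro s hs hlt' hv
    have h1 := card_filter_of_ranks (rank_injOn A) (fun y hy => rank_lt_card hy)
      (s := s) (fun m hm => mem_range.mpr (hlt' m hm))
    have h2 : A.filter (fun v => rank A v ∈ s) ⊆ (nearBlocks A β j).filter P := by
      intro v hv'
      obtain ⟨hvA, hvs⟩ := mem_filter.mp hv'
      obtain ⟨h3, h4⟩ := hv v hvA hvs
      exact mem_filter.mpr ⟨mem_filter.mpr ⟨hvA, h3⟩, h4⟩
    have := card_le_card h2
    omega
  have hle : ∀ {v w}, v ∈ A → w ∈ A → rank A v ≤ rank A w → v ≤ w := by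
    intro v w hv hw hvw
    by_contra hlt
    exact absurd ((rank_lt_iff hw hv).mpr (not_le.mp hlt)) hvw.not_gt
  have hxj := (Nat.div_eq_iff hβ).mp hj
  rcases lt_or_ge (rank A x) (rank A y) with hxy | hxy
  · have h1 : j + 2 ≤ rank A y / β := by
      have := Nat.div_le_div_right (c := β) hxy.le
      simp only [Near] at hfar
      omega
    have h2 := (Nat.le_div_iff_mul_le hβ).mp h1
    rw [add_mul] at h2
    have hyc := rank_lt_card hyA
    -- As `y` lies beyond block `j + 1`, all elements from `x` to the end of that block satisfy `P`.
    -- They number more than `β`, because the rank of `x` is less than `(j + 1) * β`.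
    refine key (Ico (rank A x) (j * β + 2 * β)) ?_ ?_ ?_
    · rw [Nat.card_Ico]; omega
    · intro m hm; rw [mem_Ico] at hm; omega
    · intro v hv hvs
      rw [mem_Ico] at hvs
      refine ⟨⟨?_, ?_⟩, hP x v y hPx hPy (hle hxA hv hvs.1) (hle hv hyA (by omega))⟩
      · have : rank A v / β < j + 2 := by
          rw [Nat.div_lt_iff_lt_mul hβ, add_mul]; omega
        omega
      · have := Nat.div_le_div_right (c := β) hvs.1
        omega
  · have h1 : rank A y / β + 2 ≤ j := by
      have := Nat.div_le_div_right (c := β) hxy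
      simp only [Near] at hfar
      omega
    have h2 : rank A y < (j - 1) * β := by
      rw [← Nat.div_lt_iff_lt_mul hβ]
      generalize rank A y / β = m at h1
      omega
    have hj0 : 1 ≤ j := (Nat.le_add_left 1 _).trans h1
    have h3 : (j - 1) * β + β = j * β := by
      rw [← Nat.succ_mul, Nat.succ_eq_add_one, Nat.sub_add_cancel hj0]
    have hxc := rank_lt_card hxA
    -- Symmetrically, all elements from the start of block `j - 1` up to and including `x` satisfy
    -- `P`; including `x` makes their number exceed `β`.
    refine key (Ico ((j - 1) * β) (rank A x + 1)) ?_ ?_ ?_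
    · rw [Nat.card_Ico]; omega
    · intro m hm; rw [mem_Ico] at hm; omega
    · intro v hv hvs
      rw [mem_Ico] at hvs
      refine ⟨⟨?_, ?_⟩, hP y v x hPy hPx (hle hyA hv (by omega)) (hle hv hxA (by omega))⟩
      · have := Nat.div_le_div_right (c := β) (Nat.le_of_lt_succ hvs.2)
        omega
      · have := (Nat.le_div_iff_mul_le hβ).mpr hvs.1
        omega

end Window

end MPC

/-! ### Parameters, and radix sort in a bounded number of passes -/

namespace MPC

open Finset

variable {M : ℕ} {Γ : Type*} {X Y Z : Type}

/-- Parameters of a family of `M` machines with `S` words below `W`, whose blocks have `b` words: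
`M` is the `T`-th power of the fan-out `f`, and items are sorted by `p` digits to base `D`. -/
structure Setup (M S W b : ℕ) where
  (f T D p N : ℕ)
  f_pos : 0 < f
  M_eq : M = f ^ T
  p_pos : 0 < p
  D_pos : 0 < D
  b_pos : 0 < b
  fD_le : f * D ≤ b
  le_S : 16 * b ≤ S
  lt_N : M * b < N
  le_W : (N + 2) * D ^ p + 2 * (D * N) ≤ W

namespace Setup

variable {S W b : ℕ}

/-- The number of rounds of sorting. -/
def sortRounds (Q : Setup M S W b) : ℕ := Q.p * (1 + Q.T * 2 + 1)

theorem M_pos (Q : Setup M S W b) : 0 < M := by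
  rw [Q.M_eq]; exact pow_pos Q.f_pos _

theorem N_pos (Q : Setup M S W b) : 0 < Q.N := lt_of_le_of_lt (Nat.zero_le _) Q.lt_N

theorem le_W_of_le (Q : Setup M S W b) {m : ℕ} (h : m ≤ 2 * Q.D ^ Q.p) : m ≤ W := by
  have := Q.le_W
  rw [add_mul] at this
  omega

variable [LinearOrder X] [Fintype X] [Fintype Z]

/-- Radix sort. -/
theorem leads_sort [NeZero M] (Q : Setup M S W b) {β : ℕ} (hβ : 0 < β) (hβb : β ≤ b)
    (a : Γ → Fin M → Finset X) (z : Γ → Fin M → Multiset Z) (A : Γ → Finset X)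
    (hdisj : ∀ γ, Pairwise fun i j => Disjoint (a γ i) (a γ j))
    (hA : ∀ γ, univ.biUnion (a γ) = A γ) (hcard : ∀ γ, (A γ).card ≤ M * β)
    (hL : ∀ γ j, (a γ j).card + (z γ j).card ≤ 13 * b)
    (hL' : ∀ γ j, β + (z γ j).card ≤ 13 * b)
    (hX : Fintype.card X ≤ Q.D ^ Q.p) (hZ : Fintype.card Z ≤ Q.D ^ Q.p) :
    Leads S W (fun γ j => (a γ j).val.disjSum (z γ j))
      (fun γ j => (block (A γ) β j).val.disjSum (z γ j)) Q.sortRounds := by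
  have : NeZero Q.N := ⟨Q.N_pos.ne'⟩
  have hMβ : M * β ≤ M * b := Nat.mul_le_mul_left M hβb
  have hN : ∀ γ, (A γ).card < Q.N := fun γ => ((hcard γ).trans hMβ).trans_lt Q.lt_N
  have hS : 13 * b + 3 * (Q.f * Q.D) ≤ S := by
    have := Q.fD_le
    have := Q.le_S
    omega
  have hW : Fintype.card X + Fintype.card Z + 2 * (Q.D * Q.N) ≤ W := by
    have := Q.le_W
    rw [add_mul] at this
    omega
  -- The sort keys are the positions in the order of `X`, which have `p` digits to base `D`.
  let e : X → ℕ := rankBy univ id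
  have he_lt : ∀ x, e x < Q.D ^ Q.p := fun x =>
    (rankBy_lt_card (mem_univ x)).trans_le (by simpa using hX)
  have he_inj : Function.Injective e := fun x y h =>
    rankBy_injOn Function.injective_id.injOn (by simp) (by simp) h
  have he_mono : ∀ x y, x < y → e x < e y := fun x y h => rankBy_lt_of_lt (mem_univ x) h
  let dig : ℕ → X → Fin Q.D := fun t x => ⟨e x / Q.D ^ t % Q.D, Nat.mod_lt _ Q.D_pos⟩
  -- Inside a machine ties are broken by the digits treated so far; adding `e x` makes the key
  -- injective.
  let κ : ℕ → X → ℕ := fun t x => (e x % Q.D ^ t) * Q.D ^ Q.p + e x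
  have hκ : ∀ t, Function.Injective (κ t) := by
    intro t x y h
    have h1 := congrArg (· % Q.D ^ Q.p) h
    simp only [κ, Nat.mul_add_mod_self_right, Nat.mod_eq_of_lt (he_lt _)] at h1
    exact he_inj h1
  have hκ_mono : ∀ t x y, e x % Q.D ^ t < e y % Q.D ^ t → κ t x < κ t y := by
    intro t x y h
    have h1 : (e x % Q.D ^ t + 1) * Q.D ^ Q.p ≤ (e y % Q.D ^ t) * Q.D ^ Q.p :=
      Nat.mul_le_mul_right _ h
    have h2 := he_lt x
    rw [add_mul, one_mul] at h1
    simp only [κ]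
    omega
  have hkey : ∀ t x y, e x % Q.D ^ (t + 1) < e y % Q.D ^ (t + 1) → dig t x < dig t y ∨
      dig t x = dig t y ∧ e x % Q.D ^ t < e y % Q.D ^ t := by
    intro t x y h
    rw [Nat.mod_pow_succ, Nat.mod_pow_succ] at h
    rcases lt_trichotomy (e x / Q.D ^ t % Q.D) (e y / Q.D ^ t % Q.D) with h1 | h1 | h1
    · exact Or.inl h1
    · rw [h1] at h
      exact Or.inr ⟨Fin.ext h1, by omega⟩
    · exfalso
      have h2 : Q.D ^ t * (e y / Q.D ^ t % Q.D + 1) ≤ Q.D ^ t * (e x / Q.D ^ t % Q.D) :=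
        Nat.mul_le_mul_left _ h1
      have h3 := Nat.mod_lt (e y) (pow_pos Q.D_pos t)
      rw [mul_add, mul_one] at h2
      refine absurd h (not_lt.mpr ?_)
      calc e y % Q.D ^ t + Q.D ^ t * (e y / Q.D ^ t % Q.D)
          ≤ Q.D ^ t * (e y / Q.D ^ t % Q.D) + Q.D ^ t := by rw [add_comm]; gcongr
        _ ≤ Q.D ^ t * (e x / Q.D ^ t % Q.D) := h2
        _ ≤ _ := Nat.le_add_left _ _
  have main : ∀ t, ∃ r : Γ → X → ℕ, (∀ γ, Set.InjOn (r γ) (A γ)) ∧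
      (∀ γ, ∀ x ∈ A γ, r γ x < (A γ).card) ∧
      (∀ γ, ∀ x ∈ A γ, ∀ y ∈ A γ, e x % Q.D ^ (t + 1) < e y % Q.D ^ (t + 1) → r γ x < r γ y) ∧
      Leads S W (fun γ j => (a γ j).val.disjSum (z γ j))
        (fun γ j => ((A γ).filter fun x => r γ x / β = j).val.disjSum (z γ j))
        ((t + 1) * (1 + Q.T * 2 + 1)) := by
    intro t
    induction t with
    | zero =>
      obtain ⟨r, h1, h2, h3, h4⟩ := Leads.pass Q.f_pos Q.M_eq hβ a z A hdisj hA hN (dig 0) (κ 0)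
        (hκ 0) hL hL' hS hW
      refine ⟨r, h1, h2, fun γ x hx y hy h => ?_, by rwa [zero_add, one_mul]⟩
      rw [← hA] at hx hy
      obtain ⟨i, -, hi⟩ := mem_biUnion.mp hx
      obtain ⟨j, -, hj⟩ := mem_biUnion.mp hy
      refine h3 γ i j x hi y hj ?_
      rcases hkey 0 x y h with h' | ⟨_, h'⟩
      · exact Or.inl h'
      · simp [Nat.mod_one] at h'
    | succ t ih =>
      obtain ⟨r, h1, h2, h3, h4⟩ := ih
      have hdiv : ∀ γ, ∀ x ∈ A γ, r γ x / β < M := fun γ x hx =>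
        Nat.div_lt_of_lt_mul ((h2 γ x hx).trans_le ((hcard γ).trans_eq (mul_comm _ _)))
      obtain ⟨r', h1', h2', h3', h4'⟩ := Leads.pass (S := S) (W := W) Q.f_pos Q.M_eq hβ
        (fun γ (j : Fin M) => (A γ).filter fun x => r γ x / β = j) z A
        (by
          intro γ i j hij
          simp only [disjoint_filter]
          intro x _ h h'
          exact hij (Fin.ext (h.symm.trans h')))
        (by
          intro γ
          ext x
          simp only [mem_biUnion, mem_univ, true_and, mem_filter]
          exact ⟨fun ⟨_, hx, _⟩ => hx, fun hx => ⟨⟨_, hdiv γ x hx⟩, hx, rfl⟩⟩)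
        hN (dig (t + 1)) (κ (t + 1)) (hκ (t + 1)) (L := 13 * b)
        (by
          intro γ j
          exact le_trans (Nat.add_le_add_right (card_block_le (h1 γ) hβ j) _) (hL' γ j))
        hL' hS hW
      refine ⟨r', h1', h2', fun γ x hx y hy h => ?_, ?_⟩
      · refine h3' γ ⟨_, hdiv γ x hx⟩ ⟨_, hdiv γ y hy⟩ x (mem_filter.mpr ⟨hx, rfl⟩) y
          (mem_filter.mpr ⟨hy, rfl⟩) ?_
        rcases hkey (t + 1) x y h with h' | ⟨h5, h6⟩
        · exact Or.inl h'
        · refine Or.inr ⟨h5, ?_⟩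
          have h7 := Nat.div_le_div_right (c := β) (h3 γ x hx y hy h6).le
          rcases h7.lt_or_eq with h8 | h8
          · exact Or.inl h8
          · exact Or.inr ⟨Fin.ext h8, hκ_mono _ _ _ h6⟩
      · rw [add_mul (t + 1) 1, one_mul]
        exact h4.trans h4'
  -- The statement for `t` concerns `t + 1` passes. After all `p` of them the comparison is by `e`
  -- itself.
  obtain ⟨r, h1, h2, h3, h4⟩ := main (Q.p - 1)
  rw [Nat.sub_add_cancel Q.p_pos] at h3 h4
  have e1 : (fun γ (j : Fin M) => ((A γ).filter fun x => r γ x / β = j).val.disjSum (z γ j)) =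
      fun γ (j : Fin M) => (block (A γ) β j).val.disjSum (z γ j) := by
    funext γ j
    congr 2
    refine filter_congr fun x hx => ?_
    rw [eq_rankBy (ρ := id) (h1 γ) (h2 γ) (fun x hx y hy h => h3 γ x hx y hy ?_)
      Function.injective_id.injOn hx]
    · rfl
    · rw [Nat.mod_eq_of_lt (he_lt x), Nat.mod_eq_of_lt (he_lt y)]
      exact he_mono x y h
  rw [e1] at h4
  exact h4

variable [Fintype Y]

/-- Sort, then apply a local map on every machine, which sees its own block and the two adjacent
ones together with the ranks. -/
theorem leads_sort_map [NeZero M] (Q : Setup M S W b) {β : ℕ} (hβ : 0 < β) (hβb : β ≤ b)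
    (a : Γ → Fin M → Finset X) (z : Γ → Fin M → Multiset Z) (A : Γ → Finset X)
    (y : Γ → Fin M → Multiset Y)
    (hdisj : ∀ γ, Pairwise fun i j => Disjoint (a γ i) (a γ j))
    (hA : ∀ γ, univ.biUnion (a γ) = A γ) (hcard : ∀ γ, (A γ).card ≤ M * β)
    (hy : ∀ γ γ' (j : Fin M), window (A γ) β j = window (A γ') β j → z γ j = z γ' j → y γ j = y γ' j)
    (hL : ∀ γ j, (a γ j).card + (z γ j).card ≤ 13 * b)
    (hz : ∀ γ j, (z γ j).card ≤ 10 * b) (hyc : ∀ γ j, (y γ j).card ≤ 16 * b)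
    (hX : Fintype.card X ≤ Q.D ^ Q.p) (hZ : Fintype.card Z ≤ Q.D ^ Q.p)
    (hY : Fintype.card Y ≤ 2 * Q.D ^ Q.p) :
    Leads S W (fun γ j => (a γ j).val.disjSum (z γ j)) y (Q.sortRounds + 2) := by
  have : NeZero Q.N := ⟨Q.N_pos.ne'⟩
  have hL' : ∀ γ j, β + (z γ j).card ≤ 13 * b := by
    intro γ j
    have := hz γ j
    omega
  have hMβ : M * β ≤ M * b := Nat.mul_le_mul_left M hβb
  have hrN : ∀ γ, ∀ x ∈ A γ, rank (A γ) x < Q.N := fun γ x hx =>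
    (rank_lt_card hx).trans (((hcard γ).trans hMβ).trans_lt Q.lt_N)
  have hS := Q.le_S
  -- Items travel to the neighbouring machines with their ranks attached. Ranks are below `Q.N`, so
  -- the reduction modulo `Q.N` changes nothing.
  let g : Γ → X → Fin Q.N × X := fun γ x => (Fin.ofNat Q.N (rank (A γ) x), x)
  have hg : ∀ γ, ∀ x ∈ A γ, ((g γ x).1 : ℕ) = rank (A γ) x := fun γ x hx =>
    Nat.mod_eq_of_lt (hrN γ x hx)
  have hXZ : Fintype.card (X ⊕ Z) ≤ W := by
    rw [Fintype.card_sum]; exact Q.le_W_of_le (by omega)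
  have hWd : Fintype.card ((Fin Q.N × X) ⊕ Z) ≤ W := by
    have h1 := Q.le_W
    simp only [Fintype.card_sum, Fintype.card_prod, Fintype.card_fin]
    have h2 : Q.N * Fintype.card X ≤ Q.N * Q.D ^ Q.p := Nat.mul_le_mul_left _ hX
    rw [add_mul] at h1
    omega
  have hwin : ∀ γ (j : Fin M), ∑ i : Fin M, ((block (A γ) β i).filter fun x =>
      Near (rank (A γ) x / β) j).val.map (g γ) = (nearBlocks (A γ) β j).val.map (g γ) := by
    intro γ j
    rw [← map_sum_multiset, ← val_biUnion]
    · congr 2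
      ext x
      simp only [mem_biUnion, mem_univ, true_and, mem_filter, mem_block, nearBlocks]
      constructor
      · rintro ⟨i, ⟨h1, _⟩, h2⟩
        exact ⟨h1, h2⟩
      · rintro ⟨h1, h2⟩
        exact ⟨⟨_, rank_div_lt (hcard γ) h1⟩, ⟨h1, rfl⟩, h2⟩
    · intro i i' hii
      exact (disjoint_block _ _ (Fin.val_injective.ne hii)).mono (filter_subset _ _)
        (filter_subset _ _)
  have hwinc : ∀ γ (j : Fin M), (((nearBlocks (A γ) β j).val.map (g γ)).disjSum (z γ j)).card ≤ S := by
    intro γ j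
    have h1 := card_nearBlocks (A γ) hβ j
    have h2 := hz γ j
    rw [Multiset.card_disjSum, Multiset.card_map, card_val]
    omega
  refine (Q.leads_sort hβ hβb a z A hdisj hA hcard hL hL' hX hZ).trans (Leads.trans (r := 1)
    (s := 1) (c' := fun γ j => ((nearBlocks (A γ) β j).val.map (g γ)).disjSum (z γ j))
    (Leads.step (fun γ i j => (((block (A γ) β i).filter fun x =>
      Near (rank (A γ) x / β) j).val.map (g γ)).disjSum (if i = j then z γ i else 0))
      ?_ ?_ hXZ hWd ?_ ?_ hwinc) (Leads.map ?_ hWd (Q.le_W_of_le hY) hwinc ?_))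
  · intro γ γ' i h
    obtain ⟨h1, h2⟩ := disjSum_injective h
    have h1 := val_injective h1
    funext j
    rw [h2]
    congr 1
    have hr : ∀ x ∈ block (A γ) β i, rank (A γ) x = rank (A γ') x := by
      intro x hx
      rw [rank_eq_of_mem_block hx, rank_eq_of_mem_block (h1 ▸ hx), h1]
    have h3 : ((block (A γ) β i).filter fun x => Near (rank (A γ) x / β) j) =
        (block (A γ') β i).filter fun x => Near (rank (A γ') x / β) j := by
      rw [← h1]
      refine filter_congr fun x hx => ?_
      rw [hr x hx]
    rw [← h3]
    refine Multiset.map_congr rfl fun x hx => ?_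
    have hx' := (mem_filter.mp (mem_val.mp hx)).1
    simp only [g, hr x hx']
  · intro γ j
    rw [sum_disjSum, hwin]
    congr 1
    simp
  · intro γ j
    have h1 := card_block (A γ) hβ j
    have h2 := hz γ j
    rw [Multiset.card_disjSum, card_val]
    omega
  · intro γ i
    simp only [Multiset.card_disjSum, sum_add_distrib, Multiset.card_map, card_val]
    have h1 : ∀ j : Fin M, ((block (A γ) β i).filter fun x => Near (rank (A γ) x / β) j).card ≤
        if Near i j then β else 0 := by
      intro j
      split_ifs with h
      · exact (card_le_card (filter_subset _ _)).trans (card_block _ hβ _)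
      · rw [Nat.le_zero, card_eq_zero, filter_eq_empty_iff]
        intro x hx
        rw [(mem_block.mp hx).2]
        exact h
    have h2 : ∑ j : Fin M, (if Near i j then β else 0) ≤ 3 * β := by
      rw [← sum_filter, sum_const, smul_eq_mul]
      exact Nat.mul_le_mul_right _ (card_near_le _)
    have h3 := (sum_le_sum fun j _ => h1 j).trans h2
    have h4 : ∑ j, (if i = j then z γ i else 0).card = (z γ i).card := by
      rw [sum_eq_single i]
      · simp
      · intro j _ hj; simp [hj.symm]
      · simp
    have h5 := hz γ i
    omega
  · intro γ γ' j h
    obtain ⟨h1, h2⟩ := disjSum_injective h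
    refine hy γ γ' j ?_ h2
    have e : ∀ γ, window (A γ) β j = (((nearBlocks (A γ) β j).val.map (g γ)).map
        fun q => ((q.1 : ℕ), q.2)).toFinset := by
      intro γ
      ext ⟨m, x⟩
      simp only [Multiset.map_map, Multiset.mem_toFinset, Multiset.mem_map, Function.comp,
        Prod.mk.injEq, mem_val, window, mem_image]
      constructor
      · rintro ⟨v, hv, rfl, rfl⟩
        exact ⟨v, hv, hg γ v (mem_filter.mp hv).1, rfl⟩
      · rintro ⟨v, hv, rfl, rfl⟩
        exact ⟨v, hv, (hg γ v (mem_filter.mp hv).1).symm, rfl⟩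
    rw [e, e, h1]
  · intro γ j
    exact (hyc γ j).trans hS

end Setup

/-! ### Charging cliques to their first vertex of low degree -/

section Graph

variable {n : ℕ} (G : SimpleGraph (Fin n)) (d : ℕ)

open Classical in
/-- The neighbours of a vertex. -/
noncomputable def nbrs (u : Fin n) : Finset (Fin n) := univ.filter fun v => G.Adj u v

/-- The vertices of degree at most `d`. -/
def Low (u : Fin n) : Prop := (nbrs G u).card ≤ d

/-- The subgraph that is left after all edges at vertices of degree at most `d` are removed. -/
def peel : SimpleGraph (Fin n) where
  Adj u v := G.Adj u v ∧ ¬ Low G d u ∧ ¬ Low G d v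
  symm := ⟨fun _ _ h => ⟨h.1.symm, h.2.2, h.2.1⟩⟩
  loopless := ⟨fun _ h => G.loopless.irrefl _ h.1⟩

open Classical in
/-- The neighbours of a vertex of low degree that are of high degree or come after it. -/
noncomputable def fwd (v : Fin n) : Finset (Fin n) :=
  univ.filter fun u => Low G d v ∧ G.Adj v u ∧ (¬ Low G d u ∨ v < u)

variable {G d}

theorem mem_nbrs {u v : Fin n} : v ∈ nbrs G u ↔ G.Adj u v := by simp [nbrs]

theorem mem_fwd {v u : Fin n} :
    u ∈ fwd G d v ↔ Low G d v ∧ G.Adj v u ∧ (¬ Low G d u ∨ v < u) := by simp [fwd]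

theorem card_fwd_le (v : Fin n) : (fwd G d v).card ≤ d := by
  by_cases h : Low G d v
  · exact (card_le_card fun u hu => mem_nbrs.mpr (mem_fwd.mp hu).2.1).trans h
  · rw [card_eq_zero.mpr]
    · exact Nat.zero_le _
    · exact eq_empty_of_forall_notMem fun u hu => h (mem_fwd.mp hu).1

/-- Used for double counting: the indicator of a nonempty set is replaced by a sum over all possible
least elements. -/
theorem card_least {α : Type*} [LinearOrder α] [Fintype α] {s : Finset α} (h : s.Nonempty) :
    (univ.filter fun u => u ∈ s ∧ ∀ w ∈ s, u ≤ w).card = 1 := by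
  rw [card_eq_one]
  refine ⟨s.min' h, ?_⟩
  ext u
  simp only [mem_filter, mem_univ, true_and, mem_singleton]
  constructor
  · rintro ⟨h1, h2⟩
    exact le_antisymm (h2 _ (s.min'_mem h)) (s.min'_le _ h1)
  · rintro rfl
    exact ⟨s.min'_mem h, fun w hw => s.min'_le _ hw⟩

variable (G d) in
open Classical in
/-- The number of `k`-cliques in `G` of which `v` is the first vertex of low degree and `u` is the
first of the other vertices. -/
noncomputable def weight (k : ℕ) (v u : Fin n) : ℕ :=
  (univ.filter fun s : Finset (Fin n) =>
    s ⊆ fwd G d v ∧ G.IsNClique (k - 1) s ∧ u ∈ s ∧ ∀ w ∈ s, u ≤ w).card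

open Classical in
theorem numCliques_eq_card (G : SimpleGraph (Fin n)) (k : ℕ) :
    G.numCliques k = (univ.filter fun s : Finset (Fin n) => G.IsNClique k s).card := by
  rw [SimpleGraph.numCliques, ← Set.ncard_coe_finset]
  congr 1
  ext s
  simp

/-- With at least two vertices, every vertex of a clique is on one of its edges, and peeled edges
have no end of low degree. For a single vertex this fails. -/
theorem peel_isNClique_iff {k : ℕ} (hk : 2 ≤ k) {s : Finset (Fin n)} :
    (peel G d).IsNClique k s ↔ G.IsNClique k s ∧ ∀ v ∈ s, ¬ Low G d v := by
  simp only [SimpleGraph.isNClique_iff, SimpleGraph.isClique_iff, Set.Pairwise]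
  constructor
  · rintro ⟨h1, h2⟩
    refine ⟨⟨fun u hu v hv huv => (h1 hu hv huv).1, h2⟩, fun v hv => ?_⟩
    obtain ⟨w, hw, hne⟩ := exists_mem_ne (by omega : 1 < s.card) v
    exact (h1 hv hw hne.symm).2.1
  · rintro ⟨⟨h1, h2⟩, h3⟩
    exact ⟨fun u hu v hv huv => ⟨h1 hu hv huv, h3 u hu, h3 v hv⟩, h2⟩

-- Each (k-1)-clique is attributed to its least vertex, so that the count at `v` is spread over the
-- forward edges of `v`. This matches items that are held by different machines.
open Classical in
theorem sum_weight {k : ℕ} (hk : 2 ≤ k) (v : Fin n) : ∑ u ∈ fwd G d v, weight G d k v u =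
    (univ.filter fun s : Finset (Fin n) => s ⊆ fwd G d v ∧ G.IsNClique (k - 1) s).card := by
  simp only [weight, card_filter]
  rw [sum_comm]
  refine sum_congr rfl fun s _ => ?_
  by_cases h : s ⊆ fwd G d v ∧ G.IsNClique (k - 1) s
  · have hne : s.Nonempty := card_pos.mp (by rw [h.2.card_eq]; omega)
    have h1 := card_least hne
    rw [card_filter] at h1
    rw [if_pos h]
    refine Eq.trans ?_ h1
    rw [← sum_subset (subset_univ (fwd G d v))]
    · refine sum_congr rfl fun u _ => ?_
      simp only [h.1, h.2, true_and]
      congr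
    · intro u _ hu
      rw [if_neg]
      exact fun h' => hu (h.1 h'.1)
  · rw [if_neg h]
    refine sum_eq_zero fun u _ => if_neg fun h' => h ⟨h'.1, h'.2.1⟩

-- Removing `v` from the clique and putting it back are inverse to each other. The other vertices
-- are forward neighbours, because each of them is of high degree or comes after `v`.
open Classical in
theorem card_cliques_through {k : ℕ} (hk : 2 ≤ k) (v : Fin n) :
    (univ.filter fun s : Finset (Fin n) => G.IsNClique k s ∧
      v ∈ s.filter (Low G d) ∧ ∀ w ∈ s.filter (Low G d), v ≤ w).card =
    (univ.filter fun s : Finset (Fin n) => s ⊆ fwd G d v ∧ G.IsNClique (k - 1) s).card := by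
  refine card_nbij' (fun s => s.erase v) (fun s => insert v s) ?_ ?_ ?_ ?_
  · intro s hs
    simp only [coe_filter, mem_univ, true_and, Set.mem_ofPred_eq, mem_filter] at hs ⊢
    obtain ⟨h1, ⟨h2, h3⟩, h4⟩ := hs
    refine ⟨fun w hw => ?_, ?_⟩
    · obtain ⟨hne, hw⟩ := mem_erase.mp hw
      refine mem_fwd.mpr ⟨h3, h1.isClique h2 hw hne.symm, ?_⟩
      by_cases hl : Low G d w
      · exact Or.inr (lt_of_le_of_ne (h4 w ⟨hw, hl⟩) hne.symm)
      · exact Or.inl hl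
    · refine ⟨h1.isClique.subset (by simp), ?_⟩
      rw [card_erase_of_mem h2, h1.card_eq]
  · intro s hs
    simp only [coe_filter, mem_univ, true_and, Set.mem_ofPred_eq, mem_filter] at hs ⊢
    obtain ⟨h1, h2⟩ := hs
    have hlow : Low G d v := by
      obtain ⟨u, hu⟩ : s.Nonempty := card_pos.mp (by rw [h2.card_eq]; omega)
      exact (mem_fwd.mp (h1 hu)).1
    refine ⟨?_, ⟨mem_insert_self _ _, hlow⟩, ?_⟩
    · have := h2.insert (a := v) fun u hu => (mem_fwd.mp (h1 hu)).2.1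
      rwa [Nat.sub_add_cancel (by omega)] at this
    · rintro w ⟨hw, hwl⟩
      rcases mem_insert.mp hw with rfl | hw
      · exact le_rfl
      · rcases (mem_fwd.mp (h1 hw)).2.2 with h | h
        · exact absurd hwl h
        · exact h.le
  · intro s hs
    simp only [coe_filter, Set.mem_ofPred_eq, mem_filter] at hs
    exact insert_erase hs.2.2.1.1
  · intro s hs
    simp only [coe_filter, Set.mem_ofPred_eq] at hs
    exact erase_insert fun hv => G.loopless.irrefl v (mem_fwd.mp (hs.2.1 hv)).2.1

/-- A clique without vertices of low degree survives the peeling; any other one has exactly one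
first vertex of low degree and is counted there. -/
theorem numCliques_peel {k : ℕ} (hk : 2 ≤ k) :
    (peel G d).numCliques k + ∑ v, ∑ u ∈ fwd G d v, weight G d k v u = G.numCliques k := by
  classical
  simp only [sum_weight hk, ← card_cliques_through hk, numCliques_eq_card, card_filter]
  rw [sum_comm, ← sum_add_distrib]
  refine sum_congr rfl fun s _ => ?_
  by_cases hs : G.IsNClique k s
  · simp only [hs, if_true, true_and, peel_isNClique_iff hk]
    by_cases hl : (s.filter (Low G d)).Nonempty
    · have h1 := card_least hl
      rw [card_filter] at h1
      have h2 : ¬ ∀ v ∈ s, ¬ Low G d v := by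
        obtain ⟨v, hv⟩ := hl
        exact fun h => h v (mem_filter.mp hv).1 (mem_filter.mp hv).2
      rw [if_neg h2, zero_add]
      convert h1
    · have h2 : ∀ v ∈ s, ¬ Low G d v := fun v hv h => hl ⟨v, mem_filter.mpr ⟨hv, h⟩⟩
      rw [if_pos h2, Nat.add_eq_left]
      refine sum_eq_zero fun v _ => if_neg fun h => hl ⟨v, ?_⟩
      convert h.1
  · simp [hs, peel_isNClique_iff hk]

end Graph

/-! ### Adjacency queries answered by ranks -/

section Items

variable {n : ℕ} (G : SimpleGraph (Fin n)) (d : ℕ)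

open Classical in
/-- The pairs of adjacent vertices. -/
noncomputable def halfEdges : Finset (Fin n ×ₗ Fin n) :=
  univ.filter fun p => G.Adj (ofLex p).1 (ofLex p).2

open Classical in
/-- The pairs of adjacent vertices, with a flag that says whether the second is of low degree. -/
noncomputable def flagged : Finset (Fin n ×ₗ (Fin n ×ₗ Bool)) :=
  univ.filter fun p => G.Adj (ofLex p).1 (ofLex (ofLex p).2).1 ∧
    ((ofLex (ofLex p).2).2 = true ↔ Low G d (ofLex (ofLex p).2).1)

/-- The pairs of a vertex of low degree and one of its forward neighbours. -/
noncomputable def fwdEdges : Finset (Fin n ×ₗ Fin n) :=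
  univ.filter fun p => (ofLex p).2 ∈ fwd G d (ofLex p).1

/-- The item for the pair `u`, `w`, with class `c`, that belongs to `v`. -/
def quad (u w : Fin n) (c : Fin 4) (v : Fin n) : Fin n ×ₗ (Fin n ×ₗ (Fin 4 ×ₗ Fin n)) :=
  toLex (u, toLex (w, toLex (c, v)))

open Classical in
/-- The edges, as items of class one, and three further items for each pair of forward neighbours
of the same vertex. -/
noncomputable def queries : Finset (Fin n ×ₗ (Fin n ×ₗ (Fin 4 ×ₗ Fin n))) :=
  univ.filter fun p => ∃ u w c v, p = quad u w c v ∧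
    (c = 1 ∧ v = u ∧ G.Adj u w ∨ c ≠ 1 ∧ u ∈ fwd G d v ∧ w ∈ fwd G d v)

/-- The item that tells the vertex `v` the rank `r` of its item of class `c` for the pair
`u`, `w`. -/
def quint {N : ℕ} (v u w : Fin n) (c : Fin 4) (r : Fin N) :
    Fin n ×ₗ (Fin n ×ₗ (Fin n ×ₗ (Fin 4 ×ₗ Fin N))) :=
  toLex (v, toLex (u, toLex (w, toLex (c, r))))

open Classical in
/-- The ranks of the items for the pairs of forward neighbours. -/
noncomputable def answers (N : ℕ) [NeZero N] :
    Finset (Fin n ×ₗ (Fin n ×ₗ (Fin n ×ₗ (Fin 4 ×ₗ Fin N)))) :=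
  univ.filter fun p => ∃ v u w c, c ≠ 1 ∧ u ∈ fwd G d v ∧ w ∈ fwd G d v ∧
    p = quint v u w c (Fin.ofNat N (rank (queries G d) (quad u w c v)))

variable {G d}

theorem mem_halfEdges {u v : Fin n} : toLex (u, v) ∈ halfEdges G ↔ G.Adj u v := by
  simp [halfEdges]

theorem mem_flagged {v u : Fin n} {t : Bool} : toLex (v, toLex (u, t)) ∈ flagged G d ↔
    G.Adj v u ∧ (t = true ↔ Low G d u) := by
  simp [flagged]

theorem mem_fwdEdges {v u : Fin n} : toLex (v, u) ∈ fwdEdges G d ↔ u ∈ fwd G d v := by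
  simp [fwdEdges]

theorem quad_inj {u w v u' w' v' : Fin n} {c c' : Fin 4} :
    quad u w c v = quad u' w' c' v' ↔ u = u' ∧ w = w' ∧ c = c' ∧ v = v' := by
  simp [quad]

theorem quint_inj {N : ℕ} {u w v u' w' v' : Fin n} {c c' : Fin 4} {r r' : Fin N} :
    quint v u w c r = quint v' u' w' c' r' ↔ v = v' ∧ u = u' ∧ w = w' ∧ c = c' ∧ r = r' := by
  simp [quint]

theorem mem_queries {u w v : Fin n} {c : Fin 4} : quad u w c v ∈ queries G d ↔
    (c = 1 ∧ v = u ∧ G.Adj u w ∨ c ≠ 1 ∧ u ∈ fwd G d v ∧ w ∈ fwd G d v) := by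
  simp only [queries, mem_filter, mem_univ, true_and, quad_inj]
  constructor
  · rintro ⟨_, _, _, _, ⟨rfl, rfl, rfl, rfl⟩, h⟩
    exact h
  · exact fun h => ⟨u, w, c, v, ⟨rfl, rfl, rfl, rfl⟩, h⟩

theorem mem_answers {N : ℕ} [NeZero N] {v u w : Fin n} {c : Fin 4} {r : Fin N} :
    quint v u w c r ∈ answers G d N ↔ c ≠ 1 ∧ u ∈ fwd G d v ∧ w ∈ fwd G d v ∧
      r = Fin.ofNat N (rank (queries G d) (quad u w c v)) := by
  simp only [answers, mem_filter, mem_univ, true_and, quint_inj]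
  constructor
  · rintro ⟨_, _, _, _, h1, h2, h3, rfl, rfl, rfl, rfl, h⟩
    exact ⟨h1, h2, h3, h⟩
  · rintro ⟨h1, h2, h3, h⟩
    exact ⟨v, u, w, c, h1, h2, h3, rfl, rfl, rfl, rfl, h⟩

theorem quad_lt {u w v u' w' v' : Fin n} {c c' : Fin 4} : quad u w c v < quad u' w' c' v' ↔
    (u < u' ∨ u = u' ∧ (w < w' ∨ w = w' ∧ (c < c' ∨ c = c' ∧ v < v'))) := by
  simp [quad, Prod.Lex.toLex_lt_toLex]

theorem exists_eq_quad (y : Fin n ×ₗ (Fin n ×ₗ (Fin 4 ×ₗ Fin n))) :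
    ∃ u w c v, y = quad u w c v := ⟨_, _, _, _, rfl⟩

theorem exists_eq_quint {N : ℕ} (y : Fin n ×ₗ (Fin n ×ₗ (Fin n ×ₗ (Fin 4 ×ₗ Fin N)))) :
    ∃ v u w c r, y = quint v u w c r := ⟨_, _, _, _, _, rfl⟩

variable (G d) in
/-- The items of class `c` for the pair `u`, `w`. -/
noncomputable def pairItems (u w : Fin n) (c : Fin 4) :
    Finset (Fin n ×ₗ (Fin n ×ₗ (Fin 4 ×ₗ Fin n))) :=
  (queries G d).filter fun y => (ofLex y).1 = u ∧ (ofLex (ofLex y).2).1 = w ∧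
    (ofLex (ofLex (ofLex y).2).2).1 = c

theorem quad_mem_pairItems {u w v u' w' : Fin n} {c c' : Fin 4} :
    quad u w c v ∈ pairItems G d u' w' c' ↔
      quad u w c v ∈ queries G d ∧ u = u' ∧ w = w' ∧ c = c' := by
  simp [pairItems, quad]

open Classical in
theorem card_pairItems_one (u w : Fin n) :
    (pairItems G d u w 1).card = if G.Adj u w then 1 else 0 := by
  split_ifs with h
  · rw [card_eq_one]
    refine ⟨quad u w 1 u, ?_⟩
    ext y
    obtain ⟨u', w', c', v', rfl⟩ := exists_eq_quad y
    rw [mem_singleton, quad_inj, quad_mem_pairItems, mem_queries]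
    constructor
    · rintro ⟨h1, rfl, rfl, rfl⟩
      simp only [ne_eq, not_true_eq_false, false_and, or_false, true_and] at h1
      simp [h1.1]
    · rintro ⟨rfl, rfl, rfl, rfl⟩
      simpa using h
  · rw [card_eq_zero]
    refine eq_empty_of_forall_notMem fun y hy => ?_
    obtain ⟨u', w', c', v', rfl⟩ := exists_eq_quad y
    rw [quad_mem_pairItems, mem_queries] at hy
    obtain ⟨h1, rfl, rfl, rfl⟩ := hy
    simp [h] at h1

theorem card_pairItems {u w : Fin n} {c : Fin 4} (hc : c ≠ 1) :
    (pairItems G d u w c).card =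
      (univ.filter fun v => u ∈ fwd G d v ∧ w ∈ fwd G d v).card := by
  rw [← card_image_of_injective (f := quad u w c)]
  · congr 1
    ext y
    obtain ⟨u', w', c', v', rfl⟩ := exists_eq_quad y
    simp only [quad_mem_pairItems, mem_image, mem_filter, mem_univ, true_and, quad_inj, mem_queries]
    constructor
    · rintro ⟨h1, rfl, rfl, rfl⟩
      simp only [hc, false_and, false_or, ne_eq, not_false_eq_true, true_and] at h1
      exact ⟨v', h1, rfl, rfl, rfl, rfl⟩
    · rintro ⟨v, h1, rfl, rfl, rfl, rfl⟩
      exact ⟨Or.inr ⟨hc, h1⟩, rfl, rfl, rfl⟩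
  · intro v v' h
    exact (quad_inj.mp h).2.2.2

/-- The order is lexicographic: what precedes the item has a smaller pair, or the same pair and a
smaller class, or differs only in a smaller owner. The first and the last term do not depend on `c`,
so they cancel when ranks of different classes are compared. -/
theorem rank_queries (u w v : Fin n) {c : Fin 4} (hc : c ≠ 1) :
    rank (queries G d) (quad u w c v) =
      ((queries G d).filter fun y => (ofLex y).1 < u ∨ (ofLex y).1 = u ∧
        (ofLex (ofLex y).2).1 < w).card +
      (∑ c' with c' < c, (pairItems G d u w c').card) +
      (univ.filter fun v' => (u ∈ fwd G d v' ∧ w ∈ fwd G d v') ∧ v' < v).card := by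
  have h1 : ∑ c' with c' < c, (pairItems G d u w c').card =
      ((queries G d).filter fun y => (ofLex y).1 = u ∧ (ofLex (ofLex y).2).1 = w ∧
        (ofLex (ofLex (ofLex y).2).2).1 < c).card := by
    rw [card_eq_sum_card_fiberwise (f := fun y => (ofLex (ofLex (ofLex y).2).2).1)
      (t := univ.filter (· < c))]
    · refine sum_congr rfl fun c' hc' => ?_
      rw [filter_filter, pairItems]
      congr 1
      refine filter_congr fun y _ => ?_
      have := (mem_filter.mp hc').2
      constructor
      · rintro ⟨h1, h2, rfl⟩
        exact ⟨⟨h1, h2, this⟩, rfl⟩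
      · rintro ⟨⟨h1, h2, _⟩, h3⟩
        exact ⟨h1, h2, h3⟩
    · intro y hy
      simpa using (mem_filter.mp hy).2.2.2
  have h2 : (univ.filter fun v' => (u ∈ fwd G d v' ∧ w ∈ fwd G d v') ∧ v' < v).card =
      ((queries G d).filter fun y => (ofLex y).1 = u ∧ (ofLex (ofLex y).2).1 = w ∧
        (ofLex (ofLex (ofLex y).2).2).1 = c ∧ (ofLex (ofLex (ofLex y).2).2).2 < v).card := by
    rw [← card_image_of_injective (f := quad u w c)]
    · congr 1
      ext y
      obtain ⟨u', w', c', v', rfl⟩ := exists_eq_quad y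
      simp only [mem_image, mem_filter, mem_univ, true_and, quad_inj, mem_queries]
      simp only [quad, ofLex_toLex]
      constructor
      · rintro ⟨v, h1, rfl, rfl, rfl, rfl⟩
        exact ⟨Or.inr ⟨hc, h1.1⟩, rfl, rfl, rfl, h1.2⟩
      · rintro ⟨hq, rfl, rfl, rfl, hv⟩
        simp only [hc, false_and, false_or, ne_eq, not_false_eq_true, true_and] at hq
        exact ⟨v', ⟨hq, hv⟩, rfl, rfl, rfl, rfl⟩
    · intro v v' h
      exact (quad_inj.mp h).2.2.2
  rw [h1, h2, ← card_union_of_disjoint, ← card_union_of_disjoint, ← filter_or, ← filter_or]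
  · change (filter _ _).card = _
    congr 1
    refine filter_congr fun y _ => ?_
    obtain ⟨u', w', c', v', rfl⟩ := exists_eq_quad y
    rw [id, id, quad_lt]
    simp only [quad, ofLex_toLex]
    tauto
  · rw [← filter_or, disjoint_filter]
    rintro y _ (h | h) h'
    · rcases h with h | h
      · exact h.ne h'.1
      · exact h.2.ne h'.2.1
    · exact h.2.2.ne h'.2.2.1
  · rw [disjoint_filter]
    rintro y _ (h | h) h'
    · exact h.ne h'.1
    · exact h.2.ne h'.2.1

/-- The ranks of the three items for a pair tell whether it is an edge. -/
theorem adj_iff_rank {u w v : Fin n} : G.Adj u w ↔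
    2 * rank (queries G d) (quad u w 2 v) =
      rank (queries G d) (quad u w 0 v) + rank (queries G d) (quad u w 3 v) + 1 := by
  classical
  rw [rank_queries u w v (c := 0) (by decide), rank_queries u w v (c := 2) (by decide),
    rank_queries u w v (c := 3) (by decide)]
  have e0 : (univ.filter fun c' : Fin 4 => c' < 0) = ∅ := by decide
  have e2 : (univ.filter fun c' : Fin 4 => c' < 2) = {0, 1} := by decide
  have e3 : (univ.filter fun c' : Fin 4 => c' < 3) = {0, 1, 2} := by decide
  rw [e0, e2, e3, sum_empty, sum_insert (by decide), sum_insert (by decide),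
    sum_insert (by decide), sum_singleton, sum_singleton, card_pairItems_one,
    card_pairItems (c := 0) (by decide), card_pairItems (c := 2) (by decide)]
  -- Let m be the number of items in each of the classes 0 and 2. The rank grows by m plus one for
  -- an edge from class 0 to class 2, but by m from class 2 to class 3.
  split_ifs with h
  · simp only [h, true_iff]
    omega
  · simp only [h, false_iff]
    omega

end Items

/-! ### Items derived from other items -/

section Pull

variable {M : ℕ} {α α' : Type*} [DecidableEq α]

/-- A derived item `y` is created by the machine that holds its source `src y`. So a partition of
the sources induces one of the derived items. -/
theorem disjoint_pull {B : Fin M → Finset α} (hB : Pairwise fun i j => Disjoint (B i) (B j))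
    (A : Finset α') (src : α' → α) :
    Pairwise fun i j => Disjoint (A.filter fun y => src y ∈ B i) (A.filter fun y => src y ∈ B j) := by
  intro i j hij
  rw [disjoint_filter]
  exact fun y _ h h' => disjoint_left.mp (hB hij) h h'

theorem biUnion_pull [DecidableEq α'] {B : Fin M → Finset α} {A : Finset α'} {src : α' → α}
    (h : ∀ y ∈ A, src y ∈ univ.biUnion B) :
    (univ.biUnion fun j => A.filter fun y => src y ∈ B j) = A := by
  ext y
  simp only [mem_biUnion, mem_univ, true_and, mem_filter]
  constructor
  · rintro ⟨_, hy, _⟩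
    exact hy
  · intro hy
    obtain ⟨j, -, hj⟩ := mem_biUnion.mp (h y hy)
    exact ⟨j, hy, hj⟩

theorem card_pull_le {B : Finset α} {A : Finset α'} {src : α' → α} (h : Set.InjOn src A) :
    (A.filter fun y => src y ∈ B).card ≤ B.card :=
  card_le_card_of_injOn src (fun _ hy => (mem_filter.mp hy).2)
    (h.mono (coe_subset.mpr (filter_subset _ _)))

end Pull

/-! ### Cardinalities of the item sets -/

section Cards

variable {n d : ℕ} {G : SimpleGraph (Fin n)}

theorem exists_eq_pair (y : Fin n ×ₗ Fin n) : ∃ v u, y = toLex (v, u) := ⟨_, _, rfl⟩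

theorem exists_eq_flag (y : Fin n ×ₗ (Fin n ×ₗ Bool)) : ∃ v u t, y = toLex (v, toLex (u, t)) :=
  ⟨_, _, _, rfl⟩

theorem flagged_inj {v u : Fin n} {t t' : Bool} (h : toLex (v, toLex (u, t)) ∈ flagged G d)
    (h' : toLex (v, toLex (u, t')) ∈ flagged G d) : t = t' := by
  rw [Bool.eq_iff_iff, (mem_flagged.mp h).2, (mem_flagged.mp h').2]

/-- The pair of vertices of a flagged item. -/
def dropFlag (y : Fin n ×ₗ (Fin n ×ₗ Bool)) : Fin n ×ₗ Fin n :=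
  toLex ((ofLex y).1, (ofLex (ofLex y).2).1)

/-- The pair of vertices of a flagged item, in the opposite order. -/
def swapFlag (y : Fin n ×ₗ (Fin n ×ₗ Bool)) : Fin n ×ₗ Fin n :=
  toLex ((ofLex (ofLex y).2).1, (ofLex y).1)

/-- The flag is determined by the graph and the pair, so flagged items are no more numerous than
ordered adjacent pairs. -/
theorem dropFlag_injOn : Set.InjOn (dropFlag (n := n)) (flagged G d) := by
  intro y h y' h' e
  obtain ⟨v, u, t, rfl⟩ := exists_eq_flag y
  obtain ⟨v', u', t', rfl⟩ := exists_eq_flag y'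
  have e' : v = v' ∧ u = u' := by
    have := congrArg ofLex e
    simpa [dropFlag] using this
  obtain ⟨rfl, rfl⟩ := e'
  have := flagged_inj h h'
  subst this
  rfl

theorem swapFlag_injOn : Set.InjOn (swapFlag (n := n)) (flagged G d) := by
  intro y h y' h' e
  refine dropFlag_injOn h h' ?_
  have e' := congrArg ofLex e
  simp only [swapFlag, ofLex_toLex, Prod.mk.injEq] at e'
  simp only [dropFlag, e'.1, e'.2]

theorem dropFlag_mem {y : Fin n ×ₗ (Fin n ×ₗ Bool)} (h : y ∈ flagged G d) :
    dropFlag y ∈ halfEdges G := by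
  obtain ⟨v, u, t, rfl⟩ := exists_eq_flag y
  exact mem_halfEdges.mpr (mem_flagged.mp h).1

theorem swapFlag_mem {y : Fin n ×ₗ (Fin n ×ₗ Bool)} (h : y ∈ flagged G d) :
    swapFlag y ∈ halfEdges G := by
  obtain ⟨v, u, t, rfl⟩ := exists_eq_flag y
  exact mem_halfEdges.mpr (mem_flagged.mp h).1.symm

theorem image_dropFlag : (flagged G d).image dropFlag = halfEdges G := by
  classical
  ext y
  obtain ⟨v, u, rfl⟩ := exists_eq_pair y
  rw [mem_image]
  constructor
  · rintro ⟨y, hy, h⟩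
    rw [← h]
    exact dropFlag_mem hy
  · intro h
    exact ⟨toLex (v, toLex (u, decide (Low G d u))),
      mem_flagged.mpr ⟨mem_halfEdges.mp h, by simp⟩, rfl⟩

theorem card_flagged : (flagged G d).card = (halfEdges G).card := by
  rw [← image_dropFlag (d := d), card_image_of_injOn dropFlag_injOn]

theorem card_halfEdges_at (v : Fin n) :
    ((halfEdges G).filter fun y => (ofLex y).1 = v).card = (nbrs G v).card := by
  rw [← card_image_of_injective (f := fun u => (toLex (v, u) : Fin n ×ₗ Fin n)) (nbrs G v)]
  · congr 1
    ext y
    obtain ⟨v', u, rfl⟩ := exists_eq_pair y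
    rw [mem_filter, mem_image]
    constructor
    · rintro ⟨h1, h2⟩
      obtain rfl : v' = v := h2
      exact ⟨u, mem_nbrs.mpr (mem_halfEdges.mp h1), rfl⟩
    · rintro ⟨u', h1, h2⟩
      rw [← h2]
      exact ⟨mem_halfEdges.mpr (mem_nbrs.mp h1), rfl⟩
  · intro u u' h
    simpa using congrArg ofLex h

theorem card_flagged_at (v : Fin n) :
    ((flagged G d).filter fun y => (ofLex y).1 = v).card = (nbrs G v).card := by
  rw [← card_halfEdges_at, ← image_dropFlag (d := d), filter_image, card_image_of_injOn]
  · rfl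
  · exact dropFlag_injOn.mono (coe_subset.mpr (filter_subset _ _))

theorem card_fwdEdges_at (v : Fin n) :
    ((fwdEdges G d).filter fun y => (ofLex y).1 = v).card ≤ d := by
  refine le_trans ?_ (card_fwd_le (G := G) v)
  refine card_le_card_of_injOn (fun y => (ofLex y).2) ?_ ?_
  · intro y h
    obtain ⟨v', u, rfl⟩ := exists_eq_pair y
    obtain ⟨h1, h2⟩ := mem_filter.mp h
    obtain rfl : v' = v := h2
    exact mem_fwdEdges.mp h1
  · intro y h y' h' e
    obtain ⟨v', u, rfl⟩ := exists_eq_pair y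
    obtain ⟨v'', u', rfl⟩ := exists_eq_pair y'
    obtain rfl : v' = v := (mem_filter.mp h).2
    obtain rfl : v'' = v' := (mem_filter.mp h').2
    obtain rfl : u = u' := e
    rfl

theorem quint_injOn {N : ℕ} [NeZero N] {v u w v' u' w' : Fin n} {c c' : Fin 4} {r r' : Fin N}
    (h : quint v u w c r ∈ answers G d N) (h' : quint v' u' w' c' r' ∈ answers G d N)
    (e : quad u w c v = quad u' w' c' v') : quint v u w c r = quint v' u' w' c' r' := by
  obtain ⟨rfl, rfl, rfl, rfl⟩ := quad_inj.mp e
  rw [(mem_answers.mp h).2.2.2, (mem_answers.mp h').2.2.2]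

/-- The item of which an item of `answers` contains the rank. -/
def toQuad {N : ℕ} (y : Fin n ×ₗ (Fin n ×ₗ (Fin n ×ₗ (Fin 4 ×ₗ Fin N)))) :
    Fin n ×ₗ (Fin n ×ₗ (Fin 4 ×ₗ Fin n)) :=
  quad (ofLex (ofLex y).2).1 (ofLex (ofLex (ofLex y).2).2).1
    (ofLex (ofLex (ofLex (ofLex y).2).2).2).1 (ofLex y).1

theorem toQuad_quint {N : ℕ} (v u w : Fin n) (c : Fin 4) (r : Fin N) :
    toQuad (quint v u w c r) = quad u w c v := rfl

theorem toQuad_injOn {N : ℕ} [NeZero N] : Set.InjOn (toQuad (n := n) (N := N)) (answers G d N) := by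
  intro y h y' h' e
  obtain ⟨v, u, w, c, r, rfl⟩ := exists_eq_quint y
  obtain ⟨v', u', w', c', r', rfl⟩ := exists_eq_quint y'
  exact quint_injOn h h' e

theorem toQuad_mem {N : ℕ} [NeZero N] {y : Fin n ×ₗ (Fin n ×ₗ (Fin n ×ₗ (Fin 4 ×ₗ Fin N)))}
    (h : y ∈ answers G d N) : toQuad y ∈ queries G d := by
  obtain ⟨v, u, w, c, r, rfl⟩ := exists_eq_quint y
  obtain ⟨h1, h2, h3, _⟩ := mem_answers.mp h
  rw [toQuad_quint, mem_queries]
  exact Or.inr ⟨h1, h2, h3⟩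

theorem card_answers_le {N : ℕ} [NeZero N] : (answers G d N).card ≤ (queries G d).card :=
  card_le_card_of_injOn toQuad (fun _ h => toQuad_mem h) toQuad_injOn

theorem card_ne_one : (univ.filter fun c : Fin 4 => c ≠ 1).card = 3 := by decide

theorem card_answers_at {N : ℕ} [NeZero N] (v : Fin n) :
    ((answers G d N).filter fun y => (ofLex y).1 = v).card ≤ 3 * d ^ 2 := by
  have h : ((fwd G d v) ×ˢ (fwd G d v) ×ˢ (univ.filter fun c : Fin 4 => c ≠ 1)).card ≤
      3 * d ^ 2 := by
    rw [card_product, card_product, card_ne_one]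
    have := card_fwd_le (G := G) (d := d) v
    nlinarith
  refine le_trans ?_ h
  refine card_le_card_of_injOn (fun y => ((ofLex (ofLex y).2).1, (ofLex (ofLex (ofLex y).2).2).1,
    (ofLex (ofLex (ofLex (ofLex y).2).2).2).1)) ?_ ?_
  · intro y hy
    obtain ⟨v', u, w, c, r, rfl⟩ := exists_eq_quint y
    obtain ⟨h1, h2⟩ := mem_filter.mp hy
    obtain rfl : v' = v := h2
    obtain ⟨h3, h4, h5, _⟩ := mem_answers.mp h1
    rw [mem_coe, mem_product, mem_product, mem_filter]
    exact ⟨h4, h5, mem_univ _, h3⟩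
  · intro y hy y' hy' e
    obtain ⟨v', u, w, c, r, rfl⟩ := exists_eq_quint y
    obtain ⟨v'', u', w', c', r', rfl⟩ := exists_eq_quint y'
    obtain ⟨h1, h2⟩ := mem_filter.mp hy
    obtain ⟨h1', h2'⟩ := mem_filter.mp hy'
    obtain rfl : v' = v := h2
    obtain rfl : v'' = v' := h2'
    simp only [quint, ofLex_toLex, Prod.mk.injEq] at e
    obtain ⟨rfl, rfl, rfl⟩ := e
    exact quint_injOn h1 h1' rfl

/-- A forward edge from `v` to `u` can be completed by at most `d` further neighbours `w` and by
three classes. -/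
theorem card_queries_part_le (B : Finset (Fin n ×ₗ Fin n)) :
    ((queries G d).filter fun y => (ofLex (ofLex (ofLex y).2).2).1 ≠ 1 ∧
      toLex ((ofLex (ofLex (ofLex y).2).2).2, (ofLex y).1) ∈ B).card ≤ B.card * (3 * d) := by
  have h : (B.sigma fun p => (fwd G d (ofLex p).1) ×ˢ (univ.filter fun c : Fin 4 => c ≠ 1)).card ≤
      B.card * (3 * d) := by
    rw [card_sigma, ← smul_eq_mul]
    refine sum_le_card_nsmul _ _ _ fun p _ => ?_
    rw [card_product, card_ne_one]
    have := card_fwd_le (G := G) (d := d) (ofLex p).1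
    omega
  refine le_trans ?_ h
  refine card_le_card_of_injOn (fun y => ⟨toLex ((ofLex (ofLex (ofLex y).2).2).2, (ofLex y).1),
    ((ofLex (ofLex y).2).1, (ofLex (ofLex (ofLex y).2).2).1)⟩) ?_ ?_
  · intro y hy
    obtain ⟨u, w, c, v, rfl⟩ := exists_eq_quad y
    obtain ⟨h1, h2⟩ := mem_filter.mp hy
    simp only [quad, ofLex_toLex] at h2
    rw [mem_queries] at h1
    simp only [h2.1, false_and, false_or, ne_eq, not_false_eq_true, true_and] at h1
    rw [mem_coe, mem_sigma, mem_product, mem_filter]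
    exact ⟨h2.2, h1.2, mem_univ _, h2.1⟩
  · intro y _ y' _ e
    obtain ⟨u, w, c, v, rfl⟩ := exists_eq_quad y
    obtain ⟨u', w', c', v', rfl⟩ := exists_eq_quad y'
    simp only [quad, ofLex_toLex, Sigma.mk.injEq, EmbeddingLike.apply_eq_iff_eq,
      Prod.mk.injEq, heq_eq_eq] at e
    obtain ⟨⟨rfl, rfl⟩, rfl, rfl⟩ := e
    rfl

theorem card_queries_one_le (B : Finset (Fin n ×ₗ Fin n)) :
    ((queries G d).filter fun y => (ofLex (ofLex (ofLex y).2).2).1 = 1 ∧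
      toLex ((ofLex y).1, (ofLex (ofLex y).2).1) ∈ B).card ≤ B.card := by
  refine card_le_card_of_injOn (fun y => toLex ((ofLex y).1, (ofLex (ofLex y).2).1)) ?_ ?_
  · intro y hy
    exact (mem_filter.mp hy).2.2
  · intro y hy y' hy' e
    obtain ⟨u, w, c, v, rfl⟩ := exists_eq_quad y
    obtain ⟨u', w', c', v', rfl⟩ := exists_eq_quad y'
    obtain ⟨h1, h2, _⟩ := mem_filter.mp hy
    obtain ⟨h1', h2', _⟩ := mem_filter.mp hy'
    simp only [quad, ofLex_toLex, EmbeddingLike.apply_eq_iff_eq, Prod.mk.injEq] at e h2 h2'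
    obtain ⟨rfl, rfl⟩ := e
    subst h2 h2'
    rw [mem_queries] at h1 h1'
    simp only [ne_eq, not_true_eq_false, false_and, or_false, true_and] at h1 h1'
    rw [h1.1, h1'.1]

end Cards

end MPC

/-! ### A phase: finding low degrees and splitting off the remaining edges -/

namespace MPC

open Finset

variable {M : ℕ} {Γ : Type*}

section Phase

variable {n S W b K d : ℕ}

theorem fst_convex {α β : Type*} [LinearOrder α] [LinearOrder β] (v : α) (y z w : α ×ₗ β)
    (hy : (ofLex y).1 = v) (hw : (ofLex w).1 = v) (hyz : y ≤ z) (hzw : z ≤ w) :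
    (ofLex z).1 = v := by
  have h1 := (Prod.Lex.monotone_fst y z hyz)
  have h2 := (Prod.Lex.monotone_fst z w hzw)
  exact le_antisymm (h2.trans hw.le) (hy.ge.trans h1)

/-- The pairs that start with `u` are consecutive in the sorted order. A machine holding one of them
can thus compare the degree with `d`, even if it does not see all of them. -/
theorem low_iff_halfEdges {G : SimpleGraph (Fin n)} {β j : ℕ} {u v : Fin n}
    (h : toLex (u, v) ∈ block (halfEdges G) β j) (hd : d ≤ β) : Low G d u ↔
      ((nearBlocks (halfEdges G) β j).filter fun y => (ofLex y).1 = u).card ≤ d := by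
  rw [card_filter_nearBlocks_le_iff h (fst_convex u) rfl hd, card_halfEdges_at, Low]

theorem low_iff_flagged {G : SimpleGraph (Fin n)} {β j : ℕ} {u v : Fin n} {t : Bool}
    (h : toLex (u, toLex (v, t)) ∈ block (flagged G d) β j) (hd : d ≤ β) : Low G d u ↔
      ((nearBlocks (flagged G d) β j).filter fun y => (ofLex y).1 = u).card ≤ d := by
  rw [card_filter_nearBlocks_le_iff h (fst_convex u) rfl hd, card_flagged_at, Low]

namespace Setup

/-- The edges whose flagged items lie in the `j`-th block. -/
noncomputable def edgesAt (G : SimpleGraph (Fin n)) (d b j : ℕ) : Finset (Fin n ×ₗ Fin n) :=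
  (block (flagged G d) b j).image dropFlag

theorem card_edgesAt_le {G : SimpleGraph (Fin n)} (hb : 0 < b) (j : ℕ) :
    (edgesAt G d b j).card ≤ b := card_image_le.trans (card_block _ hb j)

theorem edgesAt_subset {G : SimpleGraph (Fin n)} (j : ℕ) : edgesAt G d b j ⊆ halfEdges G := by
  intro y hy
  obtain ⟨y', h, rfl⟩ := mem_image.mp hy
  exact dropFlag_mem (mem_block.mp h).1

theorem disjoint_edgesAt {G : SimpleGraph (Fin n)} :
    Pairwise fun i j : Fin M => Disjoint (edgesAt G d b i) (edgesAt G d b j) := by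
  intro i j hij
  rw [disjoint_left]
  intro y hy hy'
  obtain ⟨y1, h1, rfl⟩ := mem_image.mp hy
  obtain ⟨y2, h2, e⟩ := mem_image.mp hy'
  have := dropFlag_injOn (block_subset _ _ _ h2) (block_subset _ _ _ h1) e
  subst this
  exact disjoint_left.mp (disjoint_block _ _ (Fin.val_injective.ne hij)) h1 h2

theorem biUnion_edgesAt {G : SimpleGraph (Fin n)} (hH : (halfEdges G).card ≤ M * b) :
    univ.biUnion (fun j : Fin M => edgesAt G d b j) = halfEdges G := by
  rw [← card_flagged (d := d)] at hH
  simp only [edgesAt]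
  rw [← biUnion_image, biUnion_block hH, image_dropFlag]

variable [NeZero M] (Q : Setup M S W b)

/-- The vertices of low degree are found, and their neighbours are told. -/
theorem leads_flag {G : Γ → SimpleGraph (Fin n)} (hd : d ≤ b)
    (a : Γ → Fin M → Finset (Fin n ×ₗ Fin n))
    (hdisj : ∀ γ, Pairwise fun i j => Disjoint (a γ i) (a γ j))
    (hA : ∀ γ, univ.biUnion (a γ) = halfEdges (G γ)) (ha : ∀ γ j, (a γ j).card ≤ 2 * b)
    (hH : ∀ γ, (halfEdges (G γ)).card ≤ M * b) (acc : Γ → Fin M → Fin K)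
    (hn : 2 * n ^ 2 + K ≤ Q.D ^ Q.p) :
    Leads S W (fun γ j => (a γ j).val.disjSum {acc γ j})
      (fun γ j => ((flagged (G γ) d).filter fun y =>
        swapFlag y ∈ block (halfEdges (G γ)) b j).val.disjSum {acc γ j}) (Q.sortRounds + 2) := by
  have hb := Q.b_pos
  have hn2 : n ^ 2 = n * n := sq n
  refine Q.leads_sort_map hb le_rfl a (fun γ j => {acc γ j}) (fun γ => halfEdges (G γ)) _
    hdisj hA hH ?_ ?_ ?_ ?_ ?_ ?_ ?_
  · intro γ γ' j hw hz
    rw [hz]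
    congr 2
    have hB := block_eq_of_window hw
    ext y
    -- The item for the pair (v, u) is created where (u, v) lies: there the degree of `u` can be
    -- tested, and the next sort brings the result to `v`.
    obtain ⟨v, u, t, rfl⟩ := exists_eq_flag y
    simp only [mem_filter, ← hB]
    refine and_congr_left fun hy => ?_
    have hy1 : toLex (u, v) ∈ block (halfEdges (G γ)) b j := hy
    have hy2 : toLex (u, v) ∈ block (halfEdges (G γ')) b j := hB ▸ hy
    rw [mem_flagged, mem_flagged, low_iff_halfEdges hy1 hd, low_iff_halfEdges hy2 hd,
      nearBlocks_eq_of_window hw]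
    have h1 := (mem_halfEdges.mp (mem_block.mp hy1).1).symm
    have h2 := (mem_halfEdges.mp (mem_block.mp hy2).1).symm
    simp only [h1, h2]
  · intro γ j
    have := ha γ j
    simp only [Multiset.card_singleton]
    omega
  · intro γ j
    simp only [Multiset.card_singleton]
    omega
  · intro γ j
    have h1 := card_pull_le (B := block (halfEdges (G γ)) b j)
      (swapFlag_injOn (G := G γ) (d := d))
    have h2 := card_block (halfEdges (G γ)) hb j
    rw [Multiset.card_disjSum, card_val, Multiset.card_singleton]
    omega
  · simp only [Fintype.card_lex, Fintype.card_prod, Fintype.card_fin]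
    omega
  · rw [Fintype.card_fin]; omega
  · simp only [Fintype.card_sum, Fintype.card_lex, Fintype.card_prod, Fintype.card_fin,
      Fintype.card_bool]
    nlinarith

/-- The forward edges are selected, and so are the edges of the next graph. -/
theorem leads_select {G : Γ → SimpleGraph (Fin n)} (hd : d ≤ b)
    (hH : ∀ γ, (halfEdges (G γ)).card ≤ M * b) (acc : Γ → Fin M → Fin K)
    (hn : 2 * n ^ 2 + K ≤ Q.D ^ Q.p) :
    Leads S W (fun γ j => ((flagged (G γ) d).filter fun y =>
        swapFlag y ∈ block (halfEdges (G γ)) b j).val.disjSum {acc γ j})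
      (fun γ j => ((fwdEdges (G γ) d).filter fun y => y ∈ edgesAt (G γ) d b j).val.disjSum
        ((edgesAt (G γ) d b j).val.disjSum
          (((halfEdges (peel (G γ) d)).filter fun y => y ∈ edgesAt (G γ) d b j).val.disjSum
            {acc γ j}))) (Q.sortRounds + 2) := by
  have hb := Q.b_pos
  have hn2 : n ^ 2 = n * n := sq n
  refine Q.leads_sort_map hb le_rfl (fun γ (j : Fin M) => (flagged (G γ) d).filter fun y =>
        swapFlag y ∈ block (halfEdges (G γ)) b j) (fun γ j => {acc γ j})
    (fun γ => flagged (G γ) d) _ ?_ ?_ ?_ ?_ ?_ ?_ ?_ ?_ ?_ ?_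
  · intro γ
    exact disjoint_pull (B := fun j : Fin M => block (halfEdges (G γ)) b j)
      (fun i j hij => disjoint_block _ _ (Fin.val_injective.ne hij)) _ _
  · intro γ
    refine biUnion_pull (B := fun j : Fin M => block (halfEdges (G γ)) b j) fun y hy => ?_
    rw [biUnion_block (hH γ)]
    exact swapFlag_mem hy
  · intro γ
    rw [card_flagged]
    exact hH γ
  · intro γ γ' j hw hz
    have hB := block_eq_of_window hw
    have hE : edgesAt (G γ) d b j = edgesAt (G γ') d b j := by rw [edgesAt, edgesAt, hB]
    -- For an edge in its block a machine knows both ends: the class of `u` from the flag, that of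
    -- `v` from the window.
    have key : ∀ v u, toLex (v, u) ∈ edgesAt (G γ') d b j →
        ((G γ).Adj v u ∧ (G γ').Adj v u) ∧ (Low (G γ) d v ↔ Low (G γ') d v) ∧
          (Low (G γ) d u ↔ Low (G γ') d u) := by
      intro v u h
      obtain ⟨y, hy, e⟩ := mem_image.mp h
      obtain ⟨v', u', t, rfl⟩ := exists_eq_flag y
      have e' := congrArg ofLex e
      simp only [dropFlag, ofLex_toLex, Prod.mk.injEq] at e'
      obtain ⟨rfl, rfl⟩ := e'
      have hy1 : toLex (v', toLex (u', t)) ∈ block (flagged (G γ) d) b j := hB ▸ hy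
      have h1 := mem_flagged.mp (mem_block.mp hy1).1
      have h2 := mem_flagged.mp (mem_block.mp hy).1
      refine ⟨⟨h1.1, h2.1⟩, ?_, h1.2.symm.trans h2.2⟩
      rw [low_iff_flagged hy1 hd, low_iff_flagged hy hd, nearBlocks_eq_of_window hw]
    have hF : (fwdEdges (G γ) d).filter (fun y => y ∈ edgesAt (G γ') d b j) =
        (fwdEdges (G γ') d).filter (fun y => y ∈ edgesAt (G γ') d b j) := by
      ext y
      obtain ⟨v, u, rfl⟩ := exists_eq_pair y
      simp only [mem_filter]
      refine and_congr_left fun hy => ?_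
      obtain ⟨⟨h1, h2⟩, h3, h4⟩ := key v u hy
      rw [mem_fwdEdges, mem_fwdEdges, mem_fwd, mem_fwd, h3, h4]
      simp only [h1, h2]
    have hR : (halfEdges (peel (G γ) d)).filter (fun y => y ∈ edgesAt (G γ') d b j) =
        (halfEdges (peel (G γ') d)).filter (fun y => y ∈ edgesAt (G γ') d b j) := by
      ext y
      obtain ⟨v, u, rfl⟩ := exists_eq_pair y
      simp only [mem_filter]
      refine and_congr_left fun hy => ?_
      obtain ⟨⟨h1, h2⟩, h3, h4⟩ := key v u hy
      rw [mem_halfEdges, mem_halfEdges]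
      simp only [peel, h1, h2, h3, h4]
    rw [hz, hE, hF, hR]
  · intro γ j
    have h1 := card_pull_le (B := block (halfEdges (G γ)) b j)
      (swapFlag_injOn (G := G γ) (d := d))
    have h2 := card_block (halfEdges (G γ)) hb j
    simp only [Multiset.card_singleton]
    omega
  · intro γ j
    simp only [Multiset.card_singleton]
    omega
  · intro γ j
    have h0 : ∀ A : Finset (Fin n ×ₗ Fin n),
        (A.filter fun y => y ∈ edgesAt (G γ) d b j).card ≤ b := fun A =>
      (card_le_card fun y hy => (mem_filter.mp hy).2).trans (card_edgesAt_le hb j)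
    have h1 := h0 (fwdEdges (G γ) d)
    have h2 := h0 (halfEdges (peel (G γ) d))
    have h3 := card_edgesAt_le (G := G γ) (d := d) hb j
    simp only [Multiset.card_disjSum, card_val, Multiset.card_singleton]
    omega
  · simp only [Fintype.card_lex, Fintype.card_prod, Fintype.card_fin, Fintype.card_bool]
    nlinarith
  · rw [Fintype.card_fin]; omega
  · simp only [Fintype.card_sum, Fintype.card_lex, Fintype.card_prod, Fintype.card_fin]
    omega

end Setup

end Phase

end MPC

/-! ### A phase: listing pairs, ranking them and counting -/

namespace MPC

open Finset

variable {M : ℕ} {Γ : Type*}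

section Phase

variable {n S W b K d : ℕ}

namespace Setup

/-- The items that a machine produces from the edges in its frame and the forward edges in its
block. -/
noncomputable def queriesAt (G : SimpleGraph (Fin n)) (d b β j : ℕ) :
    Finset (Fin n ×ₗ (Fin n ×ₗ (Fin 4 ×ₗ Fin n))) :=
  (queries G d).filter fun y =>
    ((ofLex (ofLex (ofLex y).2).2).1 = 1 ∧
      toLex ((ofLex y).1, (ofLex (ofLex y).2).1) ∈ edgesAt G d b j) ∨
    ((ofLex (ofLex (ofLex y).2).2).1 ≠ 1 ∧
      toLex ((ofLex (ofLex (ofLex y).2).2).2, (ofLex y).1) ∈ block (fwdEdges G d) β j)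

theorem mem_queriesAt {G : SimpleGraph (Fin n)} {β j : ℕ} {u w v : Fin n} {c : Fin 4} :
    quad u w c v ∈ queriesAt G d b β j ↔
      (c = 1 ∧ (v = u ∧ G.Adj u w) ∧ toLex (u, w) ∈ edgesAt G d b j) ∨
      (c ≠ 1 ∧ (u ∈ fwd G d v ∧ w ∈ fwd G d v) ∧ toLex (v, u) ∈ block (fwdEdges G d) β j) := by
  rw [queriesAt, mem_filter, mem_queries]
  simp only [quad, ofLex_toLex]
  tauto

theorem card_queriesAt_le {G : SimpleGraph (Fin n)} {β : ℕ} (hb : 0 < b) (hβ : 0 < β) (j : ℕ)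
    (h : β * d ≤ b) : (queriesAt G d b β j).card ≤ 4 * b := by
  rw [queriesAt, filter_or]
  refine (card_union_le _ _).trans ?_
  have h1 := card_queries_one_le (G := G) (d := d) (edgesAt G d b j)
  have h2 := card_queries_part_le (G := G) (d := d) (block (fwdEdges G d) β j)
  have h3 := card_edgesAt_le (G := G) (d := d) hb j
  have h4 : (block (fwdEdges G d) β j).card * (3 * d) ≤ 3 * b := by
    have := card_block (fwdEdges G d) hβ j
    calc (block (fwdEdges G d) β j).card * (3 * d) ≤ β * (3 * d) := Nat.mul_le_mul_right _ this
      _ = 3 * (β * d) := by ring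
      _ ≤ 3 * b := by omega
  omega

theorem disjoint_queriesAt {G : SimpleGraph (Fin n)} {β : ℕ} : Pairwise fun i j : Fin M =>
    Disjoint (queriesAt G d b β i) (queriesAt G d b β j) := by
  intro i j hij
  rw [disjoint_left]
  intro y hy hy'
  obtain ⟨u, w, c, v, rfl⟩ := exists_eq_quad y
  rw [mem_queriesAt] at hy hy'
  rcases hy with ⟨h1, -, h2⟩ | ⟨h1, -, h2⟩ <;> rcases hy' with ⟨h3, -, h4⟩ | ⟨h3, -, h4⟩
  · exact disjoint_left.mp (disjoint_edgesAt hij) h2 h4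
  · exact h3 h1
  · exact h1 h3
  · exact disjoint_left.mp (disjoint_block _ _ (Fin.val_injective.ne hij)) h2 h4

theorem biUnion_queriesAt {G : SimpleGraph (Fin n)} {β : ℕ} (hH : (halfEdges G).card ≤ M * b)
    (hF : (fwdEdges G d).card ≤ M * β) :
    univ.biUnion (fun j : Fin M => queriesAt G d b β j) = queries G d := by
  ext y
  obtain ⟨u, w, c, v, rfl⟩ := exists_eq_quad y
  simp only [mem_biUnion, mem_univ, true_and]
  constructor
  · rintro ⟨j, hj⟩
    exact (mem_filter.mp hj).1
  · intro hy
    simp only [mem_queriesAt]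
    rcases mem_queries.mp hy with ⟨h1, h2, h3⟩ | ⟨h1, h2, h3⟩
    · have : toLex (u, w) ∈ univ.biUnion fun j : Fin M => edgesAt G d b j := by
        rw [biUnion_edgesAt hH]
        exact mem_halfEdges.mpr h3
      obtain ⟨j, -, hj⟩ := mem_biUnion.mp this
      exact ⟨j, Or.inl ⟨h1, ⟨h2, h3⟩, hj⟩⟩
    · have : toLex (v, u) ∈ univ.biUnion fun j : Fin M => block (fwdEdges G d) β j := by
        rw [biUnion_block hF]
        exact mem_fwdEdges.mpr h2
      obtain ⟨j, -, hj⟩ := mem_biUnion.mp this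
      exact ⟨j, Or.inr ⟨h1, ⟨h2, h3⟩, hj⟩⟩

/-- The edges of the next graph that a machine holds. -/
noncomputable def restAt (G : SimpleGraph (Fin n)) (d b j : ℕ) : Finset (Fin n ×ₗ Fin n) :=
  (halfEdges (peel G d)).filter fun y => y ∈ edgesAt G d b j

theorem card_restAt_le {G : SimpleGraph (Fin n)} (hb : 0 < b) (j : ℕ) :
    (restAt G d b j).card ≤ b :=
  (card_le_card fun _ hy => (mem_filter.mp hy).2).trans (card_edgesAt_le hb j)

theorem biUnion_restAt {G : SimpleGraph (Fin n)} (hH : (halfEdges G).card ≤ M * b) :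
    univ.biUnion (fun j : Fin M => restAt G d b j) = halfEdges (peel G d) := by
  refine biUnion_pull (B := fun j : Fin M => edgesAt G d b j) (src := id) fun y hy => ?_
  rw [biUnion_edgesAt hH]
  obtain ⟨u, v, rfl⟩ := exists_eq_pair y
  exact mem_halfEdges.mpr (mem_halfEdges.mp hy).1

theorem disjoint_restAt {G : SimpleGraph (Fin n)} : Pairwise fun i j : Fin M =>
    Disjoint (restAt G d b i) (restAt G d b j) :=
  disjoint_pull disjoint_edgesAt _ id

/-- The items of `answers` that a machine produces from its block. -/
noncomputable def answersAt (N : ℕ) [NeZero N] (G : SimpleGraph (Fin n)) (d b j : ℕ) :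
    Finset (Fin n ×ₗ (Fin n ×ₗ (Fin n ×ₗ (Fin 4 ×ₗ Fin N)))) :=
  (answers G d N).filter fun y => toQuad y ∈ block (queries G d) b j

/-- The cliques that a machine counts. -/
noncomputable def countAt (N : ℕ) [NeZero N] (G : SimpleGraph (Fin n)) (d b k j : ℕ) : ℕ :=
  ∑ y ∈ block (answers G d N) b j, if (ofLex (ofLex y).2).1 = (ofLex (ofLex (ofLex y).2).2).1 ∧
    (ofLex (ofLex (ofLex (ofLex y).2).2).2).1 = 0
    then weight G d k (ofLex y).1 (ofLex (ofLex y).2).1 else 0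

/-- The diagonal items of class 0 serve as representatives: there is exactly one for each forward
edge, so each weight is added once, on a single machine. -/
theorem sum_countAt {N : ℕ} [NeZero N] {G : SimpleGraph (Fin n)} {k : ℕ}
    (h : (answers G d N).card ≤ M * b) :
    ∑ j : Fin M, countAt N G d b k j = ∑ v, ∑ u ∈ fwd G d v, weight G d k v u := by
  simp only [countAt]
  rw [← sum_biUnion fun i _ j _ hij => disjoint_block _ _ (Fin.val_injective.ne hij),
    biUnion_block h, ← sum_filter, sum_sigma']
  refine sum_nbij' (fun y => ⟨(ofLex y).1, (ofLex (ofLex y).2).1⟩)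
    (fun p => quint p.1 p.2 p.2 0 (Fin.ofNat N (rank (queries G d) (quad p.2 p.2 0 p.1))))
    ?_ ?_ ?_ ?_ ?_
  · intro y hy
    obtain ⟨v, u, w, c, r, rfl⟩ := exists_eq_quint y
    obtain ⟨h1, -⟩ := mem_filter.mp hy
    exact mem_sigma.mpr ⟨mem_univ _, (mem_answers.mp h1).2.1⟩
  · rintro ⟨v, u⟩ h
    have hu := (mem_sigma.mp h).2
    exact mem_filter.mpr ⟨mem_answers.mpr ⟨by decide, hu, hu, rfl⟩, rfl, rfl⟩
  · intro y hy
    obtain ⟨v, u, w, c, r, rfl⟩ := exists_eq_quint y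
    obtain ⟨h1, h2, h3⟩ := mem_filter.mp hy
    obtain rfl : u = w := h2
    obtain rfl : c = 0 := h3
    rw [quint_inj]
    exact ⟨rfl, rfl, rfl, rfl, (mem_answers.mp h1).2.2.2.symm⟩
  · rintro ⟨v, u⟩ _
    rfl
  · intro y _
    rfl

variable (Q : Setup M S W b)

/-- The at most 3d² answers for `v` fit into one block, so a machine that holds one of them sees
them all. The diagonal answers give the forward neighbours of `v`, and the ranks give all
adjacencies between them; the weight depends on nothing else. -/
theorem weight_congr [NeZero Q.N] {G G' : SimpleGraph (Fin n)} {k j : ℕ} {v u w : Fin n}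
    {c : Fin 4} {r : Fin Q.N} (hdb : 3 * d ^ 2 ≤ b) (hQ : (queries G d).card ≤ M * b)
    (hQ' : (queries G' d).card ≤ M * b)
    (hw : window (answers G d Q.N) b j = window (answers G' d Q.N) b j)
    (hy : quint v u w c r ∈ block (answers G d Q.N) b j) :
    weight G d k v u = weight G' d k v u := by
  have hB := block_eq_of_window hw
  have hsub : ∀ {G : SimpleGraph (Fin n)}, quint v u w c r ∈ block (answers G d Q.N) b j →
      ∀ x y c' r', quint v x y c' r' ∈ answers G d Q.N →
        quint v x y c' r' ∈ nearBlocks (answers G d Q.N) b j := by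
    intro G hy x y c' r' h
    exact filter_subset_nearBlocks hy (fst_convex v) rfl ((card_answers_at v).trans hdb)
      (mem_filter.mpr ⟨h, rfl⟩)
  have hN := nearBlocks_eq_of_window hw
  have htr : ∀ x y c' r', quint v x y c' r' ∈ answers G d Q.N ↔
      quint v x y c' r' ∈ answers G' d Q.N := by
    intro x y c' r'
    refine ⟨fun h => ?_, fun h => ?_⟩
    · have h1 := hsub hy x y c' r' h
      rw [hN] at h1
      exact (mem_filter.mp h1).1
    · have h1 := hsub (hB ▸ hy) x y c' r' h
      rw [← hN] at h1
      exact (mem_filter.mp h1).1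
  have hfwd : fwd G d v = fwd G' d v := by
    ext x
    constructor
    · intro hx
      exact (mem_answers.mp ((htr x x 0 _).mp (mem_answers.mpr ⟨by decide, hx, hx, rfl⟩))).2.1
    · intro hx
      exact (mem_answers.mp ((htr x x 0 _).mpr (mem_answers.mpr ⟨by decide, hx, hx, rfl⟩))).2.1
  have hrank : ∀ x ∈ fwd G d v, ∀ y ∈ fwd G d v, ∀ c', c' ≠ 1 →
      rank (queries G d) (quad x y c' v) = rank (queries G' d) (quad x y c' v) := by
    intro x hx y hy c' hc'
    have h1 := (mem_answers.mp ((htr x y c' _).mp (mem_answers.mpr ⟨hc', hx, hy, rfl⟩))).2.2.2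
    have h2 : rank (queries G d) (quad x y c' v) < Q.N :=
      (rank_lt_card (mem_queries.mpr (Or.inr ⟨hc', hx, hy⟩))).trans_le (hQ.trans Q.lt_N.le)
    have h3 : rank (queries G' d) (quad x y c' v) < Q.N :=
      (rank_lt_card (mem_queries.mpr (Or.inr ⟨hc', hfwd ▸ hx, hfwd ▸ hy⟩))).trans_le
        (hQ'.trans Q.lt_N.le)
    have h4 := congrArg Fin.val h1
    simpa [Fin.ofNat, Nat.mod_eq_of_lt h2, Nat.mod_eq_of_lt h3] using h4
  have hadj : ∀ x ∈ fwd G d v, ∀ y ∈ fwd G d v, G.Adj x y ↔ G'.Adj x y := by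
    intro x hx y hy
    rw [adj_iff_rank (d := d) (v := v), adj_iff_rank (d := d) (v := v),
      hrank x hx y hy 0 (by decide), hrank x hx y hy 2 (by decide), hrank x hx y hy 3 (by decide)]
  rw [weight, weight, ← hfwd]
  congr 1
  ext s
  simp only [mem_filter, mem_univ, true_and]
  refine and_congr_right fun hs => and_congr_left fun _ => ?_
  simp only [SimpleGraph.isNClique_iff, SimpleGraph.isClique_iff, Set.Pairwise]
  refine and_congr_left fun _ => forall₂_congr fun x hx => forall₂_congr fun y hy => ?_
  rw [hadj x (hs hx) y (hs hy)]

variable [NeZero M]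

/-- The pairs of forward neighbours are listed. -/
theorem leads_expand {G : Γ → SimpleGraph (Fin n)} (hd : 0 < d) (hdb : 3 * d ^ 2 ≤ b)
    (hH : ∀ γ, (halfEdges (G γ)).card ≤ M * b)
    (hF : ∀ γ, (fwdEdges (G γ) d).card ≤ M * (b / d)) (acc : Γ → Fin M → Fin K)
    (hn : 2 * n ^ 2 + K ≤ Q.D ^ Q.p) (hn' : 4 * n ^ 3 * Q.N ≤ Q.D ^ Q.p) :
    Leads S W
      (fun γ j => ((fwdEdges (G γ) d).filter fun y => y ∈ edgesAt (G γ) d b j).val.disjSum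
        ((edgesAt (G γ) d b j).val.disjSum ((restAt (G γ) d b j).val.disjSum {acc γ j})))
      (fun γ j => (queriesAt (G γ) d b (b / d) j).val.disjSum
        ((restAt (G γ) d b j).val.disjSum {acc γ j})) (Q.sortRounds + 2) := by
  have hb := Q.b_pos
  have hN := Q.N_pos
  have hn2 : n ^ 2 = n * n := sq n
  have hn3 : n ^ 3 = n * (n * n) := by ring
  have hn3N : 4 * n ^ 3 ≤ 4 * n ^ 3 * Q.N := Nat.le_mul_of_pos_right _ hN
  -- Forward edges are sorted into blocks of length `b / d`. This is short enough that expansion by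
  -- a factor 3d stays within 3b, and long enough that all forward edges of a vertex fit into one
  -- block.
  have hdβ : d ≤ b / d := (Nat.le_div_iff_mul_le hd).mpr (by nlinarith)
  have hβ : 0 < b / d := hd.trans_le hdβ
  have hβb : b / d ≤ b := Nat.div_le_self _ _
  refine Q.leads_sort_map hβ hβb (fun γ (j : Fin M) => (fwdEdges (G γ) d).filter fun y =>
      y ∈ edgesAt (G γ) d b j) (fun γ j => (edgesAt (G γ) d b j).val.disjSum
        ((restAt (G γ) d b j).val.disjSum {acc γ j})) (fun γ => fwdEdges (G γ) d) _
    ?_ ?_ hF ?_ ?_ ?_ ?_ ?_ ?_ ?_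
  · intro γ
    exact disjoint_pull disjoint_edgesAt _ id
  · intro γ
    refine biUnion_pull (B := fun j : Fin M => edgesAt (G γ) d b j) (src := id) fun y hy => ?_
    rw [biUnion_edgesAt (hH γ)]
    obtain ⟨u, v, rfl⟩ := exists_eq_pair y
    exact mem_halfEdges.mpr (mem_fwd.mp (mem_fwdEdges.mp hy)).2.1
  · intro γ γ' j hw hz
    obtain ⟨hE, hz⟩ := disjSum_injective hz
    have hE := val_injective hE
    rw [hz]
    congr 2
    have hB := block_eq_of_window hw
    ext y
    obtain ⟨u, w, c, v, rfl⟩ := exists_eq_quad y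
    rw [mem_queriesAt, mem_queriesAt, ← hE, ← hB]
    refine or_congr (and_congr_right fun _ => and_congr_left fun h => ?_)
      (and_congr_right fun _ => and_congr_left fun h => ?_)
    · have h1 := mem_halfEdges.mp (edgesAt_subset _ h)
      have h2 := mem_halfEdges.mp (edgesAt_subset _ (hE ▸ h))
      simp only [h1, h2]
    · have hlocal : ∀ γ, toLex (v, u) ∈ block (fwdEdges (G γ) d) (b / d) j → ∀ x,
          x ∈ fwd (G γ) d v ↔ toLex (v, x) ∈ nearBlocks (fwdEdges (G γ) d) (b / d) j := by
        intro γ h x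
        have hs := filter_subset_nearBlocks h (fst_convex v) rfl
          ((card_fwdEdges_at v).trans hdβ)
        constructor
        · intro hx
          exact hs (mem_filter.mpr ⟨mem_fwdEdges.mpr hx, rfl⟩)
        · intro hx
          exact mem_fwdEdges.mp (mem_filter.mp hx).1
      rw [hlocal γ h, hlocal γ h, hlocal γ' (hB ▸ h), hlocal γ' (hB ▸ h),
        nearBlocks_eq_of_window hw]
  · intro γ j
    have h1 := card_le_card (show ((fwdEdges (G γ) d).filter fun y => y ∈ edgesAt (G γ) d b j) ⊆ _
      from fun y hy => (mem_filter.mp hy).2)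
    have h2 := card_edgesAt_le (G := G γ) (d := d) hb j
    have h3 := card_restAt_le (G := G γ) (d := d) hb j
    simp only [Multiset.card_disjSum, card_val, Multiset.card_singleton]
    omega
  · intro γ j
    have h2 := card_edgesAt_le (G := G γ) (d := d) hb j
    have h3 := card_restAt_le (G := G γ) (d := d) hb j
    simp only [Multiset.card_disjSum, card_val, Multiset.card_singleton]
    omega
  · intro γ j
    have h1 := card_queriesAt_le (G := G γ) (d := d) hb hβ j (Nat.div_mul_le_self b d)
    have h3 := card_restAt_le (G := G γ) (d := d) hb j
    simp only [Multiset.card_disjSum, card_val, Multiset.card_singleton]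
    omega
  · simp only [Fintype.card_lex, Fintype.card_prod, Fintype.card_fin]
    omega
  · simp only [Fintype.card_sum, Fintype.card_lex, Fintype.card_prod, Fintype.card_fin]
    omega
  · simp only [Fintype.card_sum, Fintype.card_lex, Fintype.card_prod, Fintype.card_fin]
    have : n * (n * (4 * n)) = 4 * n ^ 3 := by ring
    omega

/-- The ranks of the listed items are found. -/
theorem leads_rank [NeZero Q.N] {G : Γ → SimpleGraph (Fin n)} (hd : 0 < d) (hdb : 3 * d ^ 2 ≤ b)
    (hH : ∀ γ, (halfEdges (G γ)).card ≤ M * b)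
    (hF : ∀ γ, (fwdEdges (G γ) d).card ≤ M * (b / d))
    (hQ : ∀ γ, (queries (G γ) d).card ≤ M * b) (acc : Γ → Fin M → Fin K)
    (hn : 2 * n ^ 2 + K ≤ Q.D ^ Q.p) (hn' : 4 * n ^ 3 * Q.N ≤ Q.D ^ Q.p) :
    Leads S W
      (fun γ j => (queriesAt (G γ) d b (b / d) j).val.disjSum
        ((restAt (G γ) d b j).val.disjSum {acc γ j}))
      (fun γ j => (answersAt Q.N (G γ) d b j).val.disjSum
        ((restAt (G γ) d b j).val.disjSum {acc γ j})) (Q.sortRounds + 2) := by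
  have hb := Q.b_pos
  have hn2 : n ^ 2 = n * n := sq n
  have hn3N : 4 * n ^ 3 ≤ 4 * n ^ 3 * Q.N := Nat.le_mul_of_pos_right _ Q.N_pos
  have hβ : 0 < b / d := Nat.div_pos (by nlinarith) hd
  refine Q.leads_sort_map hb le_rfl (fun γ (j : Fin M) => queriesAt (G γ) d b (b / d) j)
    (fun γ j => (restAt (G γ) d b j).val.disjSum {acc γ j}) (fun γ => queries (G γ) d) _
    (fun γ => disjoint_queriesAt) (fun γ => biUnion_queriesAt (hH γ) (hF γ)) hQ
    ?_ ?_ ?_ ?_ ?_ ?_ ?_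
  · intro γ γ' j hw hz
    rw [hz]
    congr 2
    have hB := block_eq_of_window hw
    ext y
    obtain ⟨v, u, w, c, r, rfl⟩ := exists_eq_quint y
    simp only [answersAt, mem_filter, toQuad_quint, ← hB]
    refine and_congr_left fun hy => ?_
    have hr := rank_eq_of_window hw (block_subset_nearBlocks _ _ _ hy)
    have h1 := mem_queries.mp (mem_block.mp hy).1
    have h2 := mem_queries.mp (mem_block.mp (hB ▸ hy)).1
    rw [mem_answers, mem_answers, hr]
    refine and_congr_right fun hc => ?_
    simp only [hc, false_and, false_or, ne_eq, not_false_eq_true, true_and] at h1 h2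
    simp only [h1, h2, true_and]
  · intro γ j
    have h1 := card_queriesAt_le (G := G γ) (d := d) hb hβ j (Nat.div_mul_le_self b d)
    have h3 := card_restAt_le (G := G γ) (d := d) hb j
    simp only [Multiset.card_disjSum, card_val, Multiset.card_singleton]
    omega
  · intro γ j
    have h3 := card_restAt_le (G := G γ) (d := d) hb j
    simp only [Multiset.card_disjSum, card_val, Multiset.card_singleton]
    omega
  · intro γ j
    have h1 : (answersAt Q.N (G γ) d b j).card ≤ b :=
      (card_pull_le toQuad_injOn).trans (card_block (queries (G γ) d) hb j)
    have h3 := card_restAt_le (G := G γ) (d := d) hb j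
    simp only [Multiset.card_disjSum, card_val, Multiset.card_singleton]
    omega
  · simp only [Fintype.card_lex, Fintype.card_prod, Fintype.card_fin]
    have : n * (n * (4 * n)) = 4 * n ^ 3 := by ring
    omega
  · simp only [Fintype.card_sum, Fintype.card_lex, Fintype.card_prod, Fintype.card_fin]
    omega
  · simp only [Fintype.card_sum, Fintype.card_lex, Fintype.card_prod, Fintype.card_fin]
    have : n * (n * (n * (4 * Q.N))) = 4 * n ^ 3 * Q.N := by ring
    omega

/-- The cliques through vertices of low degree are counted. -/
theorem leads_count [NeZero Q.N] [NeZero K] {G : Γ → SimpleGraph (Fin n)} {k : ℕ}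
    (hdb : 3 * d ^ 2 ≤ b) (hQ : ∀ γ, (queries (G γ) d).card ≤ M * b) (acc : Γ → Fin M → ℕ)
    (hacc : ∀ γ j, acc γ j < K)
    (hn : 2 * n ^ 2 + K ≤ Q.D ^ Q.p) (hn' : 4 * n ^ 3 * Q.N ≤ Q.D ^ Q.p) :
    Leads S W
      (fun γ j => (answersAt Q.N (G γ) d b j).val.disjSum
        ((restAt (G γ) d b j).val.disjSum {Fin.ofNat K (acc γ j)}))
      (fun γ j => (restAt (G γ) d b j).val.disjSum
        {Fin.ofNat K (acc γ j + countAt Q.N (G γ) d b k j)}) (Q.sortRounds + 2) := by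
  have hb := Q.b_pos
  have hn2 : n ^ 2 = n * n := sq n
  refine Q.leads_sort_map hb le_rfl (fun γ (j : Fin M) => answersAt Q.N (G γ) d b j)
    (fun γ j => (restAt (G γ) d b j).val.disjSum {Fin.ofNat K (acc γ j)})
    (fun γ => answers (G γ) d Q.N) _
    (fun γ => ?_) (fun γ => ?_) (fun γ => card_answers_le.trans (hQ γ)) ?_ ?_ ?_ ?_ ?_ ?_ ?_
  · exact disjoint_pull (B := fun j : Fin M => block (queries (G γ) d) b j)
      (fun i j hij => disjoint_block _ _ (Fin.val_injective.ne hij)) _ _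
  · refine biUnion_pull (B := fun j : Fin M => block (queries (G γ) d) b j) fun y hy => ?_
    rw [biUnion_block (hQ γ)]
    exact toQuad_mem hy
  · intro γ γ' j hw hz
    obtain ⟨h1, h2⟩ := disjSum_injective hz
    have h3 : acc γ j = acc γ' j := by
      have := congrArg Fin.val (Multiset.singleton_inj.mp h2)
      simpa [Fin.ofNat, Nat.mod_eq_of_lt (hacc γ j), Nat.mod_eq_of_lt (hacc γ' j)] using this
    have h4 : countAt Q.N (G γ) d b k j = countAt Q.N (G γ') d b k j := by
      rw [countAt, countAt, ← block_eq_of_window hw]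
      refine sum_congr rfl fun y hy => ?_
      obtain ⟨v, u, w, c, r, rfl⟩ := exists_eq_quint y
      simp only [quint, ofLex_toLex]
      rw [Q.weight_congr hdb (hQ γ) (hQ γ') hw hy]
    rw [h1, h3, h4]
  · intro γ j
    have h1 : (answersAt Q.N (G γ) d b j).card ≤ b :=
      (card_pull_le toQuad_injOn).trans (card_block (queries (G γ) d) hb j)
    have h3 := card_restAt_le (G := G γ) (d := d) hb j
    simp only [Multiset.card_disjSum, card_val, Multiset.card_singleton]
    omega
  · intro γ j
    have h3 := card_restAt_le (G := G γ) (d := d) hb j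
    simp only [Multiset.card_disjSum, card_val, Multiset.card_singleton]
    omega
  · intro γ j
    have h3 := card_restAt_le (G := G γ) (d := d) hb j
    simp only [Multiset.card_disjSum, card_val, Multiset.card_singleton]
    omega
  · simp only [Fintype.card_lex, Fintype.card_prod, Fintype.card_fin]
    have : n * (n * (n * (4 * Q.N))) = 4 * n ^ 3 * Q.N := by ring
    omega
  · simp only [Fintype.card_sum, Fintype.card_lex, Fintype.card_prod, Fintype.card_fin]
    omega
  · simp only [Fintype.card_sum, Fintype.card_lex, Fintype.card_prod, Fintype.card_fin]
    omega

/-- A graph whose half-edges are distributed over the machines, together with a count on every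
machine. -/
noncomputable def state (K : ℕ) [NeZero K] (a : Γ → Fin M → Finset (Fin n ×ₗ Fin n))
    (acc : Γ → Fin M → ℕ) (γ : Γ) (j : Fin M) : Multiset ((Fin n ×ₗ Fin n) ⊕ Fin K) :=
  (a γ j).val.disjSum {Fin.ofNat K (acc γ j)}

/-- One phase: the cliques through vertices of degree at most `d` are counted, and the edges at
these vertices are removed. -/
theorem leads_phase [NeZero K] {G : Γ → SimpleGraph (Fin n)} {k : ℕ} (hk : 2 ≤ k) (hd : 0 < d)
    (hdb : 3 * d ^ 2 ≤ b)
    (hH : ∀ γ, (halfEdges (G γ)).card ≤ M * b)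
    (hF : ∀ γ, (fwdEdges (G γ) d).card ≤ M * (b / d))
    (hQ : ∀ γ, (queries (G γ) d).card ≤ M * b)
    (a : Γ → Fin M → Finset (Fin n ×ₗ Fin n))
    (hdisj : ∀ γ, Pairwise fun i j => Disjoint (a γ i) (a γ j))
    (hA : ∀ γ, univ.biUnion (a γ) = halfEdges (G γ)) (ha : ∀ γ j, (a γ j).card ≤ 2 * b)
    (acc : Γ → Fin M → ℕ) (hacc : ∀ γ, (G γ).numCliques k + ∑ j, acc γ j < K)
    (hn : 2 * n ^ 2 + K ≤ Q.D ^ Q.p) (hn' : 4 * n ^ 3 * Q.N ≤ Q.D ^ Q.p) :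
    ∃ (a' : Γ → Fin M → Finset (Fin n ×ₗ Fin n)) (acc' : Γ → Fin M → ℕ),
      (∀ γ, Pairwise fun i j => Disjoint (a' γ i) (a' γ j)) ∧
      (∀ γ, univ.biUnion (a' γ) = halfEdges (peel (G γ) d)) ∧ (∀ γ j, (a' γ j).card ≤ 2 * b) ∧
      (∀ γ, (peel (G γ) d).numCliques k + ∑ j, acc' γ j =
        (G γ).numCliques k + ∑ j, acc γ j) ∧
      Leads S W (state K a acc) (state K a' acc') (5 * (Q.sortRounds + 2)) := by
  have : NeZero Q.N := ⟨Q.N_pos.ne'⟩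
  have hacc' : ∀ γ j, acc γ j < K := fun γ j =>
    ((single_le_sum (fun _ _ => Nat.zero_le _) (mem_univ j)).trans (Nat.le_add_left _ _)).trans_lt
      (hacc γ)
  refine ⟨fun γ j => restAt (G γ) d b j, fun γ j => acc γ j + countAt Q.N (G γ) d b k j,
    fun γ => disjoint_restAt, fun γ => biUnion_restAt (hH γ),
    fun γ j => (card_restAt_le Q.b_pos j).trans (by omega), fun γ => ?_, ?_⟩
  · rw [sum_add_distrib, sum_countAt (card_answers_le.trans (hQ γ)),
      ← numCliques_peel (G := G γ) (d := d) hk]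
    ring
  · have e : 5 * (Q.sortRounds + 2) = (Q.sortRounds + 2) + ((Q.sortRounds + 2) +
      ((Q.sortRounds + 2) + ((Q.sortRounds + 2) + (Q.sortRounds + 2)))) := by ring
    rw [e]
    have hdb' : d ≤ b := by nlinarith
    exact (Q.leads_flag hdb' a hdisj hA ha hH _ hn).trans ((Q.leads_select hdb' hH _ hn).trans
      ((Q.leads_expand hd hdb hH hF _ hn hn').trans ((Q.leads_rank hd hdb hH hF hQ _ hn hn').trans
        (Q.leads_count hdb hQ acc hacc' hn hn'))))

end Setup

end Phase

/-! ### Few edges on few vertices -/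

section Arboricity

variable {n : ℕ}

/-- Every graph on finitely many vertices is a union of forests. -/
theorem isUnionOfForests (G : SimpleGraph (Fin n)) : G.IsUnionOfForests n := by
  -- The forest with number `i` is the star of the edges whose smaller end is `i`.
  refine ⟨fun i => SimpleGraph.mk (fun u v => G.Adj u v ∧ (u = i ∧ u < v ∨ v = i ∧ v < u))
    ⟨fun u v h => ⟨h.1.symm, h.2.symm⟩⟩ ⟨fun u h => G.loopless.irrefl _ h.1⟩, ?_, ?_, ?_⟩
  · intro i
    refine SimpleGraph.IsAcyclic.anti ?_ (SimpleGraph.isAcyclic_starGraph i)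
    intro u v h
    rw [SimpleGraph.starGraph_adj]
    exact ⟨h.1.ne, h.2.imp (fun h => h.1) fun h => h.1⟩
  · intro i j hij
    rw [SimpleGraph.disjoint_left]
    rintro u v ⟨_, h⟩ ⟨_, h'⟩
    rcases h with ⟨rfl, h⟩ | ⟨rfl, h⟩ <;> rcases h' with ⟨h1, h'⟩ | ⟨h1, h'⟩
    · exact hij h1
    · exact lt_asymm h h'
    · exact lt_asymm h h'
    · exact hij h1
  · ext u v
    simp only [SimpleGraph.iSup_adj]
    constructor
    · rintro ⟨i, h, _⟩
      exact h
    · intro h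
      rcases lt_or_gt_of_ne h.ne with h' | h'
      · exact ⟨u, h, Or.inl ⟨rfl, h'⟩⟩
      · exact ⟨v, h, Or.inr ⟨rfl, h'⟩⟩

theorem isUnionOfForests_arboricity (G : SimpleGraph (Fin n)) :
    G.IsUnionOfForests G.arboricity := by
  have h : {a | G.IsUnionOfForests a}.Nonempty := ⟨n, isUnionOfForests G⟩
  exact Nat.sInf_mem h

open Classical in
theorem card_dart_le_of_isAcyclic {V : Type*} [Fintype V] {F : SimpleGraph V} (h : F.IsAcyclic) :
    Fintype.card F.Dart ≤ 2 * Fintype.card V := by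
  rcases isEmpty_or_nonempty V with hV | hV
  · have : IsEmpty F.Dart := ⟨fun e => hV.elim e.fst⟩
    simp
  · obtain ⟨T, hFT, -, hT⟩ := SimpleGraph.connected_top.exists_isTree_le_of_le_of_isAcyclic
      (le_top : F ≤ ⊤) h
    rw [SimpleGraph.dart_card_eq_twice_card_edges]
    have h1 := card_le_card (SimpleGraph.edgeFinset_mono hFT)
    have h2 := hT.card_edgeFinset
    omega

/-- The edges of `G` have both ends in `U`. -/
def SupportedOn (G : SimpleGraph (Fin n)) (U : Finset (Fin n)) : Prop :=
  ∀ u v, G.Adj u v → u ∈ U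

theorem card_halfEdges_le_of_isAcyclic {F : SimpleGraph (Fin n)} (h : F.IsAcyclic)
    {U : Finset (Fin n)} (hU : SupportedOn F U) : (halfEdges F).card ≤ 2 * U.card := by
  classical
  have h1 := card_dart_le_of_isAcyclic (h.induce (U : Set (Fin n)))
  have h2 : Fintype.card (U : Set (Fin n)) = U.card := by simp
  rw [h2] at h1
  refine le_trans ?_ h1
  rw [← card_univ]
  refine le_trans (card_le_card (t := univ.image fun e : (F.induce (U : Set (Fin n))).Dart =>
    (toLex ((e.fst : Fin n), (e.snd : Fin n)) : Fin n ×ₗ Fin n)) fun y hy => ?_) card_image_le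
  obtain ⟨u, v, rfl⟩ := exists_eq_pair y
  have huv := mem_halfEdges.mp hy
  exact mem_image.mpr ⟨⟨(⟨u, hU u v huv⟩, ⟨v, hU v u huv.symm⟩), huv⟩, mem_univ _, rfl⟩

/-- The forests of `G` restrict to subgraphs, and on U each has fewer edges than U has vertices
unless U is empty. Keeping the forests of the original graph avoids any argument about the
arboricity of peeled graphs. -/
theorem card_halfEdges_le {G G' : SimpleGraph (Fin n)} {α : ℕ} (hG : G.arboricity ≤ α)
    (hle : G' ≤ G) {U : Finset (Fin n)} (hU : SupportedOn G' U) :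
    (halfEdges G').card ≤ 2 * α * U.card := by
  classical
  obtain ⟨F, hF, -, hsup⟩ := isUnionOfForests_arboricity G
  have h : halfEdges G' ⊆ univ.biUnion fun i => halfEdges (F i ⊓ G') := by
    intro y hy
    obtain ⟨u, v, rfl⟩ := exists_eq_pair y
    have huv := mem_halfEdges.mp hy
    have h1 := hle huv
    rw [← hsup, SimpleGraph.iSup_adj] at h1
    obtain ⟨i, hi⟩ := h1
    exact mem_biUnion.mpr ⟨i, mem_univ _, mem_halfEdges.mpr ⟨hi, huv⟩⟩
  refine (card_le_card h).trans (card_biUnion_le.trans ?_)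
  have h2 : ∀ i, (halfEdges (F i ⊓ G')).card ≤ 2 * U.card := fun i =>
    card_halfEdges_le_of_isAcyclic ((hF i).anti inf_le_left) fun u v huv => hU u v huv.2
  calc ∑ i, (halfEdges (F i ⊓ G')).card ≤ ∑ _i : Fin G.arboricity, 2 * U.card :=
        sum_le_sum fun i _ => h2 i
    _ = G.arboricity * (2 * U.card) := by simp
    _ ≤ α * (2 * U.card) := Nat.mul_le_mul_right _ hG
    _ = 2 * α * U.card := by ring

end Arboricity

/-! ### Sizes in terms of the supporting vertex set -/

section Counting

variable {n : ℕ} (G : SimpleGraph (Fin n)) (d : ℕ)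

open Classical in
/-- The vertices of degree more than `d`. -/
noncomputable def high : Finset (Fin n) := univ.filter fun v => ¬ Low G d v

variable {G d}

theorem supportedOn_peel : SupportedOn (peel G d) (high G d) := by
  intro u v h
  simpa [high] using h.2.1

theorem peel_le : peel G d ≤ G := fun _ _ h => h.1

theorem card_high_mul_le : (high G d).card * d ≤ (halfEdges G).card := by
  calc (high G d).card * d ≤ ∑ v ∈ high G d, (nbrs G v).card := by
        rw [← smul_eq_mul]
        refine card_nsmul_le_sum _ _ _ fun v hv => ?_
        simp only [high, Low, mem_filter, mem_univ, true_and, not_le] at hv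
        exact hv.le
    _ = ∑ v ∈ high G d, ((halfEdges G).filter fun y => (ofLex y).1 = v).card := by
        simp only [card_halfEdges_at]
    _ ≤ ∑ v, ((halfEdges G).filter fun y => (ofLex y).1 = v).card :=
        sum_le_sum_of_subset (subset_univ _)
    _ = (halfEdges G).card := (card_eq_sum_card_fiberwise fun _ _ => mem_univ _).symm

theorem card_fwdEdges_le {U : Finset (Fin n)} (hU : SupportedOn G U) :
    (fwdEdges G d).card ≤ U.card * d := by
  rw [card_eq_sum_card_fiberwise (f := fun y => (ofLex y).1) (t := U), ← smul_eq_mul]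
  · exact sum_le_card_nsmul _ _ _ fun v _ => card_fwdEdges_at v
  · intro y hy
    obtain ⟨v, u, rfl⟩ := exists_eq_pair y
    exact hU v u (mem_fwd.mp (mem_fwdEdges.mp hy)).2.1

theorem card_queries_le {U : Finset (Fin n)} (hU : SupportedOn G U) :
    (queries G d).card ≤ (halfEdges G).card + U.card * d * (3 * d) := by
  have h1 := card_queries_one_le (G := G) (d := d) (halfEdges G)
  have h2 := card_queries_part_le (G := G) (d := d) (fwdEdges G d)
  have h3 := Nat.mul_le_mul_right (3 * d) (card_fwdEdges_le (d := d) hU)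
  refine le_trans ?_ (add_le_add h1 (h2.trans h3))
  refine le_trans (card_le_card fun y hy => ?_) (card_union_le _ _)
  obtain ⟨u, w, c, v, rfl⟩ := exists_eq_quad y
  rw [mem_union, mem_filter, mem_filter]
  simp only [quad, ofLex_toLex]
  rcases mem_queries.mp hy with ⟨h4, -, h5⟩ | ⟨h4, h5, -⟩
  · exact Or.inl ⟨hy, h4, mem_halfEdges.mpr h5⟩
  · exact Or.inr ⟨hy, h4, mem_fwdEdges.mpr h5⟩

theorem numCliques_eq_zero {k : ℕ} (hk : 2 ≤ k) (hU : SupportedOn G ∅) : G.numCliques k = 0 := by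
  classical
  rw [numCliques_eq_card, card_eq_zero]
  refine eq_empty_of_forall_notMem fun s hs => ?_
  have h := (mem_filter.mp hs).2
  obtain ⟨u, hu, v, hv, huv⟩ := one_lt_card.mp (by rw [h.card_eq]; omega : 1 < s.card)
  exact absurd (hU u v (h.isClique hu hv huv)) (notMem_empty _)

theorem numCliques_le (G : SimpleGraph (Fin n)) (k : ℕ) : G.numCliques k ≤ n ^ k := by
  classical
  rw [numCliques_eq_card]
  refine (card_le_card fun s hs => ?_ : _ ≤ ((univ : Finset (Fin n)).powersetCard k).card).trans ?_
  · exact mem_powersetCard.mpr ⟨subset_univ _, (mem_filter.mp hs).2.card_eq⟩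
  · rw [card_powersetCard, card_fin]
    exact Nat.choose_le_pow n k

end Counting

/-! ### Degree thresholds and the decrease of the vertex set -/

section Schedule

/-- The number of binary orders of magnitude by which the number of vertices has decreased after
`i` phases, when `E` bounds the growth of the thresholds. -/
def gain (E : ℕ) : ℕ → ℕ
  | 0 => 0
  | i + 1 => gain E i + 1 + min (gain E i / 2) E

/-- The degree threshold of a phase. -/
def threshold (E α i : ℕ) : ℕ := α * 2 ^ (2 + min (gain E i / 2) E)

variable {n : ℕ}

/-- The graph after `i` phases. -/
def peeled (E α : ℕ) (G : SimpleGraph (Fin n)) : ℕ → SimpleGraph (Fin n)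
  | 0 => G
  | i + 1 => peel (peeled E α G i) (threshold E α i)

theorem peeled_le (E α : ℕ) (G : SimpleGraph (Fin n)) (i : ℕ) : peeled E α G i ≤ G := by
  induction i with
  | zero => exact le_rfl
  | succ i ih => exact peel_le.trans ih

/-- The vertices of degree above d = α·2^(2+m) number at most 2α|U|/d = |U|/2^(1+m), and 1 + m is
the increment of `gain`. Only these vertices keep edges. -/
theorem exists_support {E α : ℕ} (hα : 0 < α) {G : SimpleGraph (Fin n)} (hG : G.arboricity ≤ α)
    (i : ℕ) : ∃ U, SupportedOn (peeled E α G i) U ∧ U.card * 2 ^ gain E i ≤ n := by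
  induction i with
  | zero => exact ⟨univ, fun _ _ _ => mem_univ _, by simp [gain]⟩
  | succ i ih =>
    obtain ⟨U, hU, hc⟩ := ih
    refine ⟨_, supportedOn_peel, le_trans ?_ hc⟩
    have h1 := (card_high_mul_le (G := peeled E α G i) (d := threshold E α i)).trans
      (card_halfEdges_le hG (peeled_le E α G i) hU)
    set m := min (gain E i / 2) E with hm
    set H := (high (peeled E α G i) (threshold E α i)).card
    have h2 : H * 2 ^ (1 + m) ≤ U.card := by
      rw [threshold, ← hm] at h1
      have e : H * (α * 2 ^ (2 + m)) = 2 * α * (H * 2 ^ (1 + m)) := by ring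
      rw [e] at h1
      exact Nat.le_of_mul_le_mul_left h1 (by omega)
    have e : gain E (i + 1) = (1 + m) + gain E i := by rw [gain, ← hm]; ring
    rw [e, pow_add, ← mul_assoc]
    exact Nat.mul_le_mul_right _ h2

/-- The exponent of the threshold contains half of the gain, so its square grows no faster than the
vertex set shrinks. This is the bound on total space. -/
theorem card_mul_threshold_sq_le {E α i c : ℕ} (h : c * 2 ^ gain E i ≤ n) :
    c * threshold E α i ^ 2 ≤ 16 * (n * α ^ 2) := by
  have h1 : threshold E α i ^ 2 ≤ 16 * α ^ 2 * 2 ^ gain E i := by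
    rw [threshold, mul_pow, ← pow_mul]
    have h2 : (2 + min (gain E i / 2) E) * 2 ≤ 4 + gain E i := by omega
    have h3 := Nat.pow_le_pow_right (n := 2) (by norm_num) h2
    rw [pow_add] at h3
    calc α ^ 2 * 2 ^ ((2 + min (gain E i / 2) E) * 2) ≤ α ^ 2 * (2 ^ 4 * 2 ^ gain E i) :=
          Nat.mul_le_mul_left _ h3
      _ = _ := by ring
  calc c * threshold E α i ^ 2 ≤ c * (16 * α ^ 2 * 2 ^ gain E i) := Nat.mul_le_mul_left _ h1
    _ = 16 * α ^ 2 * (c * 2 ^ gain E i) := by ring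
    _ ≤ 16 * α ^ 2 * n := Nat.mul_le_mul_left _ h
    _ = _ := by ring

/-- The purpose of the cap `E`: in every phase the pairs that belong to one vertex fit into one
machine. -/
theorem threshold_sq_le (E α i : ℕ) : threshold E α i ^ 2 ≤ 16 * α ^ 2 * 4 ^ E := by
  rw [threshold, mul_pow, ← pow_mul]
  have h2 : (2 + min (gain E i / 2) E) * 2 ≤ 4 + 2 * E := by omega
  have h3 := Nat.pow_le_pow_right (n := 2) (by norm_num) h2
  rw [pow_add, pow_mul 2 2 E] at h3
  calc α ^ 2 * 2 ^ ((2 + min (gain E i / 2) E) * 2) ≤ α ^ 2 * (2 ^ 4 * (2 ^ 2) ^ E) :=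
        Nat.mul_le_mul_left _ h3
    _ = _ := by ring

end Schedule

/-! ### The initial distribution of the edges -/

section Distribution

variable {n M : ℕ}

theorem encode_injective : Function.Injective (encode (n := n)) := by
  intro l
  induction l with
  | nil =>
    intro l' h
    cases l' with
    | nil => rfl
    | cons p l' => simp [encode] at h
  | cons p l ih =>
    intro l' h
    cases l' with
    | nil => simp [encode] at h
    | cons p' l' =>
      simp only [encode, List.flatMap_cons, List.cons_append, List.nil_append,
        List.cons.injEq] at h
      rw [ih h.2.2, Prod.ext (Fin.ext h.1) (Fin.ext h.2.1)]

theorem length_encode (l : List (Fin n × Fin n)) : (encode l).length = 2 * l.length := by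
  induction l with
  | nil => rfl
  | cons p l ih =>
    simp only [encode, List.flatMap_cons, List.length_append, List.length_cons,
      List.length_nil] at ih ⊢
    omega

theorem lt_of_mem_encode {l : List (Fin n × Fin n)} {x : ℕ} (h : x ∈ encode l) : x < n := by
  simp only [encode, List.mem_flatMap, List.mem_cons, List.not_mem_nil, or_false] at h
  obtain ⟨p, -, rfl | rfl⟩ := h
  · exact p.1.2
  · exact p.2.2

variable {G : SimpleGraph (Fin n)} {S : ℕ} {inp : Fin M → List (Fin n × Fin n)}

/-- The input of a machine, as a set. -/
def inputSet (inp : Fin M → List (Fin n × Fin n)) (j : Fin M) : Finset (Fin n ×ₗ Fin n) :=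
  ((inp j).map toLex).toFinset

theorem mem_inputSet {j : Fin M} {u v : Fin n} :
    toLex (u, v) ∈ inputSet inp j ↔ (u, v) ∈ inp j := by
  simp [inputSet]

theorem card_inputSet_le (j : Fin M) : (inputSet inp j).card ≤ (inp j).length :=
  (List.toFinset_card_le _).trans (by simp)

/-- All pairs of the input. -/
def inputUnion (inp : Fin M → List (Fin n × Fin n)) : Finset (Fin n ×ₗ Fin n) :=
  univ.biUnion (inputSet inp)

theorem mem_inputUnion {u v : Fin n} :
    toLex (u, v) ∈ inputUnion inp ↔ (u, v) ∈ (List.finRange M).flatMap inp := by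
  simp [inputUnion, mem_inputSet]

theorem IsDistribution.disjoint (h : IsDistribution G S inp) :
    Pairwise fun i j => Disjoint (inputSet inp i) (inputSet inp j) := by
  have h1 := (List.nodup_flatMap.mp (List.Nodup.of_map _ h.nodup)).2
  have h2 : ∀ i j, i < j → Disjoint (inputSet inp i) (inputSet inp j) := by
    intro i j hij
    have h3 := List.pairwise_iff_getElem.mp h1 i j (by simp) (by simp) hij
    rw [disjoint_left]
    intro y hy hy'
    obtain ⟨u, v, rfl⟩ := exists_eq_pair y
    refine h3 (a := (u, v)) ?_ ?_
    · simpa using mem_inputSet.mp hy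
    · simpa using mem_inputSet.mp hy'
  intro i j hij
  rcases lt_or_gt_of_ne hij with h' | h'
  · exact h2 i j h'
  · exact (h2 j i h').symm

theorem IsDistribution.adj (h : IsDistribution G S inp) {u v : Fin n}
    (huv : toLex (u, v) ∈ inputUnion inp) : G.Adj u v :=
  (h.mem_iff s(u, v)).mp (List.mem_map.mpr ⟨(u, v), mem_inputUnion.mp huv, rfl⟩)

theorem IsDistribution.mem_or_mem (h : IsDistribution G S inp) {u v : Fin n} (huv : G.Adj u v) :
    toLex (u, v) ∈ inputUnion inp ∨ toLex (v, u) ∈ inputUnion inp := by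
  obtain ⟨⟨u', v'⟩, hp, e⟩ := List.mem_map.mp ((h.mem_iff s(u, v)).mpr huv)
  rw [Sym2.eq_iff] at e
  rcases e with ⟨rfl, rfl⟩ | ⟨rfl, rfl⟩
  · exact Or.inl (mem_inputUnion.mpr hp)
  · exact Or.inr (mem_inputUnion.mpr hp)

/-- Both orders give the same unordered edge, which is held only once. Hence adding the reversed
pairs to each block creates no duplicates. -/
theorem IsDistribution.not_mem_swap (h : IsDistribution G S inp) {u v : Fin n}
    (huv : toLex (u, v) ∈ inputUnion inp) : toLex (v, u) ∉ inputUnion inp := by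
  intro hvu
  have h1 := List.inj_on_of_nodup_map h.nodup (mem_inputUnion.mp huv) (mem_inputUnion.mp hvu)
    Sym2.eq_swap
  exact (h.adj huv).ne (congrArg Prod.fst h1)

theorem card_inputUnion_le (h : IsDistribution G S inp) :
    (inputUnion inp).card ≤ (halfEdges G).card := by
  refine card_le_card fun y hy => ?_
  obtain ⟨u, v, rfl⟩ := exists_eq_pair y
  exact mem_halfEdges.mpr (h.adj hy)

/-- The opposite pair. -/
def swapPair (y : Fin n ×ₗ Fin n) : Fin n ×ₗ Fin n := toLex ((ofLex y).2, (ofLex y).1)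

/-- The pairs of a block of the input, in both orders. -/
noncomputable def bothOrders (A : Finset (Fin n ×ₗ Fin n)) (b j : ℕ) : Finset (Fin n ×ₗ Fin n) :=
  block A b j ∪ (block A b j).image swapPair

theorem mem_bothOrders {A : Finset (Fin n ×ₗ Fin n)} {b j : ℕ} {u v : Fin n} :
    toLex (u, v) ∈ bothOrders A b j ↔ toLex (u, v) ∈ block A b j ∨ toLex (v, u) ∈ block A b j := by
  rw [bothOrders, mem_union, mem_image]
  refine or_congr_right ⟨?_, fun h => ⟨_, h, rfl⟩⟩
  rintro ⟨y, hy, e⟩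
  obtain ⟨u', v', rfl⟩ := exists_eq_pair y
  have e' := congrArg ofLex e
  simp only [swapPair, ofLex_toLex, Prod.mk.injEq] at e'
  obtain ⟨rfl, rfl⟩ := e'
  exact hy

theorem card_bothOrders_le {A : Finset (Fin n ×ₗ Fin n)} {b : ℕ} (hb : 0 < b) (j : ℕ) :
    (bothOrders A b j).card ≤ 2 * b := by
  have h1 := card_block A hb j
  have h2 : ((block A b j).image swapPair).card ≤ (block A b j).card := card_image_le
  exact (card_union_le _ _).trans (by omega)

theorem IsDistribution.disjoint_bothOrders (h : IsDistribution G S inp) {b : ℕ} :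
    Pairwise fun i j : Fin M => Disjoint (bothOrders (inputUnion inp) b i)
      (bothOrders (inputUnion inp) b j) := by
  intro i j hij
  have hd := disjoint_block (inputUnion inp) b (Fin.val_injective.ne hij)
  rw [disjoint_left]
  intro y hy hy'
  obtain ⟨u, v, rfl⟩ := exists_eq_pair y
  rcases mem_bothOrders.mp hy with h1 | h1 <;> rcases mem_bothOrders.mp hy' with h2 | h2
  · exact disjoint_left.mp hd h1 h2
  · exact h.not_mem_swap (block_subset _ _ _ h1) (block_subset _ _ _ h2)
  · exact h.not_mem_swap (block_subset _ _ _ h1) (block_subset _ _ _ h2)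
  · exact disjoint_left.mp hd h1 h2

theorem IsDistribution.biUnion_bothOrders (h : IsDistribution G S inp) {b : ℕ}
    (hH : (halfEdges G).card ≤ M * b) :
    univ.biUnion (fun j : Fin M => bothOrders (inputUnion inp) b j) = halfEdges G := by
  have hU := biUnion_block ((card_inputUnion_le h).trans hH)
  ext y
  obtain ⟨u, v, rfl⟩ := exists_eq_pair y
  simp only [mem_biUnion, mem_univ, true_and, mem_bothOrders, mem_halfEdges]
  constructor
  · rintro ⟨j, hj | hj⟩
    · exact h.adj (block_subset _ _ _ hj)
    · exact (h.adj (block_subset _ _ _ hj)).symm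
  · intro huv
    rcases h.mem_or_mem huv with h' | h'
    · rw [← hU] at h'
      obtain ⟨j, -, hj⟩ := mem_biUnion.mp h'
      exact ⟨j, Or.inl hj⟩
    · rw [← hU] at h'
      obtain ⟨j, -, hj⟩ := mem_biUnion.mp h'
      exact ⟨j, Or.inr hj⟩

/-- If the machines are large and numerous enough, then the edges can be distributed. -/
theorem exists_isDistribution {β : ℕ} (hβ : 0 < β) (hH : (halfEdges G).card ≤ M * β)
    (hS : 2 * β ≤ S) : ∃ inp : Fin M → List (Fin n × Fin n), IsDistribution G S inp := by
  classical
  let A : Finset (Fin n ×ₗ Fin n) := (halfEdges G).filter fun y => (ofLex y).1 < (ofLex y).2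
  have hA : A.card ≤ M * β := (card_le_card (filter_subset _ _)).trans hH
  have hmem : ∀ {u v}, toLex (u, v) ∈ A ↔ G.Adj u v ∧ u < v := by
    intro u v
    simp only [A, mem_filter, mem_halfEdges, ofLex_toLex]
  let inp : Fin M → List (Fin n × Fin n) := fun j => (block A β j).toList.map ofLex
  have hinp : ∀ j u v, (u, v) ∈ inp j ↔ toLex (u, v) ∈ block A β j := by
    intro j u v
    simp only [inp, List.mem_map, mem_toList]
    constructor
    · rintro ⟨y, hy, e⟩
      rw [← e]
      exact hy
    · exact fun h => ⟨_, h, rfl⟩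
  have hall : ∀ u v, (u, v) ∈ (List.finRange M).flatMap inp ↔ G.Adj u v ∧ u < v := by
    intro u v
    rw [← hmem, ← biUnion_block hA]
    simp [hinp]
  refine ⟨inp, ⟨?_, ?_, fun j => ?_⟩⟩
  · refine List.Nodup.map_on ?_ (List.nodup_flatMap.mpr ⟨fun j _ => ?_, ?_⟩)
    · rintro ⟨u, v⟩ h ⟨u', v'⟩ h' e
      rw [hall] at h h'
      rcases Sym2.eq_iff.mp e with ⟨h1, h2⟩ | ⟨h1, h2⟩
      · exact Prod.ext h1 h2
      · simp only at h1 h2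
        rw [h1, h2] at h
        exact absurd h.2 h'.2.not_gt
    · exact (nodup_toList _).map ofLex.injective
    · refine (List.nodup_finRange M).pairwise_of_forall_ne fun i _ j _ hij => ?_
      rintro ⟨u, v⟩ h h'
      rw [hinp] at h h'
      exact disjoint_left.mp (disjoint_block A β (Fin.val_injective.ne hij)) h h'
  · intro e
    induction e with
    | _ u v =>
    rw [allEdges, List.mem_map, SimpleGraph.mem_edgeSet]
    constructor
    · rintro ⟨⟨u', v'⟩, h, e⟩
      have h1 := ((hall u' v').mp h).1
      rcases Sym2.eq_iff.mp e with ⟨rfl, rfl⟩ | ⟨rfl, rfl⟩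
      · exact h1
      · exact h1.symm
    · intro h
      rcases lt_or_gt_of_ne h.ne with h' | h'
      · exact ⟨(u, v), (hall u v).mpr ⟨h, h'⟩, rfl⟩
      · exact ⟨(v, u), (hall v u).mpr ⟨h.symm, h'⟩, Sym2.eq_swap⟩
  · rw [length_encode, List.length_map, length_toList]
    have := card_block A hβ j
    omega

end Distribution

/-! ### The whole algorithm -/

/-- A program whose result determines a quantity can output this quantity. -/
theorem Reach.exists_output {M S W R : ℕ} [NeZero M] {Γ : Type*}
    {pre post : Γ → (Fin M → List ℕ) → Prop}
    (h : Reach S W pre post R) (val : Γ → ℕ)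
    (hval : ∀ γ γ' l l', post γ l → post γ' l' → l 0 = l' 0 → val γ = val γ') :
    ∃ P : Program M, ∀ γ l, pre γ l →
      P.Respects l S W R ∧ P.output (P.memory l R P.outputMachine) = val γ := by
  classical
  obtain ⟨P, hP⟩ := h
  let Q : Program M := ⟨P.step, 0, fun w =>
    if h : ∃ p : Γ × (Fin M → List ℕ), post p.1 p.2 ∧ p.2 0 = w then val h.choose.1 else 0⟩
  have hm : ∀ l t, Q.memory l t = P.memory l t := fun l t =>
    Program.memory_congr Q P l t (fun _ _ => rfl) t le_rfl
  refine ⟨Q, fun γ l hl => ?_⟩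
  obtain ⟨⟨h1, h2⟩, h3⟩ := hP γ l hl
  refine ⟨⟨fun t ht => by rw [hm]; exact h1 t ht, fun t ht => by rw [hm]; exact h2 t ht⟩, ?_⟩
  have hex : ∃ p : Γ × (Fin M → List ℕ), post p.1 p.2 ∧ p.2 0 = Q.memory l R 0 :=
    ⟨(γ, P.memory l R), h3, by rw [hm]⟩
  have e : Q.output (Q.memory l R Q.outputMachine) = val hex.choose.1 := dif_pos hex
  rw [e]
  exact hval _ _ _ _ hex.choose_spec.1 h3 (by rw [hex.choose_spec.2, hm])

namespace Setup

variable {n M S W b : ℕ} [NeZero M] (Q : Setup M S W b)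

/-- The given number of rounds suffices for any number of phases. -/
theorem leads_phases {Γ : Type*} {K k E α : ℕ} [NeZero K] (hk : 2 ≤ k) (hα : 0 < α)
    (hE : 48 * α ^ 2 * 4 ^ E ≤ b) (hMb : 64 * (n * α ^ 2) ≤ M * b)
    {G : Γ → SimpleGraph (Fin n)} (hG : ∀ γ, (G γ).arboricity ≤ α)
    (a : Γ → Fin M → Finset (Fin n ×ₗ Fin n))
    (hdisj : ∀ γ, Pairwise fun i j => Disjoint (a γ i) (a γ j))
    (hA : ∀ γ, univ.biUnion (a γ) = halfEdges (G γ)) (ha : ∀ γ j, (a γ j).card ≤ 2 * b)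
    (hK : ∀ γ, (G γ).numCliques k < K)
    (hn : 2 * n ^ 2 + K ≤ Q.D ^ Q.p) (hn' : 4 * n ^ 3 * Q.N ≤ Q.D ^ Q.p) (i : ℕ) :
    ∃ (a' : Γ → Fin M → Finset (Fin n ×ₗ Fin n)) (acc' : Γ → Fin M → ℕ),
      (∀ γ, Pairwise fun i j => Disjoint (a' γ i) (a' γ j)) ∧
      (∀ γ, univ.biUnion (a' γ) = halfEdges (peeled E α (G γ) i)) ∧
      (∀ γ j, (a' γ j).card ≤ 2 * b) ∧
      (∀ γ, (peeled E α (G γ) i).numCliques k + ∑ j, acc' γ j = (G γ).numCliques k) ∧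
      Leads S W (state K a fun _ _ => 0) (state K a' acc') (i * (5 * (Q.sortRounds + 2))) := by
  have hb := Q.b_pos
  induction i with
  | zero =>
    refine ⟨a, fun _ _ => 0, hdisj, hA, ha, fun γ => by simp [peeled], ?_⟩
    rw [zero_mul]
    refine Leads.refl (fun γ j => ?_) (Q.le_W_of_le ?_)
    · have h1 := ha γ j
      have h2 := Q.le_S
      simp only [state, Multiset.card_disjSum, card_val, Multiset.card_singleton]
      omega
    · simp only [Fintype.card_sum, Fintype.card_lex, Fintype.card_prod, Fintype.card_fin]
      nlinarith
  | succ i ih =>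
    obtain ⟨a', acc', h1, h2, h3, h4, h5⟩ := ih
    have hd : 0 < threshold E α i := Nat.mul_pos hα (by positivity)
    -- Three classes of pair items times the 16 of `threshold_sq_le` give the constant 48.
    have hdb : 3 * threshold E α i ^ 2 ≤ b := by
      have := threshold_sq_le E α i
      nlinarith
    have hα2 : n * α ≤ n * α ^ 2 := Nat.mul_le_mul_left _ (by nlinarith)
    have hHn : ∀ γ, (halfEdges (peeled E α (G γ) i)).card ≤ 2 * (n * α ^ 2) := by
      intro γ
      have h := card_halfEdges_le (hG γ) (peeled_le E α (G γ) i) (U := univ)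
        fun _ _ _ => mem_univ _
      rw [card_fin] at h
      nlinarith
    have hF : ∀ γ, (fwdEdges (peeled E α (G γ) i) (threshold E α i)).card ≤
        M * (b / threshold E α i) := by
      intro γ
      obtain ⟨U, hU, hc⟩ := exists_support hα (hG γ) (E := E) i
      have hc' := card_mul_threshold_sq_le (α := α) hc
      refine (card_fwdEdges_le hU).trans ?_
      set d := threshold E α i
      -- Rounding in `b / d` loses at most a factor 2, which the constant 64 in `hMb` covers, as
      -- only 16 is needed.
      have hlt : b < d * (b / d) + d := by
        have h6 := Nat.div_add_mod b d
        have h7 := Nat.mod_lt b hd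
        omega
      have hle : d ≤ d * (b / d) :=
        Nat.le_mul_of_pos_right _ (Nat.div_pos (by nlinarith) hd)
      have h8 : M * b ≤ M * (2 * (d * (b / d))) := Nat.mul_le_mul_left _ (by omega)
      have h9 : d * (U.card * d) ≤ d * (M * (b / d)) := by
        have e1 : d * (U.card * d) = U.card * d ^ 2 := by ring
        have e2 : M * (2 * (d * (b / d))) = 2 * (d * (M * (b / d))) := by ring
        omega
      exact Nat.le_of_mul_le_mul_left h9 hd
    -- At most 2nα² edge items and 3·16·nα² pair items, together 50nα².
    have hQ : ∀ γ, (queries (peeled E α (G γ) i) (threshold E α i)).card ≤ M * b := by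
      intro γ
      obtain ⟨U, hU, hc⟩ := exists_support hα (hG γ) (E := E) i
      have hc' := card_mul_threshold_sq_le (α := α) hc
      refine (card_queries_le hU).trans ?_
      have h6 := hHn γ
      set d := threshold E α i
      have e1 : U.card * d * (3 * d) = 3 * (U.card * d ^ 2) := by ring
      omega
    obtain ⟨a'', acc'', g1, g2, g3, g4, g5⟩ := Q.leads_phase (G := fun γ => peeled E α (G γ) i)
      (K := K) hk hd hdb (fun γ => (hHn γ).trans (by omega)) hF hQ a' h1 h2
      h3 acc' (fun γ => by rw [h4]; exact hK γ) hn hn'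
    refine ⟨a'', acc'', g1, g2, g3, fun γ => (g4 γ).trans (h4 γ), ?_⟩
    rw [add_mul, one_mul]
    exact h5.trans g5

/-- The number of rounds of the whole algorithm with `I` phases. -/
def totalRounds (I : ℕ) : ℕ :=
  1 + ((Q.sortRounds + 2) + (I * (5 * (Q.sortRounds + 2)) + (1 + Q.T * 2)))

/-- The cliques are counted after sufficiently many phases. -/
theorem exists_program {k E α I : ℕ} (hS : S = 16 * b) (hk : 2 ≤ k) (hα : 0 < α)
    (hE : 48 * α ^ 2 * 4 ^ E ≤ b) (hMb : 64 * (n * α ^ 2) ≤ M * b) (hI : n < 2 ^ gain E I)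
    (hn : 2 * n ^ 2 + (n ^ k + 1) ≤ Q.D ^ Q.p) (hn' : 4 * n ^ 3 * Q.N ≤ Q.D ^ Q.p)
    (hW : n ^ 2 + 3 * (n ^ k + 1) ≤ W) :
    ∃ P : Program M, ∀ G : SimpleGraph (Fin n), G.arboricity ≤ α →
      CountsCliques P k G S W (Q.totalRounds I) := by
  have hb := Q.b_pos
  have hn2 : n ^ 2 = n * n := sq n
  let K := n ^ k + 1
  have : NeZero K := ⟨Nat.succ_ne_zero _⟩
  -- The inputs are pairs of a graph and a distribution of its edges, so a single program serves all
  -- of them.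
  let Γ := {q : SimpleGraph (Fin n) × (Fin M → List (Fin n × Fin n)) //
    q.1.arboricity ≤ α ∧ IsDistribution q.1 S q.2}
  let G : Γ → SimpleGraph (Fin n) := fun γ => γ.1.1
  let inp : Γ → Fin M → List (Fin n × Fin n) := fun γ => γ.1.2
  have hG : ∀ γ, (G γ).arboricity ≤ α := fun γ => γ.2.1
  have hinp : ∀ γ, IsDistribution (G γ) S (inp γ) := fun γ => γ.2.2
  have hα2 : n * α ≤ n * α ^ 2 := Nat.mul_le_mul_left _ (by nlinarith)
  have hH' : ∀ G : SimpleGraph (Fin n), G.arboricity ≤ α → (halfEdges G).card ≤ M * b := by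
    intro G hG
    have h := card_halfEdges_le hG le_rfl (U := univ) fun _ _ _ => mem_univ _
    rw [card_fin] at h
    nlinarith
  have hH : ∀ γ, (halfEdges (G γ)).card ≤ M * b := fun γ => hH' _ (hG γ)
  have hlen : ∀ γ j, (inputSet (inp γ) j).card ≤ 8 * b := by
    intro γ j
    have h1 := (hinp γ).fits j
    rw [length_encode] at h1
    have h2 := card_inputSet_le (inp := inp γ) j
    omega
  have hpair : Fintype.card (Fin n ×ₗ Fin n) ≤ Q.D ^ Q.p := by
    simp only [Fintype.card_lex, Fintype.card_prod, Fintype.card_fin]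
    omega
  have hKD : Fintype.card (Fin K) ≤ Q.D ^ Q.p := by
    rw [Fintype.card_fin]
    simp only [K]
    omega
  have hst : Fintype.card ((Fin n ×ₗ Fin n) ⊕ Fin K) ≤ 2 * Q.D ^ Q.p := by
    rw [Fintype.card_sum]
    omega
  have hKc : ∀ γ, (G γ).numCliques k < K := fun γ => Nat.lt_succ_of_le (numCliques_le _ _)
  -- The input is read.
  have hstart : Reach S W (fun γ l => l = fun j => encode (inp γ j))
      (fun γ => Holds fun j => (inputSet (inp γ) j).val.disjSum (0 : Multiset (Fin K))) 1 := by
    have h := Reach.step (S := S) (W := W) (Γ := Γ) (M := M) (pre := fun γ l => l = fun j => encode (inp γ j))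
      (fun γ i j => if i = j then (inputSet (inp γ) i).val.disjSum (0 : Multiset (Fin K)) else 0)
      ?_ ?_ (Q.le_W_of_le hst) ?_ ?_
    · simpa using h
    · rintro γ γ' _ _ i rfl rfl h
      have h1 : inp γ i = inp γ' i := encode_injective h
      funext j
      simp only [inputSet, h1]
    · rintro γ _ rfl i
      refine ⟨(hinp γ).fits i, fun x hx => (lt_of_mem_encode hx).trans_le ?_⟩
      exact (Nat.le_self_pow two_ne_zero n).trans (by omega)
    · intro γ i
      have h1 := hlen γ i
      rw [sum_eq_single i (fun j _ hj => by simp [hj.symm]) (by simp)]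
      simp only [if_true, Multiset.card_disjSum, card_val, Multiset.card_zero]
      omega
    · intro γ j
      have h1 := hlen γ j
      rw [sum_eq_single j (fun i _ hi => by simp [hi]) (by simp)]
      simp only [if_true, Multiset.card_disjSum, card_val, Multiset.card_zero]
      omega
  -- The edges are spread evenly, in both orders.
  have hspread : Leads S W
      (fun γ j => (inputSet (inp γ) j).val.disjSum (0 : Multiset (Fin K)))
      (state K (fun γ (j : Fin M) => bothOrders (inputUnion (inp γ)) b j) fun _ _ => 0)
      (Q.sortRounds + 2) := by
    refine Q.leads_sort_map hb le_rfl (fun γ j => inputSet (inp γ) j) (fun _ _ => 0)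
      (fun γ => inputUnion (inp γ)) _ (fun γ => (hinp γ).disjoint) (fun γ => rfl)
      (fun γ => (card_inputUnion_le (hinp γ)).trans (hH γ)) ?_ ?_ ?_ ?_ hpair hKD hst
    · intro γ γ' j hw _
      rw [state, state, bothOrders, bothOrders, block_eq_of_window hw]
    · intro γ j
      have := hlen γ j
      simp only [Multiset.card_zero]
      omega
    · simp
    · intro γ j
      have := card_bothOrders_le (A := inputUnion (inp γ)) hb j
      simp only [state, Multiset.card_disjSum, card_val, Multiset.card_singleton]
      omega
  obtain ⟨a', acc, -, -, h3, h4, h5⟩ := Q.leads_phases (K := K) hk hα hE hMb hG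
    (fun γ (j : Fin M) => bothOrders (inputUnion (inp γ)) b j)
    (fun γ => (hinp γ).disjoint_bothOrders) (fun γ => (hinp γ).biUnion_bothOrders (hH γ))
    (fun γ j => card_bothOrders_le hb j) hKc hn hn' I
  have hsum : ∀ γ, ∑ j, acc γ j = (G γ).numCliques k := by
    intro γ
    obtain ⟨U, hU, hc⟩ := exists_support hα (hG γ) (E := E) I
    -- A nonempty support would have at least one vertex, but `2 ^ gain E I` exceeds `n`. So no
    -- edges are left, and all cliques have been counted.
    have hU0 : U = ∅ := by
      rw [← card_eq_zero]
      by_contra hne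
      have := Nat.le_mul_of_pos_left (2 ^ gain E I) (Nat.pos_of_ne_zero hne)
      omega
    rw [← h4 γ, numCliques_eq_zero hk (hU0 ▸ hU), zero_add]
  have haccK : ∀ γ j, acc γ j < K := fun γ j =>
    (single_le_sum (fun _ _ => Nat.zero_le _) (mem_univ j)).trans_lt ((hsum γ).trans_lt (hKc γ))
  -- The counts are added up.
  have hscan : Leads S W (state K a' acc) (fun γ j => withVecs K (state K a' acc γ j)
      (fun _ : Fin 1 => ∑ i, acc γ i) (fun _ => ∑ i, if i < j then acc γ i else 0))
      (1 + Q.T * 2) := by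
    refine Leads.scan (D := 1) (L := 3 * b) Q.f_pos Q.M_eq (state K a' acc)
      (fun γ i _ => acc γ i) ?_ ?_ ?_ ?_ ?_
    · intro γ γ' i h
      have h6 := congrArg Fin.val (Multiset.singleton_inj.mp (disjSum_injective h).2)
      funext _
      simpa [Fin.ofNat, Nat.mod_eq_of_lt (haccK γ i), Nat.mod_eq_of_lt (haccK γ' i)] using h6
    · intro γ _
      rw [hsum]
      exact hKc γ
    · intro γ j
      have := h3 γ j
      simp only [state, Multiset.card_disjSum, card_val, Multiset.card_singleton]
      omega
    · have h6 : Q.f ≤ Q.f * Q.D := Nat.le_mul_of_pos_right _ Q.D_pos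
      have h7 := Q.fD_le
      omega
    · simp only [Fintype.card_sum, Fintype.card_lex, Fintype.card_prod, Fintype.card_fin]
      simp only [K]
      omega
  have hreach := hstart.trans (hspread.trans (h5.trans hscan))
  obtain ⟨P, hP⟩ := hreach.exists_output (fun γ => (G γ).numCliques k) (by
    intro γ γ' l l' h h' e
    have h6 := (disjSum_injective (disjSum_injective (h.injective h' e)).2).1
    have h7 := congrArg (vecSum (0 : Fin 1)) h6
    rw [vecSum_vecWords (by rw [hsum]; exact hKc γ), vecSum_vecWords (by rw [hsum]; exact hKc γ'),
      hsum, hsum] at h7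
    exact h7)
  refine ⟨P, fun G₀ hG₀ => ⟨exists_isDistribution hb (hH' G₀ hG₀) (by omega), fun inp₀ hinp₀ => ?_⟩⟩
  exact hP ⟨(G₀, inp₀), hG₀, hinp₀⟩ _ rfl

end Setup

end MPC

/-! ### Growth of the gain, and cliques with at most one vertex -/

namespace MPC

section Growth

/-- Before the cap matters, a phase multiplies the gain by about 3/2, so two phases at least double
the gain plus one. -/
theorem min_le_gain (E j : ℕ) : min (2 ^ j) (E + 1) ≤ gain E (2 * j) + 1 := by
  induction j with
  | zero => simp [gain]
  | succ j ih =>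
    have h : 2 * (j + 1) = 2 * j + 1 + 1 := by ring
    rw [h, gain, gain, pow_succ]
    omega

/-- After the doubling stage the gain is at least `E`, so the increment is at least `E / 2 + 1` in
every further phase. -/
theorem le_gain (E i : ℕ) : i * (E / 2 + 1) ≤ gain E (2 * Nat.clog 2 (E + 1) + i) := by
  have h0 : E ≤ gain E (2 * Nat.clog 2 (E + 1)) := by
    have h1 := min_le_gain E (Nat.clog 2 (E + 1))
    have h2 := Nat.le_pow_clog one_lt_two (E + 1)
    omega
  suffices h : E + i * (E / 2 + 1) ≤ gain E (2 * Nat.clog 2 (E + 1) + i) by omega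
  induction i with
  | zero => simpa using h0
  | succ i ih =>
    rw [← add_assoc, gain, add_mul]
    generalize i * (E / 2 + 1) = m at ih ⊢
    omega

end Growth

section FewVertices

variable {n M : ℕ}

/-- The number of cliques with at most one vertex does not depend on the graph. -/
theorem exists_program_of_le_one [NeZero M] {k α β S W : ℕ} (hk : k ≤ 1) (hβ : 0 < β)
    (hS : 2 * β ≤ S) (hM : 2 * (n * α) ≤ M * β) (hW : n ≤ W) :
    ∃ P : Program M, ∀ G : SimpleGraph (Fin n), G.arboricity ≤ α → CountsCliques P k G S W 0 := by
  have hnum : ∀ G : SimpleGraph (Fin n), G.numCliques k = if k = 0 then 1 else n := by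
    intro G
    interval_cases k
    · simp [SimpleGraph.numCliques]
    · have h : {s : Finset (Fin n) | G.IsNClique 1 s} = Set.range fun v => {v} := by
        ext s; simp [SimpleGraph.isNClique_one, eq_comm]
      rw [SimpleGraph.numCliques, h, Set.ncard_range_of_injective Finset.singleton_injective]
      simp
  refine ⟨⟨fun _ _ l => (l, []), 0, fun _ => if k = 0 then 1 else n⟩, fun G hG =>
    ⟨exists_isDistribution hβ ?_ hS, fun inp hinp => ⟨⟨fun t ht i => ?_, fun t ht => ?_⟩, ?_⟩⟩⟩
  · have h := card_halfEdges_le hG le_rfl (U := Finset.univ) fun _ _ _ => Finset.mem_univ _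
    rw [Finset.card_fin] at h
    nlinarith
  · obtain rfl := Nat.le_zero.1 ht
    exact ⟨hinp.fits i, fun x hx => (lt_of_mem_encode hx).trans_le hW⟩
  · exact absurd ht (Nat.not_lt_zero _)
  · exact (hnum G).symm

end FewVertices

end MPC

/-! ### Choice of the parameters -/

namespace MPC

set_option maxHeartbeats 1000000 in
/-- Parameters for the given number `n` of vertices and the given bound `α` on the arboricity. -/
theorem exists_setup {δ : ℝ} (hδ₀ : 0 < δ) (hδ₁ : δ < 1) (k : ℕ) {T p C n α : ℕ}
    (hT : 4 / δ ≤ T) (hp : p = T * (k + 8)) (hC : 2 * p + 7 ≤ C)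
    (hn : 128 * 2 ^ T + 8 ≤ n) (hα : 1 ≤ α) (hαn : (α : ℝ) ^ 2 ≤ (n : ℝ) ^ δ) :
    ∃ (M b : ℕ) (Q : Setup M (16 * b) (n ^ C) b), Q.T = T ∧ Q.p = p ∧
      48 * (n : ℝ) ^ δ ≤ b ∧ 64 * (n * α ^ 2) ≤ M * b ∧
      2 * n ^ 2 + (n ^ k + 1) ≤ Q.D ^ Q.p ∧ 4 * n ^ 3 * Q.N ≤ Q.D ^ Q.p ∧
      n ^ 2 + 3 * (n ^ k + 1) ≤ n ^ C ∧
      ((16 * b : ℕ) : ℝ) ≤ 2048 * 2 ^ T * (n : ℝ) ^ δ ∧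
      M * (16 * b) ≤ 2048 * 2 ^ T * (n * α ^ 2) := by
  have hn8 : 8 ≤ n := by omega
  have hn1 : (1 : ℝ) ≤ n := by exact_mod_cast (by omega : 1 ≤ n)
  have hn0 : (0 : ℝ) < n := by linarith
  have hT0 : 0 < T := by
    have : (0 : ℝ) < T := (by positivity : 0 < 4 / δ).trans_le hT
    exact_mod_cast this
  -- Powers of the number of vertices.
  set z : ℝ := (n : ℝ) ^ δ with hz
  -- The scale of both fan-out and base: f·D is then at most 2x² = 2n^(δ/2), well below the block
  -- size, while `T ≥ 4 / δ` gives x^T ≥ n.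
  set x : ℝ := (n : ℝ) ^ (δ / 4) with hx
  have hx1 : 1 ≤ x := Real.one_le_rpow hn1 (by positivity)
  have hxz : x ^ 4 = z := by
    rw [hx, hz, ← Real.rpow_natCast, ← Real.rpow_mul hn0.le]
    congr 1
    push_cast
    ring
  have hz1 : 1 ≤ z := Real.one_le_rpow hn1 hδ₀.le
  have hzn : z ≤ n := by
    conv_rhs => rw [← Real.rpow_one (n : ℝ)]
    exact Real.rpow_le_rpow_of_exponent_le hn1 hδ₁.le
  have hx2 : x ≤ x ^ 2 := by nlinarith
  have hx2z : x ^ 2 ≤ z := by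
    rw [← hxz]
    exact pow_le_pow_right₀ hx1 (by norm_num)
  have hxT : (n : ℝ) ≤ x ^ T := by
    rw [hx, ← Real.rpow_natCast, ← Real.rpow_mul hn0.le]
    conv_lhs => rw [← Real.rpow_one (n : ℝ)]
    refine Real.rpow_le_rpow_of_exponent_le hn1 ?_
    rw [div_le_iff₀ hδ₀] at hT
    linarith
  -- The fan-out.
  have hα1 : (1 : ℝ) ≤ (α : ℝ) ^ 2 := one_le_pow₀ (by exact_mod_cast hα)
  -- The desired number of machines, up to constants. As `M` has to be a `T`-th power, its `T`-th
  -- root is rounded down.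
  set r : ℝ := n * (α : ℝ) ^ 2 / z with hr
  have hr1 : 1 ≤ r := by
    rw [hr, le_div_iff₀ (by linarith)]
    nlinarith
  have hrz : r * z = n * (α : ℝ) ^ 2 := div_mul_cancel₀ _ (by linarith)
  have hrn : r ≤ n := by
    rw [hr, div_le_iff₀ (by linarith)]
    exact mul_le_mul_of_nonneg_left hαn hn0.le
  set y : ℝ := r ^ ((T : ℝ)⁻¹) with hy
  have hyT : y ^ T = r := Real.rpow_inv_natCast_pow (by linarith) hT0.ne'
  have hy1 : 1 ≤ y := Real.one_le_rpow hr1 (by positivity)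
  have hyx : y ≤ x := le_of_pow_le_pow_left₀ hT0.ne' (by linarith)
    (hyT.le.trans (hrn.trans hxT))
  set f := ⌊y⌋₊ with hf
  have hf1 : 1 ≤ f := Nat.le_floor (by simpa using hy1)
  have hfy : (f : ℝ) ≤ y := Nat.floor_le (by linarith)
  have hyf : y ≤ 2 * f := by
    have h1 := Nat.lt_floor_add_one y
    have h2 : (1 : ℝ) ≤ f := by exact_mod_cast hf1
    linarith
  have hfr : (f : ℝ) ^ T ≤ r := hyT ▸ pow_le_pow_left₀ (by positivity) hfy T
  have hrf : r ≤ 2 ^ T * (f : ℝ) ^ T := by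
    rw [← mul_pow, ← hyT]
    exact pow_le_pow_left₀ (by linarith) hyf T
  -- The block size and the base.
  set c := ⌈z⌉₊ with hc
  have hzc : z ≤ c := Nat.le_ceil z
  have hcz : (c : ℝ) ≤ 2 * z := by
    have := Nat.ceil_lt_add_one (show 0 ≤ z by linarith)
    linarith
  set D := ⌈x⌉₊ with hD
  have hxD : x ≤ D := Nat.le_ceil x
  have hDx : (D : ℝ) ≤ 2 * x := by
    have := Nat.ceil_lt_add_one (show 0 ≤ x by linarith)
    linarith
  -- Rounding the root down halves it at most, so `M` may be too small by a factor 2^T; longer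
  -- blocks compensate for this.
  set L := 64 * 2 ^ T with hL
  have hL1 : 64 ≤ L := Nat.le_mul_of_pos_right _ (by positivity)
  have hLr : (L : ℝ) = 64 * 2 ^ T := by simp [hL]
  have hMb : 64 * (n * α ^ 2) ≤ f ^ T * (L * c) := by
    have h : (64 : ℝ) * (n * α ^ 2) ≤ f ^ T * (L * c) := by
      rw [hLr, ← hrz]
      calc 64 * (r * z) ≤ 64 * (2 ^ T * (f : ℝ) ^ T * c) := by gcongr
        _ = _ := by ring
    exact_mod_cast h
  have hMb' : f ^ T * (L * c) ≤ 2 * L * (n * α ^ 2) := by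
    have h : (f : ℝ) ^ T * (L * c) ≤ 2 * L * (n * α ^ 2) := by
      rw [← hrz]
      calc (f : ℝ) ^ T * (L * c) ≤ r * (L * (2 * z)) := by gcongr
        _ = _ := by ring
    exact_mod_cast h
  have hα2 : α ^ 2 ≤ n := by exact_mod_cast hαn.trans hzn
  have hN : f ^ T * (L * c) + 1 ≤ n ^ 3 := by
    have h1 : 2 * L * (n * α ^ 2) ≤ 2 * L * (n * n) := by gcongr
    have h2 : (2 * L + 1) * (n * n) ≤ n * (n * n) := Nat.mul_le_mul_right _ (by omega)
    have h3 : 1 ≤ n * n := Nat.one_le_iff_ne_zero.2 (by positivity)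
    have h4 : n ^ 3 = n * (n * n) := by ring
    rw [add_mul] at h2
    omega
  -- Each group of `T` digits covers a factor `n`. The power `n ^ (k + 8)` leaves room for the
  -- clique counts and for the answers, of which there are at most 4n³·N ≤ n⁷ possible ones.
  have hDp : n ^ (k + 8) ≤ D ^ p := by
    have h : (n : ℝ) ^ (k + 8) ≤ (D : ℝ) ^ p := by
      rw [hp, pow_mul]
      exact pow_le_pow_left₀ hn0.le (hxT.trans (pow_le_pow_left₀ (by linarith) hxD T)) _
    exact_mod_cast h
  have hDn : D ≤ n ^ 2 := by
    have h : (D : ℝ) ≤ 2 * n := hDx.trans (by linarith)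
    have h' : D ≤ 2 * n := by exact_mod_cast h
    nlinarith
  have hpp : ∀ {i j}, i ≤ j → n ^ i ≤ n ^ j := fun h => Nat.pow_le_pow_right (by omega) h
  have hpk : k + 8 ≤ p := hp ▸ Nat.le_mul_of_pos_left _ hT0
  have hfD : f * D ≤ L * c := by
    have h : (f : ℝ) * D ≤ L * c := by
      have hL2 : (2 : ℝ) ≤ L := by exact_mod_cast (by omega : 2 ≤ L)
      calc (f : ℝ) * D ≤ x * (2 * x) := mul_le_mul (hfy.trans hyx) hDx (by positivity)
            (by linarith)
        _ = 2 * x ^ 2 := by ring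
        _ ≤ L * c := mul_le_mul hL2 (hx2z.trans hzc) (by positivity) (by positivity)
    exact_mod_cast h
  have hc0 : 0 < c := by
    have : (0 : ℝ) < c := by linarith
    exact_mod_cast this
  have hD0 : 0 < D := by
    have : (0 : ℝ) < D := by linarith
    exact_mod_cast this
  have hW : (f ^ T * (L * c) + 1 + 2) * D ^ p + 2 * (D * (f ^ T * (L * c) + 1)) ≤ n ^ C := by
    have h1 : D ^ p ≤ n ^ (2 * p) := by
      rw [pow_mul]
      exact Nat.pow_le_pow_left hDn p
    have h2 : (f ^ T * (L * c) + 1 + 2) * D ^ p ≤ (n ^ 3 + 2) * n ^ (2 * p) :=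
      Nat.mul_le_mul (by omega) h1
    have h3 : D * (f ^ T * (L * c) + 1) ≤ n ^ 2 * n ^ 3 := Nat.mul_le_mul hDn hN
    have h4 : n ^ 2 * n ^ 3 ≤ n ^ (2 * p + 6) := by
      rw [← pow_add]
      exact hpp (by omega)
    have h5 : (n ^ 3 + 2) * n ^ (2 * p) ≤ n ^ (2 * p + 6) := by
      rw [pow_add, mul_comm]
      refine Nat.mul_le_mul_left _ ?_
      have e1 : n ^ 6 = n ^ 3 * n ^ 3 := by ring
      have e2 : 8 ^ 3 ≤ n ^ 3 := Nat.pow_le_pow_left hn8 3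
      nlinarith
    have h6 : 8 * n ^ (2 * p + 6) ≤ n ^ C := by
      calc 8 * n ^ (2 * p + 6) ≤ n * n ^ (2 * p + 6) := Nat.mul_le_mul_right _ hn8
        _ = n ^ (2 * p + 7) := by ring
        _ ≤ n ^ C := hpp hC
    omega
  have hk1 : 1 ≤ n ^ k := Nat.one_le_iff_ne_zero.2 (by positivity)
  have hk2 : n ^ k ≤ n ^ (k + 7) := hpp (by omega)
  have hk3 : n ^ 2 ≤ n ^ (k + 7) := hpp (by omega)
  have hk4 : 8 * n ^ (k + 7) ≤ n ^ (k + 8) := by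
    rw [pow_succ n (k + 7), mul_comm]
    exact Nat.mul_le_mul_left _ hn8
  refine ⟨f ^ T, L * c, ⟨f, T, D, p, f ^ T * (L * c) + 1, hf1, rfl, by omega, hD0,
    Nat.mul_pos (by omega) hc0, hfD, le_rfl, Nat.lt_succ_self _, hW⟩, rfl, rfl, ?_, hMb, ?_, ?_,
    ?_, ?_, ?_⟩
  · have hL2 : (48 : ℝ) ≤ L := by exact_mod_cast (by omega : 48 ≤ L)
    push_cast
    gcongr
  · change _ ≤ D ^ p
    omega
  · change 4 * n ^ 3 * (f ^ T * (L * c) + 1) ≤ D ^ p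
    refine le_trans ?_ hDp
    calc 4 * n ^ 3 * (f ^ T * (L * c) + 1) ≤ n * n ^ 3 * n ^ 3 := by gcongr; omega
      _ = n ^ 7 := by ring
      _ ≤ n ^ (k + 8) := hpp (by omega)
  · have := hpp (show k + 8 ≤ C by omega)
    omega
  · push_cast
    rw [hLr]
    calc 16 * (64 * 2 ^ T * (c : ℝ)) ≤ 16 * (64 * 2 ^ T * (2 * z)) := by gcongr
      _ = _ := by ring
  · calc f ^ T * (16 * (L * c)) = 16 * (f ^ T * (L * c)) := by ring
      _ ≤ 16 * (2 * L * (n * α ^ 2)) := Nat.mul_le_mul_left _ hMb'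
      _ = _ := by rw [hL]; ring

end MPC

/-! ### Asymptotics and the final assembly -/

namespace MPC

open Filter in
theorem eventually_large {η : ℝ} (hη : 0 < η) (B Z : ℝ) (m : ℕ) :
    ∃ n₀ : ℕ, ∀ n, n₀ ≤ n → m ≤ n ∧ B ≤ (n : ℝ) ^ η ∧ 2 ≤ Real.log n ∧
      Z ≤ Real.log (Real.log n) := by
  have hlog : Tendsto (fun n : ℕ => Real.log n) atTop atTop :=
    Real.tendsto_log_atTop.comp tendsto_natCast_atTop_atTop
  rw [← eventually_atTop]
  filter_upwards [eventually_ge_atTop m,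
    ((tendsto_rpow_atTop hη).comp tendsto_natCast_atTop_atTop).eventually_ge_atTop B,
    hlog.eventually_ge_atTop 2, (Real.tendsto_log_atTop.comp hlog).eventually_ge_atTop Z]
    with n h1 h2 h3 h4
  exact ⟨h1, h2, h3, h4⟩

/-- Sufficiently many phases for `n` vertices. -/
theorem lt_two_pow_gain {η : ℝ} (hη : 0 < η) {n E J : ℕ} (hn : 1 ≤ Real.log n)
    (hE : η / 2 * Real.log n < E + 1) (hJ : 8 / η ≤ J) :
    n < 2 ^ gain E (2 * Nat.clog 2 (E + 1) + J) := by
  refine lt_of_lt_of_le ?_ (Nat.pow_le_pow_right two_pos (le_gain E J))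
  have hn0 : (0 : ℝ) < n := by
    rcases Nat.eq_zero_or_pos n with rfl | h
    · norm_num at hn
    · exact_mod_cast h
  have h1 : (E + 1 : ℝ) ≤ 2 * ((E / 2 + 1 : ℕ) : ℝ) := by
    exact_mod_cast (by omega : E + 1 ≤ 2 * (E / 2 + 1))
  have h2 : 8 ≤ J * η := (div_le_iff₀ hη).1 hJ
  have h3 : 8 * Real.log n ≤ J * η * Real.log n := by gcongr
  have h4 : (J : ℝ) * (η * Real.log n) ≤ J * (4 * ((E / 2 + 1 : ℕ) : ℝ)) :=
    mul_le_mul_of_nonneg_left (by linarith) (by positivity)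
  have h5 : Real.log n < (J * (E / 2 + 1) : ℕ) * Real.log 2 := by
    have := Real.log_two_gt_d9
    push_cast at h4 ⊢
    nlinarith
  have h6 : (n : ℝ) < 2 ^ (J * (E / 2 + 1)) := (Real.lt_pow_iff_log_lt hn0 two_pos).2 h5
  exact_mod_cast h6

theorem clog_le {L : ℝ} {E : ℕ} (hL : 1 ≤ L) (hE : E + 1 ≤ L) :
    (Nat.clog 2 (E + 1) : ℝ) ≤ 2 * Real.log L + 1 := by
  have h0 : 0 ≤ Real.log L := Real.log_nonneg hL
  refine le_trans ?_ (Nat.ceil_lt_add_one (by positivity : 0 ≤ 2 * Real.log L)).le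
  have h1 : Real.log L ≤ ⌈2 * Real.log L⌉₊ * Real.log 2 := by
    have := Real.log_two_gt_d9
    have := Nat.le_ceil (2 * Real.log L)
    nlinarith
  have h2 : (E + 1 : ℝ) ≤ 2 ^ ⌈2 * Real.log L⌉₊ :=
    hE.trans ((Real.le_pow_iff_log_le (by linarith) two_pos).2 h1)
  exact_mod_cast Nat.clog_le_of_le_pow (by exact_mod_cast h2)

/-- The thresholds stay small. -/
theorem sq_mul_four_pow_le {δ δ' B : ℝ} {n α E : ℕ} (hn : 0 < n)
    (hB : B ^ 2 ≤ (n : ℝ) ^ ((δ - δ') / 2)) (hα : (α : ℝ) ≤ B * (n : ℝ) ^ (δ' / 2))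
    (hE : 2 * E ≤ (δ - δ') / 2 * Real.log n) : (α : ℝ) ^ 2 * 4 ^ E ≤ (n : ℝ) ^ δ := by
  have hn0 : (0 : ℝ) < n := by exact_mod_cast hn
  have h1 : (α : ℝ) ^ 2 ≤ (n : ℝ) ^ ((δ - δ') / 2) * (n : ℝ) ^ δ' := by
    calc (α : ℝ) ^ 2 ≤ (B * (n : ℝ) ^ (δ' / 2)) ^ 2 := by gcongr
      _ = B ^ 2 * (n : ℝ) ^ δ' := by
        rw [mul_pow, ← Real.rpow_natCast (_ ^ (δ' / 2)), ← Real.rpow_mul hn0.le]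
        norm_num
      _ ≤ _ := by gcongr
  have h2 : (4 : ℝ) ^ E ≤ (n : ℝ) ^ ((δ - δ') / 2) := by
    have h := Real.add_one_le_exp 1
    calc (4 : ℝ) ^ E = (1 + 1) ^ (2 * E) := by rw [pow_mul]; norm_num
      _ ≤ Real.exp 1 ^ (2 * E) := by gcongr
      _ = Real.exp (2 * E) := by rw [← Real.exp_nat_mul]; simp
      _ ≤ Real.exp (Real.log n * ((δ - δ') / 2)) := Real.exp_le_exp.2 (by linarith)
      _ = _ := (Real.rpow_def_of_pos hn0 _).symm
  calc (α : ℝ) ^ 2 * 4 ^ E ≤ (n : ℝ) ^ ((δ - δ') / 2) * (n : ℝ) ^ δ' * (n : ℝ) ^ ((δ - δ') / 2) :=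
        by gcongr
    _ = _ := by
      rw [← Real.rpow_add hn0, ← Real.rpow_add hn0]
      ring_nf

end MPC

theorem mainTheorem5 (k : ℕ) (δ : ℝ) (hδ₀ : 0 < δ) (hδ₁ : δ < 1) :
    ∃ C : ℕ, ∀ δ' B : ℝ, δ' < δ → ∃ n₀ : ℕ, ∀ n α : ℕ, n₀ ≤ n → 1 ≤ α →
      (α : ℝ) ≤ B * (n : ℝ) ^ (δ' / 2) →
      ∃ (M S R : ℕ) (P : MPC.Program M),
        (S : ℝ) ≤ C * (n : ℝ) ^ δ ∧
        M * S ≤ C * (n * α ^ 2) ∧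
        (R : ℝ) ≤ C * Real.log (Real.log n) ∧
        ∀ G : SimpleGraph (Fin n), G.arboricity ≤ α →
          MPC.CountsCliques P k G S (n ^ C) R := by
  obtain ⟨T, hT⟩ := exists_nat_ge (4 / δ)
  obtain ⟨p, hp⟩ : ∃ p, p = T * (k + 8) := ⟨_, rfl⟩
  obtain ⟨A, hA⟩ : ∃ A, A = p * (1 + T * 2 + 1) + 2 := ⟨_, rfl⟩
  -- The summands serve the word size, the space bounds and the number of rounds. All of them depend
  -- on `k` and `δ` only.
  obtain ⟨C, hC⟩ : ∃ C, C = 2 * p + 7 + 2048 * 2 ^ T + (20 * A + 1) := ⟨_, rfl⟩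
  refine ⟨C, fun δ' B hδ' => ?_⟩
  -- Negative exponents are replaced by zero, so that η < 1/2 and `E + 1` stays below log n.
  set δ₁ := max δ' 0 with hδ₁'
  have hlt : δ₁ < δ := max_lt hδ' hδ₀
  have hle : δ' ≤ δ₁ := le_max_left _ _
  have h0le : 0 ≤ δ₁ := le_max_right _ _
  obtain ⟨η, hη⟩ : ∃ η, η = (δ - δ₁) / 2 := ⟨_, rfl⟩
  have hη₀ : 0 < η := by linarith
  obtain ⟨J, hJ⟩ := exists_nat_ge (8 / η)
  -- What depends on `δ'` and `B`, in particular the number `J` of final phases, is absorbed by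
  -- making log log n large, so it does not enter `C`.
  obtain ⟨n₀, hn₀⟩ := MPC.eventually_large hη₀ (|B| ^ 2)
    (2 + A + 2 * T + 10 * A + 5 * A * J) (128 * 2 ^ T + 8)
  refine ⟨n₀, fun n α hn hα hαB => ?_⟩
  obtain ⟨hn1, hn2, hn3, hn4⟩ := hn₀ n hn
  have hnpos : 0 < n := by omega
  have hnge : (1 : ℝ) ≤ n := by exact_mod_cast hnpos
  have hαB' : (α : ℝ) ≤ |B| * (n : ℝ) ^ (δ₁ / 2) := by
    refine hαB.trans ?_
    gcongr
    exact le_abs_self B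
  -- With this cap 4^E is at most n^η; together with B² ≤ n^η and 2η = δ - δ₁ this keeps α²·4^E
  -- below n^δ.
  obtain ⟨E, hE⟩ : ∃ E, E = ⌊η / 2 * Real.log n⌋₊ := ⟨_, rfl⟩
  have hE1 : (E : ℝ) ≤ η / 2 * Real.log n := hE ▸ Nat.floor_le (by positivity)
  have hE2 : η / 2 * Real.log n < E + 1 := hE ▸ Nat.lt_floor_add_one _
  have hαE : (α : ℝ) ^ 2 * 4 ^ E ≤ (n : ℝ) ^ δ :=
    MPC.sq_mul_four_pow_le hnpos (hη ▸ hn2) hαB' (by rw [← hη]; linarith)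
  have hαn : (α : ℝ) ^ 2 ≤ (n : ℝ) ^ δ :=
    (le_mul_of_one_le_right (by positivity) (one_le_pow₀ (by norm_num))).trans hαE
  obtain ⟨M, b, Q, hQT, hQp, hb, hMb, h1, h2, h3, hS, hMS⟩ :=
    MPC.exists_setup hδ₀ hδ₁ k (C := C) hT hp (by omega) hn1 hα hαn
  have : NeZero M := ⟨Q.M_pos.ne'⟩
  have hS' : ((16 * b : ℕ) : ℝ) ≤ C * (n : ℝ) ^ δ := by
    refine hS.trans ?_
    have h : ((2048 * 2 ^ T : ℕ) : ℝ) ≤ C := by exact_mod_cast (by omega : 2048 * 2 ^ T ≤ C)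
    push_cast at h
    gcongr
  have hMS' : M * (16 * b) ≤ C * (n * α ^ 2) :=
    hMS.trans (Nat.mul_le_mul_right _ (by omega))
  have hloglog : 0 ≤ Real.log (Real.log n) := Real.log_nonneg (by linarith)
  have hα2 : n * α ≤ n * α ^ 2 := Nat.mul_le_mul_left _ (by nlinarith)
  rcases Nat.lt_or_ge k 2 with hk | hk
  · obtain ⟨P, hP⟩ := MPC.exists_program_of_le_one (n := n) (M := M) (α := α) (β := b)
      (S := 16 * b) (W := n ^ C) (Nat.le_of_lt_succ hk) Q.b_pos (by omega) (by omega)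
      (Nat.le_self_pow (by omega) n)
    exact ⟨M, 16 * b, 0, P, hS', hMS', by simpa using by positivity, hP⟩
  · obtain ⟨I, hI⟩ : ∃ I, I = 2 * Nat.clog 2 (E + 1) + J := ⟨_, rfl⟩
    have hbE : 48 * α ^ 2 * 4 ^ E ≤ b := by
      have h : (48 : ℝ) * α ^ 2 * 4 ^ E ≤ b := by nlinarith
      exact_mod_cast h
    obtain ⟨P, hP⟩ := Q.exists_program (k := k) (E := E) (α := α) (I := I) rfl hk hα hbE hMb
      (hI ▸ MPC.lt_two_pow_gain hη₀ (by linarith) hE2 hJ) h1 h2 h3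
    refine ⟨M, 16 * b, Q.totalRounds I, P, hS', hMS', ?_, hP⟩
    have hclog := MPC.clog_le (L := Real.log n) (E := E) (by linarith) (by nlinarith)
    have hR : Q.totalRounds I = 2 + A + 2 * T + 5 * A * I := by
      simp only [MPC.Setup.totalRounds, MPC.Setup.sortRounds, hQT, hQp, ← hA]
      ring
    have hCA : (20 * A + 1 : ℝ) ≤ C := by exact_mod_cast (by omega : 20 * A + 1 ≤ C)
    have hIr : (I : ℝ) ≤ 2 * (2 * Real.log (Real.log n) + 1) + J := by
      rw [hI]
      push_cast
      linarith
    rw [hR]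
    push_cast
    calc (2 + A + 2 * T + 5 * A * I : ℝ)
        ≤ 2 + A + 2 * T + 5 * A * (2 * (2 * Real.log (Real.log n) + 1) + J) := by gcongr
      _ = (2 + A + 2 * T + 10 * A + 5 * A * J) + 20 * A * Real.log (Real.log n) := by ring
      _ ≤ (20 * A + 1) * Real.log (Real.log n) := by linarith
      _ ≤ C * Real.log (Real.log n) := by gcongr
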